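/- Let $d\ge 1$ be an integer and let $\alpha\in\mathbb R$, $\beta>0$, $\lambda>0$ satisfy $\min\{\alpha,\alpha\beta\}>d$. Let $\kappa(t,x,y)=1-\exp\left(-\lambda xy/t^{\alpha}\right)$, and let $\|\cdot\|$ be the Euclidean norm on $\mathbb R^d$. **Finite graphs.** For $n\ge 1$ let $X^{(n)}_1,\dots,X^{(n)}_n$ be i.i.d. uniform on $[-\tfrac12,\tfrac12]^d$, let $W^{(n)}_1,\dots,W^{(n)}_n$ be i.i.d. with $\mathbb P(W^{(n)}_i>w)=w^{-\beta}$ for $w>1$, independent of the $X^{(n)}_i$, and put $Y^{(n)}_i=n^{1/d}X^{(n)}_i$. Let $\mathbb G_n$ be the blown-up finite continuum scale-free percolation (CSFP) graph: the random graph with vertex set $\{1,\dots,n\}$ in which, conditionally on locations and weights, the edges $\{i,j\}$ are present independently with probabilities $\kappa\big(\|Y^{(n)}_i-Y^{(n)}_j\|,W^{(n)}_i,W^{(n)}_j\big)$. **Infinite graph.** Let $Y_0=\mathbf 0$, let $(Y_i)_{i\ge1}$ be an enumeration of the atoms of a unit-rate homogeneous Poisson point process on $\mathbb R^d$, and let $(W_i)_{i\ge0}$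 be i.i.d. with $\mathbb P(W_i>w)=w^{-\beta}$ for $w>1$, independent of $(Y_i)_{i\ge 0}$. Let $\mathbb G_\infty$ be the infinite CSFP graph: the random graph with vertex set $\{0,1,2,\dots\}$ in which, conditionally on locations and weights, the edges $\{i,j\}$ are present independently with probabilities $\kappa(\|Y_i-Y_j\|,W_i,W_j)$. It is rooted at $0$. Then $(\mathbb G_n)_{n\ge1}$ converges locally in probability to $(\mathbb G_\infty,0)$ as $n\to\infty$. That is, $\mathbb G_\infty$ is almost surely locally finite, and for every $r>0$ and every locally finite rooted graph $(H,h)$, $$\frac1n\sum_{i=1}^n \mathbf 1\left\{B^{\mathbb G_n}_i(r)\cong(H,h)\right\}\ \longrightarrow\ \mathbb P\left(B^{\mathbb G_\infty}_0(r)\cong(H,h)\right)\quad\text{in probability,}$$ where $B^{G}_v(r)$ is the subgraph of $G$ induced by the vertices at graph distance at most $r$ from $v$, rooted at $v$, and $\cong$ denotes rooted isomorphism. -/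

import Mathlib

open MeasureTheory ProbabilityTheory Filter Topology
open scoped NNReal ENNReal

namespace CSFP

/-- The vertices at graph distance at most `r` from `o` in `G`. -/
def ball {V : Type*} (G : SimpleGraph V) (o : V) (r : ℝ≥0) : Set V :=
  {v | G.Reachable o v ∧ (G.dist o v : ℝ≥0) ≤ r}

theorem mem_ball_self {V : Type*} (G : SimpleGraph V) (o : V) (r : ℝ≥0) : o ∈ ball G o r :=
  ⟨SimpleGraph.Reachable.refl o, by simp⟩

/-- Rooted isomorphism of rooted graphs. -/
def RootedIso {V V' : Type*} (G : SimpleGraph V) (o : V) (H : SimpleGraph V') (h : V') : Prop :=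
  ∃ φ : G ≃g H, φ o = h

/-- The `r`-neighbourhood of `o` in `G`, that is the subgraph of `G` induced by the ball of radius
`r` around `o`, rooted at `o`, is rooted isomorphic to `(H, h)`. -/
def NbhdIso {V V' : Type*} (G : SimpleGraph V) (o : V) (r : ℝ≥0)
    (H : SimpleGraph V') (h : V') : Prop :=
  RootedIso (G.induce (ball G o r)) ⟨o, mem_ball_self G o r⟩ H h

/-- Every vertex has finite degree. -/
def LocFinite {V : Type*} (G : SimpleGraph V) : Prop :=
  ∀ v, (G.neighborSet v).Finite

/-- Convergence locally in probability of the random finite graphs `G n` (each defined on its own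
probability space) to the random rooted graph `(Glim, o)`: the limit is almost surely a locally
finite rooted graph, and for every radius `r > 0` and every locally finite rooted graph `(H, h)`
the proportion of vertices of `G n` whose `r`-neighbourhood is isomorphic to `(H, h)` converges in
probability to the probability that the `r`-neighbourhood of `o` in `Glim` is isomorphic to
`(H, h)`. Neighbourhoods in locally finite graphs are finite, so it is enough to let the vertex
set of `H` range over `Type`. -/
def ConvergesLocallyInProbability {V : ℕ → Type*} [∀ n, Fintype (V n)]
    {Ω : ℕ → Type*} [∀ n, MeasurableSpace (Ω n)] (P : ∀ n, Measure (Ω n))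
    (G : ∀ n, Ω n → SimpleGraph (V n))
    {V' Ω' : Type*} [MeasurableSpace Ω'] (Q : Measure Ω') (Glim : Ω' → SimpleGraph V') (o : V') :
    Prop :=
  (∀ᵐ ω ∂Q, LocFinite (Glim ω)) ∧
  ∀ r : ℝ≥0, 0 < r → ∀ (U : Type) (H : SimpleGraph U) (h : U), LocFinite H →
    ∀ ε : ℝ, 0 < ε →
      Tendsto (fun n ↦ P n {ω | ε ≤
          |({i : V n | NbhdIso (G n ω) i r H h}.ncard : ℝ) / (Fintype.card (V n) : ℝ)
            - Q.real {ω' | NbhdIso (Glim ω') o r H h}|})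
        atTop (𝓝 0)

/-- `G` is a spatial inhomogeneous random graph with locations `Y`, weights `W` and connection
function `κ`: conditionally on `(Y, W)`, the edges `{i, j}` are present independently, with
probability `κ ‖Y i - Y j‖ (W i) (W j)`. That is, for every finite set `F` of pairs, the
conditional probability that all the edges in `F` are present is the product of these numbers.
An unordered pair is represented by the ordered pair `(i, j)` with `i < j`. -/
structure IsSIRG {V : Type*} [LinearOrder V] {Ω : Type*} [MeasurableSpace Ω] (P : Measure Ω)
    {d : ℕ} (κ : ℝ → ℝ → ℝ → ℝ) (Y : V → Ω → EuclideanSpace ℝ (Fin d)) (W : V → Ω → ℝ)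
    (G : Ω → SimpleGraph V) : Prop where
  measurable_location : ∀ i, Measurable (Y i)
  measurable_weight : ∀ i, Measurable (W i)
  measurable_adj : ∀ i j, MeasurableSet {ω | (G ω).Adj i j}
  condProb_edges : ∀ F : Finset (V × V), (∀ e ∈ F, e.1 < e.2) →
    P⟦{ω | ∀ e ∈ F, (G ω).Adj e.1 e.2} |
        MeasurableSpace.comap (fun ω ↦ ((fun i ↦ Y i ω), (fun i ↦ W i ω))) inferInstance⟧
      =ᵐ[P] fun ω ↦ ∏ e ∈ F, κ ‖Y e.1 ω - Y e.2 ω‖ (W e.1 ω) (W e.2 ω)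

/-- `W` is a family of i.i.d. Pareto variables: `P (W i > w) = w ^ (-β)` for `w > 1`. -/
def IsIIDPareto {V Ω : Type*} [MeasurableSpace Ω] (P : Measure Ω) (β : ℝ) (W : V → Ω → ℝ) :
    Prop :=
  (∀ i, HasLaw (W i) (paretoMeasure 1 β) P) ∧ iIndepFun W P

/-- The random measure `Γ` is a Poisson point process with intensity measure `ν`. -/
structure IsPoissonProcess {E Ω : Type*} [MeasurableSpace E] [MeasurableSpace Ω] (P : Measure Ω)
    (ν : Measure E) (Γ : Ω → Measure E) : Prop where
  law : ∀ A : Set E, MeasurableSet A → ν A ≠ ∞ →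
    HasLaw (fun ω ↦ Γ ω A) ((poissonMeasure (ν A).toNNReal).map (fun k : ℕ ↦ (k : ℝ≥0∞))) P
  indep : ∀ (k : ℕ) (A : Fin k → Set E), (∀ j, MeasurableSet (A j)) →
    Pairwise (fun i j ↦ Disjoint (A i) (A j)) → iIndepFun (fun j ω ↦ Γ ω (A j)) P

/-- The connection function of continuum scale-free percolation. -/
noncomputable def kernel (α lam : ℝ) (t x y : ℝ) : ℝ :=
  1 - Real.exp (-(lam * x * y / t ^ α))

/-- The box `[-1/2, 1/2]^d`. -/
def unitBox (d : ℕ) : Set (EuclideanSpace ℝ (Fin d)) :=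
  {x | ∀ k, x k ∈ Set.Icc (-(1 / 2) : ℝ) (1 / 2)}

/-- `G` is a blown-up finite CSFP graph on `n` vertices: the locations before blow-up `X i` are
i.i.d. uniform on the unit box, the weights `W i` are i.i.d. Pareto and independent of the
locations, and `G` is the SIRG with the blown-up locations `n ^ (1 / d) X i`. -/
structure IsFiniteCSFP {Ω : Type*} [MeasurableSpace Ω] (P : Measure Ω) (d : ℕ) (α β lam : ℝ)
    (n : ℕ) (X : Fin n → Ω → EuclideanSpace ℝ (Fin d)) (W : Fin n → Ω → ℝ)
    (G : Ω → SimpleGraph (Fin n)) : Prop where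
  uniform : ∀ i, pdf.IsUniform (X i) (unitBox d) P volume
  indep_location : iIndepFun X P
  pareto : IsIIDPareto P β W
  indep : IndepFun (fun ω i ↦ X i ω) (fun ω i ↦ W i ω) P
  sirg : IsSIRG P (kernel α lam) (fun i ω ↦ (n : ℝ) ^ (1 / d : ℝ) • X i ω) W G

/-- `G` is an infinite CSFP graph, to be rooted at the vertex `0`: the vertex `0` is located at the
origin, the locations of the vertices `1, 2, …` are the atoms of a unit-rate homogeneous Poisson
point process, and the weights are i.i.d. Pareto and independent of the locations. -/
structure IsInfiniteCSFP {Ω : Type*} [MeasurableSpace Ω] (P : Measure Ω) (d : ℕ) (α β lam : ℝ)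
    (Y : ℕ → Ω → EuclideanSpace ℝ (Fin d)) (W : ℕ → Ω → ℝ) (G : Ω → SimpleGraph ℕ) : Prop where
  root : ∀ ω, Y 0 ω = 0
  poisson : IsPoissonProcess P volume (fun ω ↦ Measure.sum fun i : ℕ ↦ Measure.dirac (Y (i + 1) ω))
  pareto : IsIIDPareto P β W
  indep : IndepFun (fun ω i ↦ Y i ω) (fun ω i ↦ W i ω) P
  sirg : IsSIRG P (kernel α lam) Y W G

end CSFP

/-! The proof is a second moment argument. Fix `(H, h)` and let `A_i` be the event that the
`r`-neighbourhood of the vertex `i` of the finite graph is `(H, h)`, and `p` the probability of the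
same event for the root of the infinite graph. By Chebyshev's inequality
(`mul_measureReal_proportion_le`) it suffices that `P(A_i) ≥ p - o(1)` and `P(A_i ∩ A_j) ≤ p² +
o(1)` uniformly in `i ≠ j`.

Lower bounds alone give both. Let `c`, `c'` range over `True` and `False`, selecting an event or its
complement. Each of the four joint outcomes at `(i, j)` has probability at least the product of the
two limit probabilities, up to `o(1)` (`eventually_mul_le_measure`). The four products add up to at
least one, so bounding three outcomes from below bounds the fourth from above. Hence the infinite
graph is only ever estimated from above and the finite graphs from below, and measurability of
neighbourhood events in the infinite graph is never needed.

Localisation. The hypothesis on `α`, `β` provides `γ ≤ 1` with `γ < β` and `α γ > d`. Since `1 - exp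
(-x) ≤ x ^ γ`, an edge of length `t ≥ 1` has probability at most a constant times `(1 + t) ^ (-α γ)`
after averaging over the weights: the moment of order `γ` is finite and the decay is integrable. So
the infinite graph is almost surely locally finite, its neighbourhoods lie within some distance `K`
of the root up to small probability, and for large `M` an edge from the `K`-ball to the outside of
the `M`-ball is unlikely. Without such an edge the neighbourhood can be read off from the graph
spanned by the vertices in the `M`-ball.

Comparison. Given the locations of `s + 1` vertices, the probability that their spanned graph has
the required property is a translation invariant function (`propWeight`). With `s` Poisson points in
the `M`-ball this contributes `exp (-|B_M|) / s!` times an integral (`limitWeight`). In the box, one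
chooses disjoint sets of `s` and `t` vertices for the two `M`-balls and makes all other vertices
avoid both balls. Binomial coefficients against powers of `n`, and `(1 - 2|B_M|/n) ^ n`, give in the
limit the product of the two Poisson contributions (`tendsto_patternBound`), because two uniform
roots are typically far from each other and from the boundary. -/

namespace CSFP

/-! ### Balls in graphs and their behaviour under pullback to a tuple of vertices -/

section Graph

variable {V A U : Type*}

theorem mem_ball_iff_exists_walk {G : SimpleGraph V} {o v : V} {r : ℝ≥0} :
    v ∈ ball G o r ↔ ∃ p : G.Walk o v, (p.length : ℝ≥0) ≤ r := by
  constructor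
  · rintro ⟨h, hr⟩
    obtain ⟨p, hp⟩ := h.exists_walk_length_eq_dist
    exact ⟨p, by rwa [hp]⟩
  · rintro ⟨p, hp⟩
    exact ⟨⟨p⟩, le_trans (by exact_mod_cast SimpleGraph.dist_le p) hp⟩

/-- Graph distances are integers. Passing to natural radii makes induction on the radius possible.
-/
theorem ball_eq_ball_floor (G : SimpleGraph V) (o : V) (r : ℝ≥0) :
    ball G o r = ball G o (⌊r⌋₊ : ℝ≥0) := by
  ext v
  simp only [mem_ball_iff_exists_walk, Nat.cast_le]
  exact exists_congr fun p ↦ (Nat.le_floor_iff zero_le).symm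

theorem mem_ball_zero {G : SimpleGraph V} {o v : V} : v ∈ ball G o (0 : ℕ) ↔ v = o := by
  rw [mem_ball_iff_exists_walk]
  constructor
  · rintro ⟨p, hp⟩
    have : p.length = 0 := by simpa using hp
    exact (SimpleGraph.Walk.eq_of_length_eq_zero this).symm
  · rintro rfl
    exact ⟨SimpleGraph.Walk.nil, by simp⟩

theorem mem_ball_succ {G : SimpleGraph V} {o v : V} {k : ℕ} :
    v ∈ ball G o ((k + 1 : ℕ) : ℝ≥0) ↔
      v ∈ ball G o (k : ℝ≥0) ∨ ∃ u ∈ ball G o (k : ℝ≥0), G.Adj u v := by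
  simp only [mem_ball_iff_exists_walk, Nat.cast_le]
  constructor
  · rintro ⟨p, hp⟩
    by_cases h : p.length ≤ k
    · exact Or.inl ⟨p, h⟩
    · have hlen : p.reverse.length = k + 1 := by
        rw [SimpleGraph.Walk.length_reverse]; omega
      right
      -- The last edge of `p` is the first edge of its reverse, where `cases` can split it off.
      generalize p.reverse = q at hlen
      cases q with
      | nil => simp at hlen
      | cons hadj q =>
        refine ⟨_, ⟨q.reverse, ?_⟩, hadj.symm⟩
        simpa using Nat.le_of_eq hlen
  · rintro (⟨p, hp⟩ | ⟨u, ⟨p, hp⟩, hadj⟩)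
    · exact ⟨p, by omega⟩
    · exact ⟨p.concat hadj, by simpa using hp⟩

theorem ball_mono (G : SimpleGraph V) (o : V) {r s : ℝ≥0} (h : r ≤ s) :
    ball G o r ⊆ ball G o s := fun _ hv ↦ ⟨hv.1, hv.2.trans h⟩

theorem finite_ball {G : SimpleGraph V} (hG : LocFinite G) (o : V) (r : ℝ≥0) :
    (ball G o r).Finite := by
  rw [ball_eq_ball_floor]
  induction ⌊r⌋₊ with
  | zero => exact (Set.finite_singleton o).subset fun v hv ↦ mem_ball_zero.1 hv
  | succ k ih =>
    refine (ih.union (ih.biUnion fun u _ ↦ hG u)).subset fun v hv ↦ ?_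
    rcases mem_ball_succ.1 hv with h | ⟨u, hu, hadj⟩
    · exact Or.inl h
    · exact Or.inr (Set.mem_biUnion hu hadj)

/-- A walk of length at most `r` from `σ a` visits only vertices of the ball. These all lie in the
range of `σ`, so the walk lifts. -/
theorem ball_comap {G : SimpleGraph V} {σ : A → V} (hσ : Function.Injective σ) {a : A} {r : ℝ≥0}
    (h : ball G (σ a) r ⊆ Set.range σ) :
    ball (G.comap σ) a r = σ ⁻¹' ball G (σ a) r := by
  rw [ball_eq_ball_floor] at h ⊢
  rw [ball_eq_ball_floor G]
  have key : ∀ k ≤ ⌊r⌋₊, ball (G.comap σ) a (k : ℝ≥0) = σ ⁻¹' ball G (σ a) (k : ℝ≥0) := by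
    intro k
    induction k with
    | zero =>
      intro _
      ext v
      rw [mem_ball_zero, Set.mem_preimage, mem_ball_zero, hσ.eq_iff]
    | succ k ih =>
      intro hk
      have ih := ih (by omega)
      ext v
      rw [mem_ball_succ, Set.mem_preimage, mem_ball_succ, ih]
      refine or_congr Iff.rfl ⟨?_, ?_⟩
      · rintro ⟨u, hu, hadj⟩
        exact ⟨σ u, hu, hadj⟩
      · rintro ⟨u, hu, hadj⟩
        obtain ⟨u, rfl⟩ := h (ball_mono G _ (Nat.cast_le.2 (by omega)) hu)
        exact ⟨u, hu, hadj⟩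
  exact key _ le_rfl

/-- The ball of `G` stays inside the range of `σ` when the ball of the pulled back graph lies in a
set without edges leading out of the range. -/
theorem ball_subset_range {G : SimpleGraph V} {σ : A → V} {a : A} {r : ℝ≥0} {S : Set V}
    (h : σ '' ball (G.comap σ) a r ⊆ S) (hS : ∀ u ∈ S, ∀ v, G.Adj u v → v ∈ Set.range σ) :
    ball G (σ a) r ⊆ Set.range σ := by
  rw [ball_eq_ball_floor] at h ⊢
  -- Lifting into the ball of the pullback, and not merely into the range, places each predecessor
  -- in `S`, so that `hS` applies to the next edge.
  have key : ∀ k ≤ ⌊r⌋₊, ball G (σ a) (k : ℝ≥0) ⊆ σ '' ball (G.comap σ) a (k : ℝ≥0) := by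
    intro k
    induction k with
    | zero =>
      intro _ v hv
      exact ⟨a, mem_ball_zero.2 rfl, (mem_ball_zero.1 hv).symm⟩
    | succ k ih =>
      intro hk v hv
      have ih := ih (by omega)
      rcases mem_ball_succ.1 hv with hv | ⟨u, hu, hadj⟩
      · exact Set.image_mono (ball_mono _ _ (Nat.cast_le.2 (by omega))) (ih hv)
      · obtain ⟨x, hx, rfl⟩ := ih hu
        have hmem : σ x ∈ S := h ⟨x, ball_mono _ _ (Nat.cast_le.2 (by omega)) hx, rfl⟩
        obtain ⟨w, rfl⟩ := hS _ hmem _ hadj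
        exact ⟨w, mem_ball_succ.2 (Or.inr ⟨x, hx, hadj⟩), rfl⟩
  exact (key _ le_rfl).trans (Set.image_subset_range _ _)

theorem RootedIso.congr_left {V₁ V₂ : Type*} {G₁ : SimpleGraph V₁} {o₁ : V₁}
    {G₂ : SimpleGraph V₂} {o₂ : V₂} (e : G₁ ≃g G₂) (he : e o₁ = o₂) (H : SimpleGraph U) (h : U) :
    RootedIso G₁ o₁ H h ↔ RootedIso G₂ o₂ H h := by
  subst he
  constructor
  · rintro ⟨φ, hφ⟩
    exact ⟨e.symm.trans φ, by simpa using hφ⟩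
  · rintro ⟨φ, hφ⟩
    exact ⟨e.trans φ, hφ⟩

/-- This replaces a large or infinite graph by one on `Fin (s + 1)`, for which there are only
finitely many possibilities. -/
theorem nbhdIso_comap_iff {G : SimpleGraph V} {σ : A → V} (hσ : Function.Injective σ) {a : A}
    {r : ℝ≥0} (h : ball G (σ a) r ⊆ Set.range σ) (H : SimpleGraph U) (u : U) :
    NbhdIso (G.comap σ) a r H u ↔ NbhdIso G (σ a) r H u := by
  have hb := ball_comap hσ h
  refine RootedIso.congr_left
    { toEquiv := Equiv.ofBijective
        (fun x : ball (G.comap σ) a r ↦ (⟨σ x, hb.subset x.2⟩ : ball G (σ a) r)) ⟨?_, ?_⟩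
      map_rel_iff' := ?_ } ?_ H u
  · intro x y hxy
    exact Subtype.ext (hσ (congrArg Subtype.val hxy))
  · rintro ⟨v, hv⟩
    obtain ⟨x, rfl⟩ := h hv
    exact ⟨⟨x, by rw [hb]; exact hv⟩, rfl⟩
  · intro x y
    rfl
  · rfl

end Graph

/-! ### Estimates for the kernel, Pareto moments and spatial decay -/

theorem one_sub_exp_neg_le_rpow {x γ : ℝ} (hx : 0 ≤ x) (hγ0 : 0 < γ) (hγ1 : γ ≤ 1) :
    1 - Real.exp (-x) ≤ x ^ γ := by
  rcases le_total x 1 with h | h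
  · calc 1 - Real.exp (-x) ≤ x := by linarith [Real.add_one_le_exp (-x)]
      _ = x ^ (1 : ℝ) := (Real.rpow_one x).symm
      _ ≤ x ^ γ := Real.rpow_le_rpow_of_exponent_ge' hx h hγ0.le hγ1
  · calc 1 - Real.exp (-x) ≤ 1 := by linarith [Real.exp_pos (-x)]
      _ ≤ x ^ γ := Real.one_le_rpow h hγ0.le

theorem kernel_nonneg {α lam t x y : ℝ} (hlam : 0 < lam) (ht : 0 ≤ t) (hx : 0 ≤ x) (hy : 0 ≤ y) :
    0 ≤ kernel α lam t x y := by
  have : 0 ≤ lam * x * y / t ^ α := by positivity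
  have := Real.exp_le_one_iff.2 (neg_nonpos.2 this)
  unfold kernel
  linarith

theorem kernel_le_one {α lam t x y : ℝ} : kernel α lam t x y ≤ 1 := by
  unfold kernel
  linarith [Real.exp_pos (-(lam * x * y / t ^ α))]

theorem kernel_comm {α lam t x y : ℝ} : kernel α lam t x y = kernel α lam t y x := by
  unfold kernel
  congr 4
  ring

@[fun_prop]
theorem measurable_kernel {X : Type*} [MeasurableSpace X] {α lam : ℝ} {f g h : X → ℝ}
    (hf : Measurable f) (hg : Measurable g) (hh : Measurable h) :
    Measurable fun x ↦ kernel α lam (f x) (g x) (h x) := by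
  unfold kernel
  fun_prop

/-- The exponent `γ` trades decay in the distance against the moment required of the weights.
Replacing `t` by `1 + t` costs the factor `2 ^ (α * γ)`, as `t ≥ 1`, and removes the singularity at
zero. -/
theorem kernel_le {α lam γ t x y : ℝ} (hα : 0 < α) (hlam : 0 < lam) (hγ0 : 0 < γ) (hγ1 : γ ≤ 1)
    (ht : 1 ≤ t) (hx : 0 ≤ x) (hy : 0 ≤ y) :
    kernel α lam t x y ≤ lam ^ γ * 2 ^ (α * γ) * x ^ γ * y ^ γ * (1 + t) ^ (-(α * γ)) := by
  have ht0 : 0 < t := by linarith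
  refine (one_sub_exp_neg_le_rpow (by positivity) hγ0 hγ1).trans ?_
  rw [Real.div_rpow (by positivity) (by positivity), Real.mul_rpow (by positivity) hy,
    Real.mul_rpow hlam.le hx, ← Real.rpow_mul ht0.le]
  have h1 : (t ^ (α * γ))⁻¹ ≤ 2 ^ (α * γ) * (1 + t) ^ (-(α * γ)) := by
    rw [Real.rpow_neg (by positivity), ← div_eq_mul_inv, ← one_div,
      div_le_div_iff₀ (by positivity) (by positivity), one_mul,
      ← Real.mul_rpow (by norm_num) ht0.le]
    exact Real.rpow_le_rpow (by positivity) (by linarith) (by positivity)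
  calc lam ^ γ * x ^ γ * y ^ γ / t ^ (α * γ)
      = lam ^ γ * x ^ γ * y ^ γ * (t ^ (α * γ))⁻¹ := div_eq_mul_inv _ _
    _ ≤ lam ^ γ * x ^ γ * y ^ γ * (2 ^ (α * γ) * (1 + t) ^ (-(α * γ))) := by gcongr
    _ = _ := by ring

theorem ae_one_le_paretoMeasure (β : ℝ) : ∀ᵐ x ∂paretoMeasure 1 β, 1 ≤ x := by
  rw [ae_iff]
  simp only [not_le]
  change paretoMeasure 1 β (Set.Iio 1) = 0
  rw [paretoMeasure, withDensity_apply _ measurableSet_Iio]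
  exact lintegral_paretoPDF_of_le le_rfl

theorem lintegral_rpow_paretoMeasure_lt_top {β γ : ℝ} (h : γ < β) :
    ∫⁻ x, ENNReal.ofReal (x ^ γ) ∂paretoMeasure 1 β < ∞ := by
  have hm : Measurable (paretoPDF 1 β) := (measurable_paretoPDFReal 1 β).ennreal_ofReal
  have hm' : Measurable fun x : ℝ ↦ ENNReal.ofReal (x ^ γ) := by fun_prop
  rw [paretoMeasure, lintegral_withDensity_eq_lintegral_mul _ hm hm',
    ← lintegral_add_compl _ (measurableSet_Ici (a := (1 : ℝ)))]
  have h0 : ∫⁻ x in (Set.Ici (1 : ℝ))ᶜ, (paretoPDF 1 β * fun x ↦ ENNReal.ofReal (x ^ γ)) x = 0 := by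
    rw [setLIntegral_congr_fun (g := 0) measurableSet_Ici.compl fun x hx ↦ ?_]
    · simp
    · simp [paretoPDF_of_lt (not_le.1 hx)]
  rw [h0, add_zero, setLIntegral_congr_fun (g := fun x ↦ ENNReal.ofReal (β * x ^ (γ - β - 1)))
    measurableSet_Ici fun x (hx : 1 ≤ x) ↦ ?_]
  · have := integrableOn_Ioi_rpow_of_lt (a := γ - β - 1) (by linarith) one_pos
    rw [← integrableOn_Ici_iff_integrableOn_Ioi] at this
    exact (this.const_mul β).lintegral_lt_top
  · have hx0 : 0 < x := by linarith
    rw [Pi.mul_apply, paretoPDF_of_le hx, ← ENNReal.ofReal_mul' (by positivity), Real.one_rpow,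
      mul_one, mul_assoc, ← Real.rpow_add hx0]
    ring_nf

/-- The integrable decay function `z ↦ (1 + ‖z‖) ^ (-a)`. -/
noncomputable def decay {E : Type*} [Norm E] (a : ℝ) (z : E) : ℝ≥0∞ :=
  ENNReal.ofReal ((1 + ‖z‖) ^ (-a))

@[fun_prop]
theorem measurable_decay {E : Type*} [NormedAddCommGroup E] [MeasurableSpace E] [BorelSpace E]
    (a : ℝ) : Measurable (decay a : E → ℝ≥0∞) := by
  unfold decay
  fun_prop

theorem lintegral_decay_lt_top {d : ℕ} {a : ℝ} (ha : d < a) :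
    ∫⁻ z : EuclideanSpace ℝ (Fin d), decay a z < ∞ :=
  (integrable_one_add_norm (by simpa using ha)).lintegral_lt_top

/-- Continuity from above for the finite measure with density `decay a`: the complements of balls
decrease to the empty set. -/
theorem tendsto_setLIntegral_decay {d : ℕ} {a : ℝ} (ha : d < a) :
    Tendsto (fun R : ℝ ↦ ∫⁻ z in {z : EuclideanSpace ℝ (Fin d) | R < ‖z‖}, decay a z)
      atTop (𝓝 0) := by
  have hm : ∀ R : ℝ, MeasurableSet {z : EuclideanSpace ℝ (Fin d) | R < ‖z‖} := fun R ↦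
    measurableSet_lt measurable_const measurable_norm
  simp_rw [← fun R ↦ withDensity_apply (μ := (volume : Measure (EuclideanSpace ℝ (Fin d))))
    (decay a) (hm R)]
  have hfin : IsFiniteMeasure ((volume : Measure (EuclideanSpace ℝ (Fin d))).withDensity
    (decay a)) := isFiniteMeasure_withDensity (lintegral_decay_lt_top ha).ne
  have hinter : ⋂ R : ℝ, {z : EuclideanSpace ℝ (Fin d) | R < ‖z‖} = ∅ := by
    ext z
    simp only [Set.mem_iInter, Set.mem_ofPred_eq, Set.mem_empty_iff_false, iff_false, not_forall]
    exact ⟨‖z‖, lt_irrefl _⟩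
  have := tendsto_measure_iInter_atTop (μ := (volume : Measure (EuclideanSpace ℝ (Fin d))).withDensity
    (decay a)) (fun R ↦ (hm R).nullMeasurableSet)
    (fun R S hRS z hz ↦ lt_of_le_of_lt hRS hz) ⟨0, measure_ne_top _ _⟩
  rwa [hinter, measure_empty] at this

/-- Here `‖x‖ ≤ ‖y‖ / 2`, so `‖x - y‖ ≥ ‖y‖ / 2` and `1 + ‖y‖ ≤ 2 * (1 + ‖x - y‖)`. -/
theorem decay_sub_le {E : Type*} [NormedAddCommGroup E] {a R : ℝ} (ha : 0 < a) {x y : E}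
    (hx : ‖x‖ ≤ R) (hy : 2 * R ≤ ‖y‖) :
    decay a (x - y) ≤ ENNReal.ofReal (2 ^ a) * decay a y := by
  unfold decay
  rw [← ENNReal.ofReal_mul (by positivity)]
  refine ENNReal.ofReal_le_ofReal ?_
  have h1 : ‖y‖ - ‖x‖ ≤ ‖x - y‖ := by rw [norm_sub_rev]; exact norm_sub_norm_le y x
  have h0 : 0 ≤ ‖x‖ := norm_nonneg _
  rw [Real.rpow_neg (by positivity), Real.rpow_neg (by positivity), ← one_div, ← div_eq_mul_inv,
    div_le_div_iff₀ (by positivity) (by positivity), one_mul,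
    ← Real.mul_rpow (by norm_num) (by positivity)]
  exact Real.rpow_le_rpow (by positivity) (by linarith) ha.le

/-- The two halves of the hypothesis say that `d / α` is below `1` and below `β`. Any `γ` strictly
between `d / α` and `min 1 β` will do. -/
theorem exists_exponent {d : ℕ} {α β : ℝ} (hmin : (d : ℝ) < min α (α * β)) :
    ∃ γ : ℝ, 0 < γ ∧ γ ≤ 1 ∧ γ < β ∧ d < α * γ := by
  have hα : (d : ℝ) < α := hmin.trans_le (min_le_left _ _)
  have hαβ : (d : ℝ) < α * β := hmin.trans_le (min_le_right _ _)
  have hd : (0 : ℝ) ≤ d := d.cast_nonneg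
  have hα0 : 0 < α := by linarith
  have h : (d : ℝ) / α < min 1 β :=
    lt_min ((div_lt_one hα0).2 hα) ((div_lt_iff₀' hα0).2 hαβ)
  obtain ⟨γ, h1, h2⟩ := exists_between h
  refine ⟨γ, (div_nonneg hd hα0.le).trans_lt h1, (h2.trans_le (min_le_left _ _)).le,
    h2.trans_le (min_le_right _ _), (div_lt_iff₀' hα0).1 h1⟩

/-! ### Probabilities of prescribed edge patterns -/

section SIRG

variable {V : Type*} [LinearOrder V] {Ω : Type*} [MeasurableSpace Ω] {P : Measure Ω} {d : ℕ}
  {κ : ℝ → ℝ → ℝ → ℝ} {Y : V → Ω → EuclideanSpace ℝ (Fin d)} {W : V → Ω → ℝ}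
  {G : Ω → SimpleGraph V}

theorem IsSIRG.measurable_pair (h : IsSIRG P κ Y W G) :
    Measurable fun ω ↦ ((fun i ↦ Y i ω), (fun i ↦ W i ω)) :=
  (measurable_pi_lambda _ h.measurable_location).prodMk (measurable_pi_lambda _ h.measurable_weight)

theorem IsSIRG.measurableSet_pattern (h : IsSIRG P κ Y W G) (s t : Finset (V × V)) :
    MeasurableSet {ω | (∀ e ∈ s, (G ω).Adj e.1 e.2) ∧ ∀ e ∈ t, ¬(G ω).Adj e.1 e.2} := by
  have h1 : ∀ s : Finset (V × V), MeasurableSet {ω | ∀ e ∈ s, (G ω).Adj e.1 e.2} := fun s ↦ by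
    have : {ω | ∀ e ∈ s, (G ω).Adj e.1 e.2} = ⋂ e ∈ s, {ω | (G ω).Adj e.1 e.2} := by ext; simp
    rw [this]
    exact s.measurableSet_biInter fun e _ ↦ h.measurable_adj _ _
  have h2 : ∀ s : Finset (V × V), MeasurableSet {ω | ∀ e ∈ s, ¬(G ω).Adj e.1 e.2} := fun s ↦ by
    have : {ω | ∀ e ∈ s, ¬(G ω).Adj e.1 e.2} = ⋂ e ∈ s, {ω | (G ω).Adj e.1 e.2}ᶜ := by ext; simp
    rw [this]
    exact s.measurableSet_biInter fun e _ ↦ (h.measurable_adj _ _).compl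
  exact (h1 s).inter (h2 t)

/-- Only the probabilities of present edges are given. Absent edges are added one at a time: the
event that `e` is absent is the event without condition on `e` minus the event that `e` is present,
whence the induction on `t` with `s` varying. Integrability is carried along because `κ` is an
arbitrary function here. -/
theorem IsSIRG.setIntegral_pattern [IsProbabilityMeasure P] (h : IsSIRG P κ Y W G)
    (t s : Finset (V × V)) (hs : ∀ e ∈ s, e.1 < e.2) (ht : ∀ e ∈ t, e.1 < e.2)
    (hst : Disjoint s t) :
    Integrable (fun ω ↦ (∏ e ∈ s, κ ‖Y e.1 ω - Y e.2 ω‖ (W e.1 ω) (W e.2 ω)) *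
      ∏ e ∈ t, (1 - κ ‖Y e.1 ω - Y e.2 ω‖ (W e.1 ω) (W e.2 ω))) P ∧
    ∀ B, MeasurableSet B →
      P.real (((fun ω ↦ ((fun i ↦ Y i ω), (fun i ↦ W i ω))) ⁻¹' B) ∩
        {ω | (∀ e ∈ s, (G ω).Adj e.1 e.2) ∧ ∀ e ∈ t, ¬(G ω).Adj e.1 e.2}) =
      ∫ ω in (fun ω ↦ ((fun i ↦ Y i ω), (fun i ↦ W i ω))) ⁻¹' B,
        (∏ e ∈ s, κ ‖Y e.1 ω - Y e.2 ω‖ (W e.1 ω) (W e.2 ω)) *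
          ∏ e ∈ t, (1 - κ ‖Y e.1 ω - Y e.2 ω‖ (W e.1 ω) (W e.2 ω)) ∂P := by
  classical
  induction t using Finset.induction_on generalizing s with
  | empty =>
    have hc := h.condProb_edges s hs
    have hle := h.measurable_pair.comap_le
    have hms := h.measurableSet_pattern s ∅
    simp only [Finset.notMem_empty, false_imp_iff, implies_true, and_true] at hms
    simp only [Finset.prod_empty, mul_one, Finset.notMem_empty, false_imp_iff, implies_true,
      and_true]
    refine ⟨integrable_condExp.congr hc, fun B hB ↦ ?_⟩
    refine Eq.trans ?_ (setIntegral_congr_ae₀ (h.measurable_pair hB).nullMeasurableSet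
      (hc.mono fun ω hω _ ↦ hω))
    rw [setIntegral_condExp hle ((integrable_const (1 : ℝ)).indicator hms) ⟨B, hB, rfl⟩,
      setIntegral_indicator hms]
    simp
  | insert e t het ih =>
    have hes : e ∉ s := fun h' ↦ Finset.disjoint_left.1 hst h' (Finset.mem_insert_self _ _)
    have hlt := ht e (Finset.mem_insert_self _ _)
    have ht' : ∀ e ∈ t, e.1 < e.2 := fun e he ↦ ht e (Finset.mem_insert_of_mem he)
    obtain ⟨hi1, h1⟩ := ih s hs ht' (hst.mono_right (Finset.subset_insert _ _))
    obtain ⟨hi2, h2⟩ := ih (insert e s) (by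
      intro e' he'
      rcases Finset.mem_insert.1 he' with rfl | he'
      exacts [hlt, hs _ he']) ht' (by
      rw [Finset.disjoint_insert_left]
      exact ⟨het, hst.mono_right (Finset.subset_insert _ _)⟩)
    have hfun : (fun ω ↦ (∏ e ∈ s, κ ‖Y e.1 ω - Y e.2 ω‖ (W e.1 ω) (W e.2 ω)) *
        ∏ e ∈ insert e t, (1 - κ ‖Y e.1 ω - Y e.2 ω‖ (W e.1 ω) (W e.2 ω))) =
        fun ω ↦ ((∏ e ∈ s, κ ‖Y e.1 ω - Y e.2 ω‖ (W e.1 ω) (W e.2 ω)) *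
          ∏ e ∈ t, (1 - κ ‖Y e.1 ω - Y e.2 ω‖ (W e.1 ω) (W e.2 ω))) -
        ((∏ e ∈ insert e s, κ ‖Y e.1 ω - Y e.2 ω‖ (W e.1 ω) (W e.2 ω)) *
          ∏ e ∈ t, (1 - κ ‖Y e.1 ω - Y e.2 ω‖ (W e.1 ω) (W e.2 ω))) := by
      funext ω
      rw [Finset.prod_insert het, Finset.prod_insert hes]
      ring
    rw [hfun]
    refine ⟨hi1.sub hi2, fun B hB ↦ ?_⟩
    rw [integral_sub hi1.integrableOn hi2.integrableOn, ← h1 B hB, ← h2 B hB, eq_sub_iff_add_eq,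
      ← measureReal_union]
    · congr 1
      ext ω
      simp only [Finset.forall_mem_insert, Set.mem_union, Set.mem_inter_iff, Set.mem_ofPred_eq]
      tauto
    · rw [Set.disjoint_left]
      simp only [Finset.forall_mem_insert, Set.mem_inter_iff, Set.mem_ofPred_eq]
      tauto
    · exact (h.measurable_pair hB).inter (h.measurableSet_pattern _ _)

end SIRG

/-- The probability that the edge `{a, b}` is present (if `p` holds) or absent (otherwise). -/
noncomputable def edgeWeight (p : Prop) (x : ℝ) : ℝ≥0∞ :=
  open Classical in ENNReal.ofReal (if p then x else 1 - x)

section SIRG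

variable {V : Type*} [LinearOrder V] {Ω : Type*} [MeasurableSpace Ω] {P : Measure Ω} {d : ℕ}
  {α lam : ℝ} {Y : V → Ω → EuclideanSpace ℝ (Fin d)} {W : V → Ω → ℝ}
  {G : Ω → SimpleGraph V}

/-- Probability of prescribing the status of finitely many distinct edges. -/
theorem IsSIRG.measure_pattern [IsProbabilityMeasure P] (h : IsSIRG P (kernel α lam) Y W G)
    (hlam : 0 < lam) (hW : ∀ i, ∀ᵐ ω ∂P, 1 ≤ W i ω)
    {ι : Type*} (F : Finset ι) (u v : ι → V) (huv : ∀ k ∈ F, u k ≠ v k)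
    (hinj : Set.InjOn (fun k ↦ s(u k, v k)) F) (p : ι → Prop)
    {B : Set ((V → EuclideanSpace ℝ (Fin d)) × (V → ℝ))} (hB : MeasurableSet B) :
    P (((fun ω ↦ ((fun i ↦ Y i ω), (fun i ↦ W i ω))) ⁻¹' B) ∩ {ω | ∀ k ∈ F, (G ω).Adj (u k) (v k) ↔ p k}) =
      ∫⁻ ω in (fun ω ↦ ((fun i ↦ Y i ω), (fun i ↦ W i ω))) ⁻¹' B,
        ∏ k ∈ F, edgeWeight (p k)
          (kernel α lam ‖Y (u k) ω - Y (v k) ω‖ (W (u k) ω) (W (v k) ω)) ∂P := by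
  classical
  -- The conditional law is stated for pairs `i < j`, so each unordered pair is put in increasing
  -- order. The symmetry of the kernel makes this harmless.
  set e : ι → V × V := fun k ↦ (min (u k) (v k), max (u k) (v k)) with he
  have hlt : ∀ k ∈ F, (e k).1 < (e k).2 := fun k hk ↦ min_lt_max.2 (huv k hk)
  have hinj' : Set.InjOn e F := by
    intro k hk l hl hkl
    refine hinj hk hl ?_
    have : s((e k).1, (e k).2) = s((e l).1, (e l).2) := by rw [hkl]
    have key : ∀ k, s((e k).1, (e k).2) = s(u k, v k) := by
      intro k
      rcases le_total (u k) (v k) with h | h <;> simp [he, h, Sym2.eq_swap]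
    simpa only [key] using this
  have hadj : ∀ k ω, (G ω).Adj (e k).1 (e k).2 ↔ (G ω).Adj (u k) (v k) := by
    intro k ω
    rcases le_total (u k) (v k) with h | h <;> simp [he, h, SimpleGraph.adj_comm]
  have hker : ∀ k ω, kernel α lam ‖Y (e k).1 ω - Y (e k).2 ω‖ (W (e k).1 ω) (W (e k).2 ω) =
      kernel α lam ‖Y (u k) ω - Y (v k) ω‖ (W (u k) ω) (W (v k) ω) := by
    intro k ω
    rcases le_total (u k) (v k) with h | h
    · simp [he, h]
    · simp only [he, h, min_eq_right, max_eq_left]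
      rw [norm_sub_rev, kernel_comm]
  have h1 : Set.InjOn e (F.filter p) := hinj'.mono (Finset.coe_subset.2 (Finset.filter_subset _ _))
  have h2 : Set.InjOn e (F.filter fun k ↦ ¬p k) :=
    hinj'.mono (Finset.coe_subset.2 (Finset.filter_subset _ _))
  obtain ⟨hint, hpat⟩ := h.setIntegral_pattern ((F.filter fun k ↦ ¬p k).image e)
    ((F.filter p).image e) (by
      simp only [Finset.forall_mem_image, Finset.mem_filter]
      exact fun k hk ↦ hlt k hk.1) (by
      simp only [Finset.forall_mem_image, Finset.mem_filter]
      exact fun k hk ↦ hlt k hk.1) (by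
      simp only [Finset.disjoint_left, Finset.mem_image, Finset.mem_filter]
      rintro _ ⟨k, ⟨hk, hpk⟩, rfl⟩ ⟨l, ⟨hl, hpl⟩, hlk⟩
      exact hpl (hinj' hl hk hlk ▸ hpk))
  have hpat := hpat B hB
  simp only [Finset.forall_mem_image, Finset.mem_filter, Finset.prod_image h1,
    Finset.prod_image h2, hadj, hker] at hpat hint
  have hset : {ω | ∀ k ∈ F, (G ω).Adj (u k) (v k) ↔ p k} = {ω | (∀ ⦃k : ι⦄, k ∈ F ∧ p k →
      (G ω).Adj (u k) (v k)) ∧ ∀ ⦃k : ι⦄, k ∈ F ∧ ¬p k → ¬(G ω).Adj (u k) (v k)} := by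
    ext ω
    simp only [Set.mem_ofPred_eq]
    constructor
    · exact fun H ↦ ⟨fun k hk ↦ (H k hk.1).2 hk.2, fun k hk ↦ fun h' ↦ hk.2 ((H k hk.1).1 h')⟩
    · exact fun H k hk ↦ ⟨fun h' ↦ by_contra fun h'' ↦ H.2 ⟨hk, h''⟩ h', fun h' ↦ H.1 ⟨hk, h'⟩⟩
  -- The weights are at least `1` only almost surely. Nonnegativity of the kernel, needed to pass
  -- from Bochner to Lebesgue integrals, therefore also holds only almost surely.
  have hW' : ∀ᵐ ω ∂P, ∀ k ∈ F, 1 ≤ W (u k) ω ∧ 1 ≤ W (v k) ω := by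
    rw [Finset.eventually_all]
    exact fun k _ ↦ (hW _).and (hW _)
  have hnn : ∀ᵐ ω ∂P, ∀ k ∈ F,
      0 ≤ kernel α lam ‖Y (u k) ω - Y (v k) ω‖ (W (u k) ω) (W (v k) ω) :=
    hW'.mono fun ω hω k hk ↦ kernel_nonneg hlam (norm_nonneg _) (by linarith [(hω k hk).1])
      (by linarith [(hω k hk).2])
  have hnn' : ∀ᵐ ω ∂P, 0 ≤ (∏ k ∈ F with p k, kernel α lam ‖Y (u k) ω - Y (v k) ω‖ (W (u k) ω)
      (W (v k) ω)) * ∏ k ∈ F with ¬p k, (1 - kernel α lam ‖Y (u k) ω - Y (v k) ω‖ (W (u k) ω)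
      (W (v k) ω)) := by
    filter_upwards [hnn] with ω hω
    exact mul_nonneg (Finset.prod_nonneg fun k hk ↦ hω k (Finset.mem_filter.1 hk).1)
      (Finset.prod_nonneg fun k _ ↦ sub_nonneg.2 kernel_le_one)
  rw [hset, ← ENNReal.ofReal_toReal (measure_ne_top P _), ← measureReal_def, hpat,
    ofReal_integral_eq_lintegral_ofReal hint.integrableOn (ae_restrict_of_ae hnn')]
  refine lintegral_congr_ae (ae_restrict_of_ae ?_)
  filter_upwards [hnn] with ω hω
  rw [ENNReal.ofReal_mul (Finset.prod_nonneg fun k hk ↦ hω k (Finset.mem_filter.1 hk).1),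
    ENNReal.ofReal_prod_of_nonneg (fun k hk ↦ hω k (Finset.mem_filter.1 hk).1),
    ENNReal.ofReal_prod_of_nonneg (fun k _ ↦ sub_nonneg.2 kernel_le_one),
    ← Finset.prod_filter_mul_prod_filter_not F p]
  congr 1
  · exact Finset.prod_congr rfl fun k hk ↦ by simp [edgeWeight, (Finset.mem_filter.1 hk).2]
  · exact Finset.prod_congr rfl fun k hk ↦ by simp [edgeWeight, (Finset.mem_filter.1 hk).2]

end SIRG

/-! ### Integrating out the weights -/

theorem IsIIDPareto.map_comp {V A Ω : Type*} [MeasurableSpace Ω] {P : Measure Ω}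
    [IsProbabilityMeasure P] {β : ℝ} {W : V → Ω → ℝ} (hW : IsIIDPareto P β W)
    [Fintype A] {e : A → V} (he : Function.Injective e) :
    P.map (fun ω a ↦ W (e a) ω) = Measure.pi fun _ : A ↦ paretoMeasure 1 β := by
  have h := hW.2.precomp he
  rw [iIndepFun_iff_map_fun_eq_pi_map fun a ↦ (hW.1 (e a)).aemeasurable] at h
  rw [h]
  congr 1
  funext a
  exact (hW.1 (e a)).map_eq

theorem IsIIDPareto.ae_one_le {V Ω : Type*} [MeasurableSpace Ω] {P : Measure Ω}
    {β : ℝ} {W : V → Ω → ℝ} (hW : IsIIDPareto P β W) (i : V) : ∀ᵐ ω ∂P, 1 ≤ W i ω :=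
  (hW.1 i).ae_iff (p := fun x ↦ 1 ≤ x) (by measurability) |>.2 (ae_one_le_paretoMeasure β)

/-- Integrating out finitely many weights. -/
theorem lintegral_location_weight {V A Ω E : Type*} [MeasurableSpace Ω] [MeasurableSpace E]
    {P : Measure Ω} [IsProbabilityMeasure P] {β : ℝ} (hβ : 0 < β) {Y : V → Ω → E}
    {W : V → Ω → ℝ} (hYm : ∀ i, Measurable (Y i)) (hWm : ∀ i, Measurable (W i))
    (hW : IsIIDPareto P β W) (hind : IndepFun (fun ω i ↦ Y i ω) (fun ω i ↦ W i ω) P)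
    [Fintype A] {e : A → V} (he : Function.Injective e) {f : (V → E) × (A → ℝ) → ℝ≥0∞}
    (hf : Measurable f) :
    ∫⁻ ω, f (fun i ↦ Y i ω, fun a ↦ W (e a) ω) ∂P =
      ∫⁻ ω, ∫⁻ w, f (fun i ↦ Y i ω, w) ∂(Measure.pi fun _ : A ↦ paretoMeasure 1 β) ∂P := by
  have := isProbabilityMeasure_paretoMeasure one_pos hβ
  have hY : Measurable fun ω i ↦ Y i ω := measurable_pi_lambda _ hYm
  have hWe : Measurable fun ω a ↦ W (e a) ω := measurable_pi_lambda _ fun a ↦ hWm _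
  have hind' : IndepFun (fun ω i ↦ Y i ω) (fun ω a ↦ W (e a) ω) P :=
    hind.comp (φ := id) (ψ := fun (w : V → ℝ) (a : A) ↦ w (e a)) measurable_id
      (measurable_pi_lambda _ fun a ↦ measurable_pi_apply _)
  rw [indepFun_iff_map_prod_eq_prod_map_map hY.aemeasurable hWe.aemeasurable,
    hW.map_comp he] at hind'
  rw [← lintegral_map (f := f) (g := fun ω ↦ (fun i ↦ Y i ω, fun a ↦ W (e a) ω)) hf
    (hY.prodMk hWe), hind', lintegral_prod _ hf.aemeasurable,
    lintegral_map hf.lintegral_prod_right' hY]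

/-- Ordered pairs representing the unordered pairs of elements of `Fin m`. -/
def pairs (m : ℕ) : Finset (Fin m × Fin m) := Finset.univ.filter fun e ↦ e.1 < e.2

theorem forall_mem_pairs_adj_iff {m : ℕ} {g g' : SimpleGraph (Fin m)} :
    (∀ e ∈ pairs m, g.Adj e.1 e.2 ↔ g'.Adj e.1 e.2) ↔ g = g' := by
  constructor
  · intro h
    ext a b
    rcases lt_trichotomy a b with hab | rfl | hab
    · exact h (a, b) (by simpa [pairs] using hab)
    · simp
    · rw [g.adj_comm, g'.adj_comm]
      exact h (b, a) (by simpa [pairs] using hab)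
  · rintro rfl
    simp

/-- Conditional probability that the graph spanned by vertices with locations `z` and weights `w`
is `g`. -/
noncomputable def graphWeight (α lam : ℝ) {d m : ℕ} (g : SimpleGraph (Fin m))
    (z : Fin m → EuclideanSpace ℝ (Fin d)) (w : Fin m → ℝ) : ℝ≥0∞ :=
  ∏ e ∈ pairs m, edgeWeight (g.Adj e.1 e.2) (kernel α lam ‖z e.1 - z e.2‖ (w e.1) (w e.2))

@[fun_prop]
theorem measurable_edgeWeight {X : Type*} [MeasurableSpace X] {p : Prop} {f : X → ℝ}
    (hf : Measurable f) : Measurable fun x ↦ edgeWeight p (f x) := by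
  unfold edgeWeight
  split_ifs <;> fun_prop

@[fun_prop]
theorem measurable_graphWeight {X : Type*} [MeasurableSpace X] {α lam : ℝ} {d m : ℕ}
    (g : SimpleGraph (Fin m)) {z : X → Fin m → EuclideanSpace ℝ (Fin d)} {w : X → Fin m → ℝ}
    (hz : Measurable z) (hw : Measurable w) :
    Measurable fun x ↦ graphWeight α lam g (z x) (w x) := by
  unfold graphWeight
  fun_prop

/-- Conditional probability, given the locations `z` only, that the spanned graph is `g`. -/
noncomputable def meanGraphWeight (α β lam : ℝ) {d m : ℕ} (g : SimpleGraph (Fin m))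
    (z : Fin m → EuclideanSpace ℝ (Fin d)) : ℝ≥0∞ :=
  ∫⁻ w, graphWeight α lam g z w ∂(Measure.pi fun _ ↦ paretoMeasure 1 β)

@[fun_prop]
theorem measurable_meanGraphWeight {X : Type*} [MeasurableSpace X] {α β lam : ℝ}
    [IsProbabilityMeasure (paretoMeasure 1 β)] {d m : ℕ} (g : SimpleGraph (Fin m))
    {z : X → Fin m → EuclideanSpace ℝ (Fin d)} (hz : Measurable z) :
    Measurable fun x ↦ meanGraphWeight α β lam g (z x) :=
  Measurable.lintegral_prod_right' (f := fun p : X × (Fin m → ℝ) ↦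
    graphWeight α lam g (z p.1) p.2) (by fun_prop)

/-- Conditional probability, given the locations `z`, of the property `T` of a graph with
`m` located vertices. -/
noncomputable def propWeight (α β lam : ℝ) {d m : ℕ}
    (T : SimpleGraph (Fin m) → (Fin m → EuclideanSpace ℝ (Fin d)) → Prop)
    (z : Fin m → EuclideanSpace ℝ (Fin d)) : ℝ≥0∞ :=
  ∑ g, {z | T g z}.indicator (meanGraphWeight α β lam g) z

theorem measurable_propWeight {α β lam : ℝ} (hβ : 0 < β) {d m : ℕ}
    {T : SimpleGraph (Fin m) → (Fin m → EuclideanSpace ℝ (Fin d)) → Prop}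
    (hT : ∀ g, MeasurableSet {z | T g z}) : Measurable (propWeight α β lam T) := by
  have := isProbabilityMeasure_paretoMeasure one_pos hβ
  unfold propWeight
  exact Finset.measurable_sum _ fun g _ ↦
    Measurable.indicator (measurable_meanGraphWeight g measurable_id) (hT g)

/-- The kernel sees only differences of locations. Through this invariance, the contribution of a
root in the box will not depend on where the root is. -/
theorem propWeight_add_const {α β lam : ℝ} {d m : ℕ}
    {T : SimpleGraph (Fin m) → (Fin m → EuclideanSpace ℝ (Fin d)) → Prop}
    (hT : ∀ g z a, T g (fun i ↦ z i + a) ↔ T g z) (z : Fin m → EuclideanSpace ℝ (Fin d))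
    (a : EuclideanSpace ℝ (Fin d)) :
    propWeight α β lam T (fun i ↦ z i + a) = propWeight α β lam T z := by
  classical
  unfold propWeight
  refine Finset.sum_congr rfl fun g _ ↦ ?_
  simp only [Set.indicator_apply, Set.mem_ofPred_eq, hT, meanGraphWeight, graphWeight,
    add_sub_add_right_eq_sub]

/-! ### Joint law of the graphs spanned by disjoint tuples -/

section SIRG

variable {V : Type*} [LinearOrder V] {Ω : Type*} [MeasurableSpace Ω] {P : Measure Ω} {d : ℕ}
  {α β lam : ℝ} {Y : V → Ω → EuclideanSpace ℝ (Fin d)} {W : V → Ω → ℝ}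
  {G : Ω → SimpleGraph V}

/-- The ranges of `σ` and `τ` are disjoint, so the edges inside them are distinct and conditionally
independent, and the weights they involve are independent. The average over the weights thus factors
for fixed locations. The set `B` leaves room to constrain the locations of all the other vertices.
-/
theorem IsSIRG.measure_comap_eq [IsProbabilityMeasure P] (h : IsSIRG P (kernel α lam) Y W G)
    (hβ : 0 < β) (hlam : 0 < lam) (hW : IsIIDPareto P β W)
    (hind : IndepFun (fun ω i ↦ Y i ω) (fun ω i ↦ W i ω) P)
    {m k : ℕ} {σ : Fin m → V} {τ : Fin k → V} (hστ : Function.Injective (Sum.elim σ τ))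
    (g : SimpleGraph (Fin m)) (g' : SimpleGraph (Fin k))
    {B : Set (V → EuclideanSpace ℝ (Fin d))} (hB : MeasurableSet B) :
    P ({ω | (fun i ↦ Y i ω) ∈ B} ∩ {ω | (G ω).comap σ = g ∧ (G ω).comap τ = g'}) =
      ∫⁻ ω in {ω | (fun i ↦ Y i ω) ∈ B},
        meanGraphWeight α β lam g (fun a ↦ Y (σ a) ω) *
          meanGraphWeight α β lam g' (fun a ↦ Y (τ a) ω) ∂P := by
  classical
  have := isProbabilityMeasure_paretoMeasure one_pos hβ
  have hYm : Measurable fun ω i ↦ Y i ω := measurable_pi_lambda _ h.measurable_location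
  set u : (Fin m × Fin m) ⊕ (Fin k × Fin k) → V :=
    Sum.elim (fun e ↦ σ e.1) (fun e ↦ τ e.1) with hu
  set v : (Fin m × Fin m) ⊕ (Fin k × Fin k) → V :=
    Sum.elim (fun e ↦ σ e.2) (fun e ↦ τ e.2) with hv
  have hσ : Function.Injective σ := hστ.comp Sum.inl_injective
  have hτ : Function.Injective τ := hστ.comp Sum.inr_injective
  have hne : ∀ a b, σ a ≠ τ b := fun a b hab ↦
    Sum.inl_ne_inr (hστ (show Sum.elim σ τ (Sum.inl a) = Sum.elim σ τ (Sum.inr b) from hab))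
  have key := h.measure_pattern hlam hW.ae_one_le ((pairs m).disjSum (pairs k)) u v (by
      rintro (⟨a, b⟩ | ⟨a, b⟩) hk
      · simp only [Finset.inl_mem_disjSum, pairs, Finset.mem_filter] at hk
        exact fun hab ↦ hk.2.ne (hσ hab)
      · simp only [Finset.inr_mem_disjSum, pairs, Finset.mem_filter] at hk
        exact fun hab ↦ hk.2.ne (hτ hab)) (by
      rintro (⟨a, b⟩ | ⟨a, b⟩) hk (⟨a', b'⟩ | ⟨a', b'⟩) hl hkl
      · simp only [Finset.mem_coe, Finset.inl_mem_disjSum, pairs, Finset.mem_filter] at hk hl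
        simp only [hu, hv, Sum.elim_inl, Sym2.eq_iff, hσ.eq_iff] at hkl
        rcases hkl with ⟨rfl, rfl⟩ | ⟨rfl, rfl⟩
        · rfl
        · exact absurd hk.2 hl.2.asymm
      · simp only [hu, hv, Sum.elim_inl, Sum.elim_inr, Sym2.eq_iff, hne, false_and, or_self] at hkl
      · simp only [hu, hv, Sum.elim_inl, Sum.elim_inr, Sym2.eq_iff, (hne _ _).symm, false_and,
          or_self] at hkl
      · simp only [Finset.mem_coe, Finset.inr_mem_disjSum, pairs, Finset.mem_filter] at hk hl
        simp only [hu, hv, Sum.elim_inr, Sym2.eq_iff, hτ.eq_iff] at hkl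
        rcases hkl with ⟨rfl, rfl⟩ | ⟨rfl, rfl⟩
        · rfl
        · exact absurd hk.2 hl.2.asymm)
    (Sum.elim (fun e ↦ g.Adj e.1 e.2) (fun e ↦ g'.Adj e.1 e.2))
    (B := Prod.fst ⁻¹' B) (measurable_fst hB)
  have hset : {ω | ∀ x ∈ (pairs m).disjSum (pairs k), (G ω).Adj (u x) (v x) ↔
      Sum.elim (fun e : Fin m × Fin m ↦ g.Adj e.1 e.2)
        (fun e : Fin k × Fin k ↦ g'.Adj e.1 e.2) x} =
      {ω | (G ω).comap σ = g ∧ (G ω).comap τ = g'} := by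
    ext ω
    simp only [Set.mem_ofPred_eq, ← forall_mem_pairs_adj_iff, Sum.forall, Finset.inl_mem_disjSum,
      Finset.inr_mem_disjSum]
    rfl
  rw [hset] at key
  refine key.trans ?_
  change ∫⁻ ω in (fun ω i ↦ Y i ω) ⁻¹' B, _ ∂P = ∫⁻ ω in (fun ω i ↦ Y i ω) ⁻¹' B, _ ∂P
  rw [← lintegral_indicator (hYm hB), ← lintegral_indicator (hYm hB)]
  have h2 := lintegral_location_weight hβ h.measurable_location h.measurable_weight hW hind hστ
    (f := fun p ↦ B.indicator 1 p.1 *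
      (graphWeight α lam g (fun a ↦ p.1 (σ a)) (fun a ↦ p.2 (Sum.inl a)) *
        graphWeight α lam g' (fun a ↦ p.1 (τ a)) (fun a ↦ p.2 (Sum.inr a)))) (by
      refine Measurable.mul ((measurable_one.indicator hB).comp measurable_fst) ?_
      fun_prop)
  refine Eq.trans ?_ (h2.trans ?_)
  · refine lintegral_congr fun ω ↦ ?_
    by_cases hω : (fun i ↦ Y i ω) ∈ B
    · rw [Set.indicator_of_mem (show ω ∈ (fun ω i ↦ Y i ω) ⁻¹' B from hω),
        Set.indicator_of_mem hω, Finset.prod_disjSum]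
      simp [graphWeight, hu, hv]
    · rw [Set.indicator_of_notMem (show ω ∉ (fun ω i ↦ Y i ω) ⁻¹' B from hω),
        Set.indicator_of_notMem hω, zero_mul]
  · refine lintegral_congr fun ω ↦ ?_
    by_cases hω : (fun i ↦ Y i ω) ∈ B
    · rw [Set.indicator_of_mem (show ω ∈ (fun ω i ↦ Y i ω) ⁻¹' B from hω)]
      simp only [Set.indicator_of_mem hω, Pi.one_apply, one_mul]
      -- Tonelli: the product law of the weights on `Fin m ⊕ Fin k` is the product of the laws on
      -- the two blocks.
      rw [meanGraphWeight, meanGraphWeight, ← lintegral_prod_mul (by fun_prop) (by fun_prop),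
        ← (measurePreserving_sumPiEquivProdPi (fun _ : Fin m ⊕ Fin k ↦ paretoMeasure 1 β)).lintegral_comp
          (by fun_prop)]
      rfl
    · rw [Set.indicator_of_notMem (show ω ∉ (fun ω i ↦ Y i ω) ⁻¹' B from hω)]
      simp [Set.indicator_of_notMem hω]

/-- Probability of properties of the graphs spanned by two disjoint tuples of vertices. -/
theorem IsSIRG.measure_prop_comap [IsProbabilityMeasure P] (h : IsSIRG P (kernel α lam) Y W G)
    (hβ : 0 < β) (hlam : 0 < lam) (hW : IsIIDPareto P β W)
    (hind : IndepFun (fun ω i ↦ Y i ω) (fun ω i ↦ W i ω) P)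
    {m k : ℕ} {σ : Fin m → V} {τ : Fin k → V} (hστ : Function.Injective (Sum.elim σ τ))
    {T : SimpleGraph (Fin m) → (Fin m → EuclideanSpace ℝ (Fin d)) → Prop}
    (hT : ∀ g, MeasurableSet {z | T g z})
    {T' : SimpleGraph (Fin k) → (Fin k → EuclideanSpace ℝ (Fin d)) → Prop}
    (hT' : ∀ g, MeasurableSet {z | T' g z})
    {B : Set (V → EuclideanSpace ℝ (Fin d))} (hB : MeasurableSet B) :
    P {ω | (fun i ↦ Y i ω) ∈ B ∧ T ((G ω).comap σ) (fun a ↦ Y (σ a) ω) ∧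
        T' ((G ω).comap τ) (fun a ↦ Y (τ a) ω)} =
      ∫⁻ ω in {ω | (fun i ↦ Y i ω) ∈ B}, propWeight α β lam T (fun a ↦ Y (σ a) ω) *
        propWeight α β lam T' (fun a ↦ Y (τ a) ω) ∂P := by
  classical
  have := isProbabilityMeasure_paretoMeasure one_pos hβ
  have hYm : Measurable fun ω i ↦ Y i ω := measurable_pi_lambda _ h.measurable_location
  have hm : ∀ (g : SimpleGraph (Fin m)) (g' : SimpleGraph (Fin k)), MeasurableSet
      {y : V → EuclideanSpace ℝ (Fin d) | T g (fun a ↦ y (σ a)) ∧ T' g' (fun a ↦ y (τ a))} :=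
    fun g g' ↦ MeasurableSet.inter
      ((measurable_pi_lambda (fun y : V → EuclideanSpace ℝ (Fin d) ↦ fun a ↦ y (σ a))
        fun a ↦ measurable_pi_apply _) (hT g))
      ((measurable_pi_lambda (fun y : V → EuclideanSpace ℝ (Fin d) ↦ fun a ↦ y (τ a))
        fun a ↦ measurable_pi_apply _) (hT' g'))
  set D : SimpleGraph (Fin m) × SimpleGraph (Fin k) → Set (V → EuclideanSpace ℝ (Fin d)) :=
    fun p ↦ B ∩ {y | T p.1 (fun a ↦ y (σ a)) ∧ T' p.2 (fun a ↦ y (τ a))} with hD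
  have hDm : ∀ p, MeasurableSet (D p) := fun p ↦ hB.inter (hm p.1 p.2)
  have hmeas : ∀ (g : SimpleGraph (Fin m)) (g' : SimpleGraph (Fin k)),
      MeasurableSet {ω | (G ω).comap σ = g ∧ (G ω).comap τ = g'} := by
    intro g g'
    have : {ω | (G ω).comap σ = g ∧ (G ω).comap τ = g'} =
        (⋂ a, ⋂ b, {ω | (G ω).Adj (σ a) (σ b) ↔ g.Adj a b}) ∩
          ⋂ a, ⋂ b, {ω | (G ω).Adj (τ a) (τ b) ↔ g'.Adj a b} := by
      ext ω
      simp [SimpleGraph.ext_iff, funext_iff]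
    rw [this]
    refine (MeasurableSet.iInter fun a ↦ MeasurableSet.iInter fun b ↦ ?_).inter
      (MeasurableSet.iInter fun a ↦ MeasurableSet.iInter fun b ↦ ?_)
    exacts [(h.measurable_adj _ _).iff (MeasurableSet.const _),
      (h.measurable_adj _ _).iff (MeasurableSet.const _)]
  have hset : {ω | (fun i ↦ Y i ω) ∈ B ∧ T ((G ω).comap σ) (fun a ↦ Y (σ a) ω) ∧
        T' ((G ω).comap τ) (fun a ↦ Y (τ a) ω)} =
      ⋃ p ∈ (Finset.univ : Finset (SimpleGraph (Fin m) × SimpleGraph (Fin k))),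
        {ω | (fun i ↦ Y i ω) ∈ D p} ∩ {ω | (G ω).comap σ = p.1 ∧ (G ω).comap τ = p.2} := by
    ext ω
    simp only [Set.mem_ofPred_eq, hD, Set.mem_inter_iff, Finset.mem_univ, Set.iUnion_true,
      Set.mem_iUnion]
    constructor
    · rintro ⟨h1, h2, h3⟩
      exact ⟨((G ω).comap σ, (G ω).comap τ), ⟨h1, h2, h3⟩, rfl, rfl⟩
    · rintro ⟨⟨g, g'⟩, ⟨h1, h2, h3⟩, rfl, rfl⟩
      exact ⟨h1, h2, h3⟩
  rw [hset, measure_biUnion_finset]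
  · simp_rw [fun p ↦ h.measure_comap_eq hβ hlam hW hind hστ p.1 p.2 (hDm p)]
    change ∑ p, ∫⁻ ω in (fun ω i ↦ Y i ω) ⁻¹' D p, _ ∂P = ∫⁻ ω in (fun ω i ↦ Y i ω) ⁻¹' B, _ ∂P
    simp_rw [fun p ↦ (lintegral_indicator (hYm (hDm p))
      (μ := P) (fun ω ↦ meanGraphWeight α β lam p.1 (fun a ↦ Y (σ a) ω) *
        meanGraphWeight α β lam p.2 (fun a ↦ Y (τ a) ω))).symm]
    rw [← lintegral_indicator (hYm hB), ← lintegral_finsetSum]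
    · refine lintegral_congr fun ω ↦ ?_
      by_cases hω : (fun i ↦ Y i ω) ∈ B
      · rw [Set.indicator_of_mem (show ω ∈ (fun ω i ↦ Y i ω) ⁻¹' B from hω), propWeight,
          propWeight, Finset.sum_mul_sum, ← Finset.univ_product_univ, Finset.sum_product]
        refine Finset.sum_congr rfl fun g _ ↦ Finset.sum_congr rfl fun g' _ ↦ ?_
        simp only [Set.indicator_apply, Set.mem_preimage, hD, Set.mem_inter_iff, hω, true_and,
          Set.mem_ofPred_eq]
        by_cases h1 : T g fun a ↦ Y (σ a) ω <;> by_cases h2 : T' g' fun a ↦ Y (τ a) ω <;>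
          simp [h1, h2]
      · rw [Set.indicator_of_notMem (show ω ∉ (fun ω i ↦ Y i ω) ⁻¹' B from hω)]
        exact Finset.sum_eq_zero fun p _ ↦ Set.indicator_of_notMem (fun h' ↦ hω h'.1) _
    · intro p _
      refine Measurable.indicator ?_ (hYm (hDm p))
      have hYl := h.measurable_location
      exact Measurable.mul (by fun_prop) (by fun_prop)
  · rintro ⟨g, g'⟩ _ ⟨k, k'⟩ _ hne
    refine Set.disjoint_left.2 ?_
    rintro ω ⟨_, h1, h2⟩ ⟨_, h3, h4⟩
    exact hne (Prod.ext (h1.symm.trans h3) (h2.symm.trans h4))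
  · exact fun p _ ↦ (hYm (hDm p)).inter (hmeas _ _)

/-- Probability of a property of the graph spanned by a tuple of vertices. -/
theorem IsSIRG.measure_prop_comap_single [IsProbabilityMeasure P]
    (h : IsSIRG P (kernel α lam) Y W G)
    (hβ : 0 < β) (hlam : 0 < lam) (hW : IsIIDPareto P β W)
    (hind : IndepFun (fun ω i ↦ Y i ω) (fun ω i ↦ W i ω) P)
    {m : ℕ} {σ : Fin m → V} (hσ : Function.Injective σ)
    {T : SimpleGraph (Fin m) → (Fin m → EuclideanSpace ℝ (Fin d)) → Prop}
    (hT : ∀ g, MeasurableSet {z | T g z})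
    {B : Set (V → EuclideanSpace ℝ (Fin d))} (hB : MeasurableSet B) :
    P {ω | (fun i ↦ Y i ω) ∈ B ∧ T ((G ω).comap σ) (fun a ↦ Y (σ a) ω)} =
      ∫⁻ ω in {ω | (fun i ↦ Y i ω) ∈ B}, propWeight α β lam T (fun a ↦ Y (σ a) ω) ∂P := by
  have := isProbabilityMeasure_paretoMeasure one_pos hβ
  -- The second tuple is empty and its property trivial, so its weight is `1`.
  have key := h.measure_prop_comap hβ hlam hW hind (τ := (Fin.elim0 : Fin 0 → V))
    (hσ.sumElim (fun a ↦ a.elim0) fun _ b ↦ b.elim0) hT (T' := fun _ _ ↦ True)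
    (fun _ ↦ MeasurableSet.univ) hB
  simpa [propWeight, meanGraphWeight, graphWeight, pairs] using key

end SIRG

/-! ### Counting enumerations of points -/

theorem tsum_indicator_one_eq_encard {ι : Type*} (S : Set ι) :
    ∑' i, S.indicator (1 : ι → ℝ≥0∞) i = (S.encard : ℝ≥0∞) := by
  rw [← tsum_subtype]
  simp

theorem sum_dirac_apply {ι E : Type*} [MeasurableSpace E] (y : ι → E) {A : Set E}
    (hA : MeasurableSet A) :
    Measure.sum (fun i ↦ Measure.dirac (y i)) A = ({i | y i ∈ A}.encard : ℝ≥0∞) := by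
  classical
  rw [Measure.sum_apply _ hA]
  have h1 : ∀ i, Measure.dirac (y i) A = {i | y i ∈ A}.indicator 1 i := fun i ↦ by
    rw [Measure.dirac_apply' _ hA]
    rfl
  simp_rw [h1]
  exact tsum_indicator_one_eq_encard _

/-- `σ` enumerates the indices of the points of `y` that lie in `A`. -/
def Enumerates {ι κ E : Type*} (A : Set E) (σ : κ → ι) (y : ι → E) : Prop :=
  ∀ v, y v ∈ A ↔ v ∈ Set.range σ

/-- For each cell choose a bijection from the labels `l` with `c l = b` to the points in `C b`.
These glue to an injective enumeration because the cells are disjoint. -/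
theorem enumerates_exists_iff {ι E T : Type*} [Fintype T] {y : ι → E} {C : T → Set E}
    (hC : Pairwise fun b b' ↦ Disjoint (C b) (C b')) {s : ℕ} (c : Fin s → T) :
    (∃ σ : Fin s ↪ ι, Enumerates (⋃ b, C b) σ y ∧ ∀ l, y (σ l) ∈ C (c l)) ↔
      ∀ b, {v | y v ∈ C b}.encard = {l | c l = b}.ncard := by
  have huniq : ∀ {x b b'}, x ∈ C b → x ∈ C b' → b = b' := fun {x b b'} h h' ↦
    by_contra fun hne ↦ Set.disjoint_left.1 (hC hne) h h'
  constructor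
  · rintro ⟨σ, h1, h2⟩ b
    have : {v | y v ∈ C b} = σ '' {l | c l = b} := by
      ext v
      constructor
      · intro hv
        obtain ⟨l, rfl⟩ := (h1 v).1 (Set.mem_iUnion.2 ⟨b, hv⟩)
        exact ⟨l, huniq (h2 l) hv, rfl⟩
      · rintro ⟨l, rfl, rfl⟩
        exact h2 l
    rw [this, σ.injective.encard_image, (Set.toFinite _).cast_ncard_eq]
  · intro h
    have hfin : ∀ b, {v | y v ∈ C b}.Finite := fun b ↦
      Set.finite_of_encard_eq_coe (h b)
    have he : ∀ b, Nonempty ({l | c l = b} ≃ {v | y v ∈ C b}) := fun b ↦ by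
      have := (hfin b).to_subtype
      rw [← Finite.card_eq, Nat.card_coe_set_eq, Nat.card_coe_set_eq, ← Nat.cast_inj (R := ℕ∞),
        (hfin b).cast_ncard_eq, h b]
    let e := fun b ↦ (he b).some
    have hmem : ∀ l, y (e (c l) ⟨l, rfl⟩) ∈ C (c l) := fun l ↦ (e (c l) ⟨l, rfl⟩).2
    have hcongr : ∀ b l (hl : c l = b), (e (c l) ⟨l, rfl⟩ : ι) = e b ⟨l, hl⟩ := by
      rintro _ l rfl
      rfl
    refine ⟨⟨fun l ↦ e (c l) ⟨l, rfl⟩, fun l l' hll ↦ ?_⟩, fun v ↦ ⟨fun hv ↦ ?_, ?_⟩, hmem⟩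
    · have hll : (e (c l) ⟨l, rfl⟩ : ι) = e (c l') ⟨l', rfl⟩ := hll
      have hcc : c l = c l' := huniq (hmem l) (hll ▸ hmem l')
      rw [hcongr _ l hcc] at hll
      exact congrArg Subtype.val ((e (c l')).injective (Subtype.ext hll))
    · obtain ⟨b, hb⟩ := Set.mem_iUnion.1 hv
      obtain ⟨⟨l, hl⟩, hlv⟩ := (e b).surjective ⟨v, hb⟩
      exact ⟨l, (hcongr b l hl).trans (congrArg Subtype.val hlv)⟩
    · rintro ⟨l, rfl⟩
      exact Set.mem_iUnion.2 ⟨_, hmem l⟩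

-- Two such enumerations differ by a permutation of `Fin s` that preserves `c`, and every such
-- permutation gives another one. Their number is the order of the stabiliser of `c`, a product of
-- factorials.
open scoped Nat in
theorem ncard_enumerates {ι E T : Type*} [Fintype T] {y : ι → E} {C : T → Set E}
    (hC : Pairwise fun b b' ↦ Disjoint (C b) (C b')) {s : ℕ} (c : Fin s → T)
    (h : ∀ b, {v | y v ∈ C b}.encard = {l | c l = b}.ncard) :
    {σ : Fin s ↪ ι | Enumerates (⋃ b, C b) σ y ∧ ∀ l, y (σ l) ∈ C (c l)}.encard =
      ((∏ b, ({l | c l = b}.ncard)! : ℕ) : ℕ∞) := by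
  classical
  have huniq : ∀ {x b b'}, x ∈ C b → x ∈ C b' → b = b' := fun {x b b'} h h' ↦
    by_contra fun hne ↦ Set.disjoint_left.1 (hC hne) h h'
  obtain ⟨σ₀, h1, h2⟩ := (enumerates_exists_iff hC c).2 h
  rw [← DomMulAct.stabilizer_ncard c, (Set.toFinite _).cast_ncard_eq]
  have hinj : Function.Injective fun g : Equiv.Perm (Fin s) ↦ g.toEmbedding.trans σ₀ := by
    intro g g' hgg
    ext l
    have := DFunLike.congr_fun hgg l
    exact congrArg _ (σ₀.injective this)
  rw [← hinj.encard_image]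
  congr 1
  ext σ
  constructor
  · rintro ⟨h3, h4⟩
    have hr : ∀ l, ∃ l', σ₀ l' = σ l := fun l ↦ (h1 _).1 ((h3 _).2 ⟨l, rfl⟩)
    choose f hf using hr
    have hfinj : Function.Injective f := fun l l' hll ↦
      σ.injective (by rw [← hf l, ← hf l', hll])
    refine ⟨Equiv.ofBijective f (Finite.injective_iff_bijective.1 hfinj), ?_, ?_⟩
    · funext l
      refine huniq (h2 (f l)) ?_
      rw [hf]
      exact h4 l
    · ext l
      exact hf l
  · rintro ⟨g, hg, rfl⟩
    refine ⟨fun v ↦ (h1 v).trans ⟨?_, ?_⟩, fun l ↦ ?_⟩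
    · rintro ⟨l, rfl⟩
      exact ⟨g.symm l, by simp⟩
    · rintro ⟨l, rfl⟩
      exact ⟨g l, rfl⟩
    · have := congrFun hg l
      simp only [Function.comp_apply] at this
      rw [← this]
      exact h2 _

/-! ### Poisson processes: factorial moment measures and Campbell's formula -/

section Poisson

variable {ι E Ω : Type*} [MeasurableSpace E] [MeasurableSpace Ω] {P : Measure Ω}
  {ν : Measure E} {y : ι → Ω → E}

open scoped Nat in
theorem IsPoissonProcess.measure_encard_eq
    (h : IsPoissonProcess P ν fun ω ↦ Measure.sum fun i ↦ Measure.dirac (y i ω))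
    {A : Set E} (hA : MeasurableSet A) (hν : ν A ≠ ∞) (m : ℕ) :
    P {ω | {i | y i ω ∈ A}.encard = m} =
      ENNReal.ofReal (Real.exp (-(ν A).toReal)) * ν A ^ m / (m ! : ℕ) := by
  have hl := h.law A hA hν
  have hset : {ω | {i | y i ω ∈ A}.encard = m} =
      (fun ω ↦ Measure.sum (fun i ↦ Measure.dirac (y i ω)) A) ⁻¹' {(m : ℝ≥0∞)} := by
    ext ω
    simp only [Set.mem_ofPred_eq, Set.mem_preimage, Set.mem_singleton_iff, sum_dirac_apply _ hA]
    rw [← ENat.toENNReal_coe, ENat.toENNReal_inj]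
  have hpre : (fun k : ℕ ↦ (k : ℝ≥0∞)) ⁻¹' {(m : ℝ≥0∞)} = {m} := by
    ext k
    simp
  rw [hset, ← Measure.map_apply_of_aemeasurable hl.aemeasurable (measurableSet_singleton _),
    hl.map_eq, Measure.map_apply .of_discrete (measurableSet_singleton _), hpre,
    poissonMeasure_singleton]
  have hr : ((ν A).toNNReal : ℝ) = (ν A).toReal := rfl
  rw [hr, ENNReal.ofReal_div_of_pos (by positivity), ENNReal.ofReal_mul (by positivity),
    ENNReal.ofReal_pow ENNReal.toReal_nonneg, ENNReal.ofReal_toReal hν, ENNReal.ofReal_natCast]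

open scoped Nat in
theorem IsPoissonProcess.measure_forall_encard_eq
    (h : IsPoissonProcess P ν fun ω ↦ Measure.sum fun i ↦ Measure.dirac (y i ω))
    {T : Type*} [Fintype T] {C : T → Set E} (hCm : ∀ b, MeasurableSet (C b))
    (hC : Pairwise fun b b' ↦ Disjoint (C b) (C b')) (hν : ∀ b, ν (C b) ≠ ∞) (m : T → ℕ) :
    P {ω | ∀ b, {i | y i ω ∈ C b}.encard = m b} =
      ∏ b, ENNReal.ofReal (Real.exp (-(ν (C b)).toReal)) * ν (C b) ^ m b / ((m b)! : ℕ) := by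
  let e := Fintype.equivFin T
  have hind := h.indep (Fintype.card T) (fun j ↦ C (e.symm j)) (fun j ↦ hCm _)
    (fun i j hij ↦ hC (e.symm.injective.ne hij))
  have key := hind.measure_inter_preimage_eq_mul Finset.univ
    (sets := fun j ↦ {(m (e.symm j) : ℝ≥0∞)}) fun j _ ↦ measurableSet_singleton _
  have hset : ∀ b, {ω | {i | y i ω ∈ C b}.encard = m b} =
      (fun ω ↦ Measure.sum (fun i ↦ Measure.dirac (y i ω)) (C b)) ⁻¹' {(m b : ℝ≥0∞)} := by
    intro b
    ext ω
    simp only [Set.mem_ofPred_eq, Set.mem_preimage, Set.mem_singleton_iff,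
      sum_dirac_apply _ (hCm b)]
    rw [← ENat.toENNReal_coe, ENat.toENNReal_inj]
  have h1 : {ω | ∀ b, {i | y i ω ∈ C b}.encard = m b} = ⋂ j ∈ (Finset.univ : Finset (Fin _)),
      (fun ω ↦ Measure.sum (fun i ↦ Measure.dirac (y i ω)) (C (e.symm j))) ⁻¹'
        {(m (e.symm j) : ℝ≥0∞)} := by
    simp_rw [← hset]
    ext ω
    simp only [Set.mem_ofPred_eq, Finset.mem_univ, Set.iInter_true, Set.mem_iInter]
    exact (e.symm.forall_congr_left (p := fun j ↦
      {i | y i ω ∈ C (e.symm j)}.encard = m (e.symm j))).trans (by simp) |>.symm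
  rw [h1, key, ← e.symm.prod_comp]
  refine Finset.prod_congr rfl fun j _ ↦ ?_
  rw [← hset, h.measure_encard_eq (hCm _) (hν _)]

theorem measurable_encard_mem [Countable ι] (hy : ∀ i, Measurable (y i)) {A : Set E}
    (hA : MeasurableSet A) (m : ℕ) : MeasurableSet {ω | {i | y i ω ∈ A}.encard = m} := by
  have hset : {ω | {i | y i ω ∈ A}.encard = m} =
      (fun ω ↦ ∑' i, (y i ⁻¹' A).indicator (1 : Ω → ℝ≥0∞) ω) ⁻¹' {(m : ℝ≥0∞)} := by
    ext ω
    have : ∑' i, (y i ⁻¹' A).indicator (1 : Ω → ℝ≥0∞) ω = ({i | y i ω ∈ A}.encard : ℝ≥0∞) :=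
      tsum_indicator_one_eq_encard {i | y i ω ∈ A}
    simp only [Set.mem_ofPred_eq, Set.mem_preimage, Set.mem_singleton_iff, this]
    rw [← ENat.toENNReal_coe, ENat.toENNReal_inj]
  rw [hset]
  exact (Measurable.tsum fun i ↦ measurable_one.indicator (hy i hA))
    (measurableSet_singleton _)

theorem measurableSet_enumerates [Countable ι] {κ : Type*} (hy : ∀ i, Measurable (y i)) {A : Set E}
    (hA : MeasurableSet A) (σ : κ → ι) : MeasurableSet {ω | Enumerates A σ fun i ↦ y i ω} := by
  have : {ω | Enumerates A σ fun i ↦ y i ω} = ⋂ v, {ω | y v ω ∈ A ↔ v ∈ Set.range σ} := by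
    ext ω
    simp [Enumerates]
  rw [this]
  exact MeasurableSet.iInter fun v ↦ (hy v hA).iff (MeasurableSet.const _)

-- The sum over `σ` counts each configuration with the right occupation numbers `m b` exactly `∏ b,
-- (m b)!` times, which cancels the denominators of the Poisson probabilities. The exponentials of
-- the cells multiply to that of the union.
open scoped Nat in
theorem IsPoissonProcess.tsum_measure_enumerates_cells [Countable ι]
    (h : IsPoissonProcess P ν fun ω ↦ Measure.sum fun i ↦ Measure.dirac (y i ω))
    (hy : ∀ i, Measurable (y i))
    {T : Type*} [Fintype T] {C : T → Set E} (hCm : ∀ b, MeasurableSet (C b))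
    (hC : Pairwise fun b b' ↦ Disjoint (C b) (C b')) (hν : ν (⋃ b, C b) ≠ ∞)
    {s : ℕ} (c : Fin s → T) :
    ∑' σ : Fin s ↪ ι, P {ω | Enumerates (⋃ b, C b) σ (fun i ↦ y i ω) ∧ ∀ l, y (σ l) ω ∈ C (c l)} =
      ENNReal.ofReal (Real.exp (-(ν (⋃ b, C b)).toReal)) * ∏ l, ν (C (c l)) := by
  classical
  have hν' : ∀ b, ν (C b) ≠ ∞ := fun b ↦
    ne_top_of_le_ne_top hν (measure_mono (Set.subset_iUnion C b))
  have hcount : Countable (Fin s ↪ ι) := DFunLike.coe_injective.countable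
  set m : T → ℕ := fun b ↦ {l | c l = b}.ncard with hm
  set D : (Fin s ↪ ι) → Set Ω := fun σ ↦
    {ω | Enumerates (⋃ b, C b) σ (fun i ↦ y i ω) ∧ ∀ l, y (σ l) ω ∈ C (c l)} with hD
  have hDm : ∀ σ, MeasurableSet (D σ) := fun σ ↦ by
    refine (measurableSet_enumerates hy (MeasurableSet.iUnion hCm) σ).inter ?_
    have : {ω | ∀ l, y (σ l) ω ∈ C (c l)} = ⋂ l, y (σ l) ⁻¹' C (c l) := by ext; simp
    change MeasurableSet {ω | ∀ l, y (σ l) ω ∈ C (c l)}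
    rw [this]
    exact MeasurableSet.iInter fun l ↦ hy _ (hCm _)
  have hMm : MeasurableSet {ω | ∀ b, {i | y i ω ∈ C b}.encard = m b} := by
    rw [Set.ofPred_forall]
    exact MeasurableSet.iInter fun b ↦ measurable_encard_mem hy (hCm b) _
  have hpt : ∀ ω, ∑' σ, (D σ).indicator (1 : Ω → ℝ≥0∞) ω =
      {ω | ∀ b, {i | y i ω ∈ C b}.encard = m b}.indicator
        (fun _ ↦ ((∏ b, (m b)! : ℕ) : ℝ≥0∞)) ω := by
    intro ω
    have h1 : ∑' σ, (D σ).indicator (1 : Ω → ℝ≥0∞) ω = ({σ | ω ∈ D σ}.encard : ℝ≥0∞) :=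
      tsum_indicator_one_eq_encard {σ | ω ∈ D σ}
    rw [h1]
    by_cases hω : ∀ b, {i | y i ω ∈ C b}.encard = m b
    · rw [Set.indicator_of_mem (show ω ∈ {ω | ∀ b, {i | y i ω ∈ C b}.encard = m b} from hω)]
      have := ncard_enumerates (y := fun i ↦ y i ω) hC c hω
      simp only [hD, Set.mem_ofPred_eq]
      rw [this, ENat.toENNReal_coe]
    · rw [Set.indicator_of_notMem (show ω ∉ {ω | ∀ b, {i | y i ω ∈ C b}.encard = m b} from hω)]
      have : {σ | ω ∈ D σ} = ∅ := by
        rw [Set.eq_empty_iff_forall_notMem]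
        exact fun σ hσ ↦ hω ((enumerates_exists_iff (y := fun i ↦ y i ω) hC c).1 ⟨σ, hσ⟩)
      simp [this]
  calc ∑' σ, P (D σ) = ∫⁻ ω, ∑' σ, (D σ).indicator (1 : Ω → ℝ≥0∞) ω ∂P := by
        rw [lintegral_tsum fun σ ↦ (measurable_one.indicator (hDm σ)).aemeasurable]
        exact tsum_congr fun σ ↦ (lintegral_indicator_one (hDm σ)).symm
    _ = ((∏ b, (m b)! : ℕ) : ℝ≥0∞) * P {ω | ∀ b, {i | y i ω ∈ C b}.encard = m b} := by
        simp_rw [hpt]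
        rw [lintegral_indicator_const hMm]
    _ = ∏ b, ENNReal.ofReal (Real.exp (-(ν (C b)).toReal)) * ν (C b) ^ m b := by
        rw [h.measure_forall_encard_eq hCm hC hν', Nat.cast_prod, ← Finset.prod_mul_distrib]
        refine Finset.prod_congr rfl fun b _ ↦ ?_
        exact ENNReal.mul_div_cancel (by exact_mod_cast (m b).factorial_ne_zero)
          (ENNReal.natCast_ne_top _)
    _ = _ := by
        rw [Finset.prod_mul_distrib, ← ENNReal.ofReal_prod_of_nonneg fun b _ ↦ by positivity,
          ← Real.exp_sum, Finset.sum_neg_distrib,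
          measure_iUnion hC hCm, tsum_fintype, ENNReal.toReal_sum fun b _ ↦ hν' b]
        congr 1
        rw [← Finset.prod_fiberwise' Finset.univ c fun b ↦ ν (C b)]
        refine Finset.prod_congr rfl fun b _ ↦ ?_
        rw [Finset.prod_const, hm]
        congr 1
        change {l | c l = b}.ncard = _
        rw [Set.ncard_eq_toFinset_card']
        congr 1
        ext l
        simp

/-- The ordered tuples of points of a Poisson process in a set `A` of finite intensity. -/
theorem IsPoissonProcess.sum_map_enumerates [Countable ι]
    (h : IsPoissonProcess P ν fun ω ↦ Measure.sum fun i ↦ Measure.dirac (y i ω))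
    (hy : ∀ i, Measurable (y i)) {A : Set E} (hA : MeasurableSet A) (hν : ν A ≠ ∞) (s : ℕ) :
    Measure.sum (fun σ : Fin s ↪ ι ↦
        (P.restrict {ω | Enumerates A σ fun i ↦ y i ω}).map fun ω l ↦ y (σ l) ω) =
      ENNReal.ofReal (Real.exp (-(ν A).toReal)) • Measure.pi fun _ : Fin s ↦ ν.restrict A := by
  classical
  have hfin : IsFiniteMeasure (ν.restrict A) := ⟨by simpa using hν.lt_top⟩
  set x := ENNReal.ofReal (Real.exp (-(ν A).toReal)) with hx
  have hx0 : x ≠ 0 := by simp [hx, Real.exp_pos]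
  have hxt : x ≠ ∞ := ENNReal.ofReal_ne_top
  set N := Measure.sum (fun σ : Fin s ↪ ι ↦
        (P.restrict {ω | Enumerates A σ fun i ↦ y i ω}).map fun ω l ↦ y (σ l) ω) with hN
  -- Dividing by the nonzero constant turns the claim into a characterisation of the product
  -- measure, to be checked on rectangles.
  suffices hpi : Measure.pi (fun _ : Fin s ↦ ν.restrict A) = x⁻¹ • N by
    rw [hpi, smul_smul, ENNReal.mul_inv_cancel hx0 hxt, one_smul]
  refine Measure.pi_eq fun B hB ↦ ?_
  -- The sides `B l` of a rectangle may overlap. They are cut into the atoms that they generate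
  -- inside `A`, to which the formula for disjoint cells applies.
  set C : Set (Fin s) → Set E := fun b ↦ {z | z ∈ A ∧ ∀ l, z ∈ B l ↔ l ∈ b} with hCdef
  have hCm : ∀ b, MeasurableSet (C b) := fun b ↦ by
    refine hA.inter ?_
    change MeasurableSet {z | ∀ l, z ∈ B l ↔ l ∈ b}
    rw [Set.ofPred_forall]
    exact MeasurableSet.iInter fun l ↦ (hB l).iff (MeasurableSet.const _)
  have hC : Pairwise fun b b' ↦ Disjoint (C b) (C b') := by
    intro b b' hne
    refine Set.disjoint_left.2 fun z hz hz' ↦ hne ?_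
    ext l
    rw [← hz.2, ← hz'.2]
  have hCU : ⋃ b, C b = A := by
    ext z
    simp only [Set.mem_iUnion]
    exact ⟨fun ⟨b, hb⟩ ↦ hb.1, fun hz ↦ ⟨{l | z ∈ B l}, hz, fun l ↦ Iff.rfl⟩⟩
  -- The ways to choose, for every `l`, an atom contained in `B l`.
  set S : Finset (Fin s → Set (Fin s)) :=
    Fintype.piFinset fun l ↦ Finset.univ.filter fun b ↦ l ∈ b with hS
  have hBl : ∀ l, ν.restrict A (B l) = ∑ b with l ∈ b, ν (C b) := by
    intro l
    rw [Measure.restrict_apply (hB l), ← measure_biUnion_finset (fun b _ b' _ hne ↦ hC hne)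
      fun b _ ↦ hCm b]
    congr 1
    ext z
    simp only [Set.mem_inter_iff, Finset.mem_filter, Finset.mem_univ, true_and, Set.mem_iUnion,
      exists_prop]
    constructor
    · exact fun hz ↦ ⟨{l | z ∈ B l}, hz.1, hz.2, fun l ↦ Iff.rfl⟩
    · rintro ⟨b, hb, hz⟩
      exact ⟨(hz.2 l).2 hb, hz.1⟩
  have hNB : N (Set.univ.pi B) = ∑' σ : Fin s ↪ ι,
      P {ω | Enumerates A σ (fun i ↦ y i ω) ∧ ∀ l, y (σ l) ω ∈ B l} := by
    rw [hN, Measure.sum_apply _ (MeasurableSet.univ_pi hB)]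
    refine tsum_congr fun σ ↦ ?_
    have hm : Measurable fun ω l ↦ y (σ l) ω := measurable_pi_lambda _ fun l ↦ hy _
    rw [Measure.map_apply hm (MeasurableSet.univ_pi hB),
      Measure.restrict_apply (hm (MeasurableSet.univ_pi hB)), Set.inter_comm]
    congr 1
    ext ω
    simp
  have hsplit : ∀ σ : Fin s ↪ ι, P {ω | Enumerates A σ (fun i ↦ y i ω) ∧ ∀ l, y (σ l) ω ∈ B l} =
      ∑ c ∈ S, P {ω | Enumerates A σ (fun i ↦ y i ω) ∧ ∀ l, y (σ l) ω ∈ C (c l)} := by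
    intro σ
    rw [← measure_biUnion_finset]
    · congr 1
      ext ω
      simp only [Set.mem_ofPred_eq, Set.mem_iUnion, exists_prop, hS, Fintype.mem_piFinset,
        Finset.mem_filter, Finset.mem_univ, true_and]
      constructor
      · rintro ⟨h1, h2⟩
        exact ⟨fun l ↦ {l' | y (σ l) ω ∈ B l'}, fun l ↦ h2 l, h1, fun l ↦
          ⟨(h1 _).2 ⟨l, rfl⟩, fun l' ↦ Iff.rfl⟩⟩
      · rintro ⟨c, hc, h1, h2⟩
        exact ⟨h1, fun l ↦ ((h2 l).2 l).2 (hc l)⟩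
    · intro c _ c' _ hne
      refine Set.disjoint_left.2 fun ω hω hω' ↦ hne (funext fun l ↦ ?_)
      by_contra hl
      exact Set.disjoint_left.1 (hC hl) (hω.2 l) (hω'.2 l)
    · intro c _
      refine (measurableSet_enumerates hy hA σ).inter ?_
      have : {ω | ∀ l, y (σ l) ω ∈ C (c l)} = ⋂ l, y (σ l) ⁻¹' C (c l) := by ext; simp
      change MeasurableSet {ω | ∀ l, y (σ l) ω ∈ C (c l)}
      rw [this]
      exact MeasurableSet.iInter fun l ↦ hy _ (hCm _)
  simp_rw [hBl]
  rw [Finset.prod_univ_sum, Measure.smul_apply, hNB]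
  simp_rw [hsplit]
  rw [Summable.tsum_finsetSum fun _ _ ↦ ENNReal.summable]
  have hcell := fun c ↦ h.tsum_measure_enumerates_cells hy hCm hC (by rwa [hCU]) (s := s) c
  simp_rw [hCU] at hcell
  simp_rw [hcell]
  rw [← Finset.mul_sum, smul_eq_mul, ← mul_assoc, ENNReal.inv_mul_cancel hx0 hxt, one_mul]

theorem IsPoissonProcess.tsum_setLIntegral_enumerates [Countable ι]
    (h : IsPoissonProcess P ν fun ω ↦ Measure.sum fun i ↦ Measure.dirac (y i ω))
    (hy : ∀ i, Measurable (y i)) {A : Set E} (hA : MeasurableSet A) (hν : ν A ≠ ∞) (s : ℕ)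
    {f : (Fin s → E) → ℝ≥0∞} (hf : Measurable f) :
    ∑' σ : Fin s ↪ ι, ∫⁻ ω in {ω | Enumerates A σ fun i ↦ y i ω}, f (fun l ↦ y (σ l) ω) ∂P =
      ENNReal.ofReal (Real.exp (-(ν A).toReal)) *
        ∫⁻ z, f z ∂Measure.pi fun _ : Fin s ↦ ν.restrict A := by
  rw [← smul_eq_mul, ← lintegral_smul_measure, ← h.sum_map_enumerates hy hA hν s,
    lintegral_sum_measure]
  exact tsum_congr fun σ ↦ (lintegral_map hf (measurable_pi_lambda _ fun l ↦ hy _)).symm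

theorem lintegral_natCast_poissonMeasure (r : ℝ≥0) :
    ∫⁻ k : ℕ, (k : ℝ≥0∞) ∂poissonMeasure r = r := by
  rw [poissonMeasure, lintegral_sum_measure]
  simp_rw [lintegral_smul_measure, lintegral_dirac]
  rw [tsum_eq_zero_add' ENNReal.summable]
  have h1 : ∀ k : ℕ, ENNReal.ofReal (Real.exp (-r) * r ^ (k + 1) / (k + 1).factorial) •
      ((k + 1 : ℕ) : ℝ≥0∞) = r * ENNReal.ofReal (Real.exp (-r) * r ^ k / k.factorial) := by
    intro k
    rw [smul_eq_mul, ← ENNReal.ofReal_natCast, ← ENNReal.ofReal_coe_nnreal,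
      ← ENNReal.ofReal_mul (by positivity), ← ENNReal.ofReal_mul (by positivity),
      Nat.factorial_succ]
    congr 1
    push_cast
    field_simp
    ring
  simp_rw [h1]
  have h2 : ∑' k : ℕ, ENNReal.ofReal (Real.exp (-r) * r ^ k / k.factorial) = 1 := by
    rw [← ENNReal.ofReal_tsum_of_nonneg (fun k ↦ by positivity)
      (hasSum_one_poissonMeasure r).summable, (hasSum_one_poissonMeasure r).tsum_eq,
      ENNReal.ofReal_one]
  rw [ENNReal.tsum_mul_left, h2]
  simp

/-- Campbell's formula for nonnegative functions, in terms of the points of the process. -/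
theorem IsPoissonProcess.tsum_lintegral [Countable ι] [SigmaFinite ν]
    (h : IsPoissonProcess P ν fun ω ↦ Measure.sum fun i ↦ Measure.dirac (y i ω))
    (hy : ∀ i, Measurable (y i)) {f : E → ℝ≥0∞} (hf : Measurable f) :
    ∑' i, ∫⁻ ω, f (y i ω) ∂P = ∫⁻ z, f z ∂ν := by
  have hfin : ∀ A, MeasurableSet A → ν A ≠ ∞ → Measure.sum (fun i ↦ P.map (y i)) A = ν A := by
    intro A hA hνA
    have hl := h.law A hA hνA
    have h1 : ∫⁻ ω, Measure.sum (fun i ↦ Measure.dirac (y i ω)) A ∂P = ν A := by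
      rw [hl.lintegral_comp (f := fun x ↦ x) aemeasurable_id', lintegral_map measurable_id'
        .of_discrete, lintegral_natCast_poissonMeasure, ENNReal.coe_toNNReal hνA]
    rw [← h1, Measure.sum_apply _ hA]
    simp_rw [Measure.sum_apply _ hA]
    rw [lintegral_tsum]
    · refine tsum_congr fun i ↦ ?_
      rw [Measure.map_apply (hy i) hA, ← lintegral_indicator_one (hy i hA)]
      refine lintegral_congr fun ω ↦ ?_
      rw [Measure.dirac_apply' _ hA]
      rfl
    · intro i
      simp_rw [Measure.dirac_apply' _ hA]
      exact ((measurable_one.indicator hA).comp (hy i)).aemeasurable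
  -- Agreement on sets of finite measure extends to all sets by exhausting with spanning sets.
  have heq : Measure.sum (fun i ↦ P.map (y i)) = ν := by
    refine Measure.ext_of_iUnion_eq_univ (iUnion_spanningSets ν) fun n ↦ Measure.ext fun A hA ↦ ?_
    rw [Measure.restrict_apply hA, Measure.restrict_apply hA]
    exact hfin _ (hA.inter (measurableSet_spanningSets ν n))
      ((measure_mono Set.inter_subset_right).trans_lt (measure_spanningSets_lt_top ν n)).ne
  rw [← heq, lintegral_sum_measure]
  exact tsum_congr fun i ↦ (lintegral_map hf (hy i)).symm

end Poisson

/-- The `r`-neighbourhood of the root `0` is isomorphic to `(H, h)` if and only if `c` holds, and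
its vertices are located at distance at most `K` from the root. -/
def LocalProp {U : Type*} (r : ℝ≥0) (H : SimpleGraph U) (h : U) (c : Prop) (K : ℝ) {d s : ℕ}
    (g : SimpleGraph (Fin (s + 1))) (z : Fin (s + 1) → EuclideanSpace ℝ (Fin d)) : Prop :=
  (NbhdIso g 0 r H h ↔ c) ∧ ∀ a ∈ ball g 0 r, ‖z a - z 0‖ ≤ K

/-! ### Passing between a graph and its pullback to the vertices near the root -/

section LocalProp

variable {U : Type*} {r : ℝ≥0} {H : SimpleGraph U} {h : U} {c : Prop} {K : ℝ} {d s : ℕ}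

theorem measurableSet_localProp (g : SimpleGraph (Fin (s + 1))) :
    MeasurableSet {z : Fin (s + 1) → EuclideanSpace ℝ (Fin d) | LocalProp r H h c K g z} := by
  refine (MeasurableSet.const _).inter ?_
  have : {z : Fin (s + 1) → EuclideanSpace ℝ (Fin d) | ∀ a ∈ ball g 0 r, ‖z a - z 0‖ ≤ K} =
      ⋂ a ∈ ball g 0 r, {z | ‖z a - z 0‖ ≤ K} := by
    ext; simp
  change MeasurableSet
    {z : Fin (s + 1) → EuclideanSpace ℝ (Fin d) | ∀ a ∈ ball g 0 r, ‖z a - z 0‖ ≤ K}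
  rw [this]
  refine MeasurableSet.biInter (Set.to_countable _) fun a _ ↦ ?_
  exact measurableSet_le (by fun_prop) measurable_const

theorem localProp_add_const (g : SimpleGraph (Fin (s + 1)))
    (z : Fin (s + 1) → EuclideanSpace ℝ (Fin d)) (a : EuclideanSpace ℝ (Fin d)) :
    LocalProp r H h c K g (fun i ↦ z i + a) ↔ LocalProp r H h c K g z := by
  simp [LocalProp]

/-- When the neighbourhood lies in the range of `σ`, pulling back changes neither its shape nor its
extent. This direction serves the infinite graph. -/
theorem localProp_comap {V : Type*} {G : SimpleGraph V} {σ : Fin (s + 1) → V}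
    (hσ : Function.Injective σ) {y : V → EuclideanSpace ℝ (Fin d)}
    (hG : NbhdIso G (σ 0) r H h ↔ c) (hb : ∀ v ∈ ball G (σ 0) r, ‖y v - y (σ 0)‖ ≤ K)
    (hr : ball G (σ 0) r ⊆ Set.range σ) :
    LocalProp r H h c K (G.comap σ) fun a ↦ y (σ a) := by
  refine ⟨(nbhdIso_comap_iff hσ hr H h).trans hG, fun a ha ↦ hb _ ?_⟩
  rwa [ball_comap hσ hr] at ha

/-- The ball of the spanned graph stays within distance `K`, and no edge leads from there out of the
tuple, so the ball of the whole graph is no larger. This direction serves the finite graphs. -/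
theorem nbhdIso_of_localProp_comap {V : Type*} {G : SimpleGraph V} {σ : Fin (s + 1) → V}
    (hσ : Function.Injective σ) {y : V → EuclideanSpace ℝ (Fin d)}
    (hT : LocalProp r H h c K (G.comap σ) fun a ↦ y (σ a))
    (hr : ∀ u v, ‖y u - y (σ 0)‖ ≤ K → G.Adj u v → v ∈ Set.range σ) :
    NbhdIso G (σ 0) r H h ↔ c := by
  refine (nbhdIso_comap_iff hσ ?_ H h).symm.trans hT.1
  refine ball_subset_range (S := {u | ‖y u - y (σ 0)‖ ≤ K}) ?_ fun u hu v huv ↦ hr u v hu huv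
  rintro _ ⟨a, ha, rfl⟩
  exact hT.2 a ha

end LocalProp

/-- The integral, over the locations in the ball of radius `M` of `s` vertices besides the root, of
the probability of `LocalProp`. -/
noncomputable def localWeight (α β lam : ℝ) (d : ℕ) {U : Type*} (r : ℝ≥0) (H : SimpleGraph U)
    (h : U) (c : Prop) (K M : ℝ) (s : ℕ) : ℝ≥0∞ :=
  ∫⁻ z, propWeight α β lam (LocalProp r H h c K) (Fin.cons 0 z)
    ∂Measure.pi fun _ : Fin s ↦
      (volume : Measure (EuclideanSpace ℝ (Fin d))).restrict (Metric.closedBall 0 M)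

/-! ### Upper bound for neighbourhood probabilities in the infinite graph -/

section Infinite

variable {Ω : Type*} [MeasurableSpace Ω] {Q : Measure Ω} {d : ℕ} {α β lam : ℝ}
  {Y : ℕ → Ω → EuclideanSpace ℝ (Fin d)} {W : ℕ → Ω → ℝ} {G : Ω → SimpleGraph ℕ}

theorem IsInfiniteCSFP.ae_finite (hG : IsInfiniteCSFP Q d α β lam Y W G) (M : ℝ) :
    ∀ᵐ ω ∂Q, {i | Y (i + 1) ω ∈ Metric.closedBall 0 M}.Finite := by
  have hA : MeasurableSet (Metric.closedBall (0 : EuclideanSpace ℝ (Fin d)) M) :=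
    measurableSet_closedBall
  have hl := hG.poisson.law _ hA measure_closedBall_lt_top.ne
  have h1 : ∀ᵐ ω ∂Q, Measure.sum (fun i ↦ Measure.dirac (Y (i + 1) ω))
      (Metric.closedBall 0 M) ≠ ∞ := by
    refine (hl.ae_iff (p := fun x : ℝ≥0∞ ↦ x ≠ ∞)
      (measurableSet_setOfPred.1 (measurableSet_singleton ∞).compl)).2 ?_
    exact (ae_map_iff (p := fun x : ℝ≥0∞ ↦ x ≠ ∞) .of_discrete
      (measurableSet_singleton ∞).compl).2 (ae_of_all _ fun k ↦ ENNReal.natCast_ne_top k)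
  filter_upwards [h1] with ω hω
  rw [sum_dirac_apply _ hA] at hω
  rw [← Set.encard_ne_top_iff]
  intro h
  rw [h] at hω
  exact hω rfl

theorem encard_enumerates {ι E : Type*} {A : Set E} {y : ι → E} {s : ℕ}
    (hs : {i | y i ∈ A}.encard = s) :
    {σ : Fin s ↪ ι | Enumerates A σ y}.encard = (s.factorial : ℕ∞) := by
  have key := ncard_enumerates (T := Unit) (C := fun _ ↦ A) (y := y)
    (fun b b' hb ↦ absurd (Subsingleton.elim b b') hb) (fun _ : Fin s ↦ ()) (by simpa using hs)
  simp only [Set.iUnion_const, Finset.univ_unique, Finset.prod_singleton, Set.ofPred_true,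
    Set.ncard_univ, Nat.card_eq_fintype_card, Fintype.card_fin] at key
  rw [← key]
  congr 1
  ext σ
  exact ⟨fun h ↦ ⟨h, fun l ↦ (h _).2 ⟨l, rfl⟩⟩, fun h ↦ h.1⟩

/-- The tuple of vertices `0, σ 0 + 1, …, σ (s - 1) + 1`. -/
def rootedTuple {s : ℕ} (σ : Fin s ↪ ℕ) : Fin (s + 1) → ℕ := Fin.cons 0 fun l ↦ σ l + 1

theorem injective_rootedTuple {s : ℕ} (σ : Fin s ↪ ℕ) : Function.Injective (rootedTuple σ) :=
  Fin.cons_injective_iff.2 ⟨by rintro ⟨l, hl⟩; simp at hl,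
    fun _ _ hab ↦ σ.injective (Nat.succ_injective hab)⟩

/-- Almost surely the `M`-ball holds some finite number `s` of Poisson points. On the event
considered, each of their `s!` enumerations `σ` puts `ω` into `F s σ`. The indicator is thus at most
the sum over `s` of `1 / s!` times the sum of the indicators of `F s σ`, and the Poisson formula
integrates the latter. -/
theorem IsInfiniteCSFP.measure_le [IsProbabilityMeasure Q]
    (hG : IsInfiniteCSFP Q d α β lam Y W G) (hβ : 0 < β) (hlam : 0 < lam)
    {U : Type*} (r : ℝ≥0) (H : SimpleGraph U) (h : U) (c : Prop) {K M : ℝ} (hKM : K ≤ M) :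
    Q {ω | (NbhdIso (G ω) 0 r H h ↔ c) ∧ ∀ v ∈ ball (G ω) 0 r, ‖Y v ω‖ ≤ K} ≤
      ∑' s : ℕ, ENNReal.ofReal (Real.exp
        (-(volume (Metric.closedBall (0 : EuclideanSpace ℝ (Fin d)) M)).toReal)) *
          (s.factorial : ℝ≥0∞)⁻¹ * localWeight α β lam d r H h c K M s := by
  classical
  set A := Metric.closedBall (0 : EuclideanSpace ℝ (Fin d)) M with hA
  have hAm : MeasurableSet A := measurableSet_closedBall
  have hYm := hG.sirg.measurable_location
  have hYext : ∀ {s : ℕ} (σ : Fin s ↪ ℕ) ω, (fun a ↦ Y (rootedTuple σ a) ω) =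
      Fin.cons 0 fun l ↦ Y (σ l + 1) ω := by
    intro s σ ω
    funext a
    refine Fin.cases ?_ (fun l ↦ ?_) a
    · simp [rootedTuple, hG.root]
    · simp [rootedTuple]
  set F : ∀ s : ℕ, (Fin s ↪ ℕ) → Set Ω := fun s σ ↦
    {ω | (fun i ↦ Y i ω) ∈ {y : ℕ → EuclideanSpace ℝ (Fin d) | Enumerates A σ fun i ↦ y (i + 1)} ∧
      LocalProp r H h c K ((G ω).comap (rootedTuple σ)) fun a ↦ Y (rootedTuple σ a) ω} with hF
  have hBm : ∀ {s : ℕ} (σ : Fin s ↪ ℕ), MeasurableSet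
      {y : ℕ → EuclideanSpace ℝ (Fin d) | Enumerates A σ fun i ↦ y (i + 1)} := fun σ ↦
    measurableSet_enumerates (y := fun (i : ℕ) (y : ℕ → EuclideanSpace ℝ (Fin d)) ↦ y (i + 1))
      (fun i ↦ measurable_pi_apply _) hAm σ
  have hQF : ∀ s (σ : Fin s ↪ ℕ), Q (F s σ) =
      ∫⁻ ω in {ω | Enumerates A σ fun i ↦ Y (i + 1) ω}, propWeight α β lam (LocalProp r H h c K)
        (Fin.cons 0 fun l ↦ Y (σ l + 1) ω) ∂Q := by
    intro s σ
    rw [hF, hG.sirg.measure_prop_comap_single hβ hlam hG.pareto hG.indep (injective_rootedTuple σ)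
      (fun g ↦ measurableSet_localProp g) (hBm σ)]
    simp_rw [hYext]
    rfl
  have hcons : ∀ s, Measurable fun z : Fin s → EuclideanSpace ℝ (Fin d) ↦
      (Fin.cons 0 z : Fin (s + 1) → EuclideanSpace ℝ (Fin d)) := fun s ↦ by
    refine measurable_pi_lambda _ fun a ↦ ?_
    refine Fin.cases ?_ (fun l ↦ ?_) a
    · simp
    · simpa using measurable_pi_apply l
  have hsum : ∀ s, ∑' σ : Fin s ↪ ℕ, Q (F s σ) = ENNReal.ofReal (Real.exp
      (-(volume A).toReal)) * localWeight α β lam d r H h c K M s := by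
    intro s
    simp_rw [hQF]
    exact hG.poisson.tsum_setLIntegral_enumerates (fun i ↦ hYm (i + 1)) hAm
      measure_closedBall_lt_top.ne s
      (f := fun z ↦ propWeight α β lam (LocalProp r H h c K) (Fin.cons 0 z))
      ((measurable_propWeight hβ fun g ↦ measurableSet_localProp g).comp (hcons s))
  set E := {ω | ((NbhdIso (G ω) 0 r H h ↔ c) ∧ ∀ v ∈ ball (G ω) 0 r, ‖Y v ω‖ ≤ K) ∧
    {i | Y (i + 1) ω ∈ A}.Finite} with hE
  have hmem : ∀ ω ∈ E, ∃ s : ℕ, {i | Y (i + 1) ω ∈ A}.encard = s ∧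
      ∀ σ : Fin s ↪ ℕ, Enumerates A σ (fun i ↦ Y (i + 1) ω) → ω ∈ F s σ := by
    rintro ω ⟨⟨h1, h2⟩, h3⟩
    refine ⟨_, h3.cast_ncard_eq.symm, fun σ hσ ↦ ⟨hσ, ?_⟩⟩
    refine localProp_comap (y := fun i ↦ Y i ω) (injective_rootedTuple σ) h1 ?_ fun v hv ↦ ?_
    · intro v hv
      simpa [rootedTuple, hG.root] using h2 v hv
    · rcases v with _ | v
      · exact ⟨0, rfl⟩
      · have hvA : Y (v + 1) ω ∈ A := mem_closedBall_zero_iff.2 ((h2 _ hv).trans hKM)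
        obtain ⟨l, hl⟩ := (hσ v).1 hvA
        exact ⟨l.succ, by simp [rootedTuple, hl]⟩
  -- Measurable hulls have the same measure as the sets `F s σ` and spare a proof that these are
  -- measurable.
  have hle : ∀ ω ∈ E, 1 ≤ ∑' (s : ℕ) (σ : Fin s ↪ ℕ),
      (s.factorial : ℝ≥0∞)⁻¹ * (toMeasurable Q (F s σ)).indicator 1 ω := by
    intro ω hω
    obtain ⟨s, hs, hσ⟩ := hmem ω hω
    refine le_trans ?_ (ENNReal.le_tsum s)
    rw [ENNReal.tsum_mul_left]
    have hcard : (s.factorial : ℝ≥0∞) ≤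
        ∑' σ : Fin s ↪ ℕ, (toMeasurable Q (F s σ)).indicator (1 : Ω → ℝ≥0∞) ω := by
      have h1 : ∑' σ : Fin s ↪ ℕ, {σ : Fin s ↪ ℕ | Enumerates A σ
          fun i ↦ Y (i + 1) ω}.indicator (1 : (Fin s ↪ ℕ) → ℝ≥0∞) σ = (s.factorial : ℝ≥0∞) := by
        rw [tsum_indicator_one_eq_encard, encard_enumerates hs, ENat.toENNReal_coe]
      rw [← h1]
      refine ENNReal.tsum_le_tsum fun σ ↦ Set.indicator_le
        (g := fun σ ↦ (toMeasurable Q (F s σ)).indicator (1 : Ω → ℝ≥0∞) ω) (fun σ' h' ↦ ?_) σ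
      rw [Set.indicator_of_mem (subset_toMeasurable _ _ (hσ σ' h'))]
      rfl
    calc (1 : ℝ≥0∞) = (s.factorial : ℝ≥0∞)⁻¹ * s.factorial :=
          (ENNReal.inv_mul_cancel (by exact_mod_cast s.factorial_ne_zero)
            (ENNReal.natCast_ne_top _)).symm
      _ ≤ _ := by gcongr
  have hm : ∀ s (σ : Fin s ↪ ℕ), Measurable fun ω ↦
      (s.factorial : ℝ≥0∞)⁻¹ * (toMeasurable Q (F s σ)).indicator (1 : Ω → ℝ≥0∞) ω := fun s σ ↦
    (measurable_one.indicator (measurableSet_toMeasurable _ _)).const_mul _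
  have hcount : ∀ s, Countable (Fin s ↪ ℕ) := fun s ↦ DFunLike.coe_injective.countable
  calc Q {ω | (NbhdIso (G ω) 0 r H h ↔ c) ∧ ∀ v ∈ ball (G ω) 0 r, ‖Y v ω‖ ≤ K} ≤ Q E := by
        refine measure_mono_ae ?_
        filter_upwards [hG.ae_finite M] with ω hω hω'
        exact ⟨hω', hω⟩
    _ ≤ ∫⁻ ω, ∑' (s : ℕ) (σ : Fin s ↪ ℕ),
          (s.factorial : ℝ≥0∞)⁻¹ * (toMeasurable Q (F s σ)).indicator 1 ω ∂Q :=
        meas_le_lintegral₀ (Measurable.tsum fun s ↦ Measurable.tsum fun σ ↦ hm s σ).aemeasurable hle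
    _ = ∑' (s : ℕ) (σ : Fin s ↪ ℕ), (s.factorial : ℝ≥0∞)⁻¹ * Q (F s σ) := by
        rw [lintegral_tsum fun s ↦ (Measurable.tsum fun σ ↦ hm s σ).aemeasurable]
        refine tsum_congr fun s ↦ ?_
        rw [lintegral_tsum fun σ ↦ (hm s σ).aemeasurable]
        refine tsum_congr fun σ ↦ ?_
        rw [lintegral_const_mul _ (measurable_one.indicator (measurableSet_toMeasurable _ _)),
          lintegral_indicator_one (measurableSet_toMeasurable _ _), measure_toMeasurable]
    _ = _ := by
        refine tsum_congr fun s ↦ ?_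
        rw [ENNReal.tsum_mul_left, hsum]
        ring

end Infinite

/-- The constant in the bound on edge probabilities by `decay`. -/
noncomputable def edgeConst (α β lam γ : ℝ) : ℝ≥0∞ :=
  ENNReal.ofReal (lam ^ γ * 2 ^ (α * γ)) * (∫⁻ x, ENNReal.ofReal (x ^ γ) ∂paretoMeasure 1 β) ^ 2

theorem edgeConst_ne_top {α β lam γ : ℝ} (h : γ < β) : edgeConst α β lam γ ≠ ∞ :=
  ENNReal.mul_ne_top ENNReal.ofReal_ne_top
    (ENNReal.pow_ne_top (lintegral_rpow_paretoMeasure_lt_top h).ne)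

/-- The bound `kernel_le` is a product of a function of the distance and of powers of the two
weights. The weights are independent of each other and of the locations, so averaging yields the
square of the moment of order `γ`. -/
theorem IsSIRG.measure_adj_le {V : Type*} [LinearOrder V] {Ω : Type*} [MeasurableSpace Ω]
    {P : Measure Ω} {d : ℕ} {α β lam γ : ℝ} {Y : V → Ω → EuclideanSpace ℝ (Fin d)}
    {W : V → Ω → ℝ} {G : Ω → SimpleGraph V} [IsProbabilityMeasure P]
    (h : IsSIRG P (kernel α lam) Y W G) (hα : 0 < α)
    (hβ : 0 < β) (hlam : 0 < lam) (hγ0 : 0 < γ) (hγ1 : γ ≤ 1) (hW : IsIIDPareto P β W)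
    (hind : IndepFun (fun ω i ↦ Y i ω) (fun ω i ↦ W i ω) P) {u v : V} (huv : u ≠ v)
    {B : Set (V → EuclideanSpace ℝ (Fin d))} (hB : MeasurableSet B)
    (hBuv : ∀ y ∈ B, 1 ≤ ‖y u - y v‖) :
    P {ω | (fun i ↦ Y i ω) ∈ B ∧ (G ω).Adj u v} ≤
      edgeConst α β lam γ * ∫⁻ ω, B.indicator (fun y ↦ decay (α * γ) (y u - y v))
        (fun i ↦ Y i ω) ∂P := by
  classical
  have := isProbabilityMeasure_paretoMeasure one_pos hβ
  have hYm : Measurable fun ω i ↦ Y i ω := measurable_pi_lambda _ h.measurable_location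
  have key := h.measure_pattern hlam hW.ae_one_le (Finset.univ : Finset Unit) (fun _ ↦ u)
    (fun _ ↦ v) (fun _ _ ↦ huv) (fun _ _ _ _ _ ↦ rfl) (fun _ ↦ True) (B := Prod.fst ⁻¹' B)
    (measurable_fst hB)
  simp only [iff_true, Finset.univ_unique, Finset.prod_singleton, Finset.mem_singleton,
    forall_const] at key
  have hset : {ω | (fun i ↦ Y i ω) ∈ B ∧ (G ω).Adj u v} =
      (fun ω ↦ (fun i ↦ Y i ω, fun i ↦ W i ω)) ⁻¹' (Prod.fst ⁻¹' B) ∩ {ω | (G ω).Adj u v} := rfl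
  have hpre : MeasurableSet ((fun ω ↦ (fun i ↦ Y i ω, fun i ↦ W i ω)) ⁻¹' (Prod.fst ⁻¹' B)) :=
    hYm hB
  rw [hset, key, ← lintegral_indicator hpre]
  set f : (V → EuclideanSpace ℝ (Fin d)) × (Fin 2 → ℝ) → ℝ≥0∞ := fun p ↦
    ENNReal.ofReal (lam ^ γ * 2 ^ (α * γ)) *
      (ENNReal.ofReal (p.2 0 ^ γ) * ENNReal.ofReal (p.2 1 ^ γ)) *
        B.indicator (fun y ↦ decay (α * γ) (y u - y v)) p.1 with hf
  have hdm : Measurable (B.indicator fun y : V → EuclideanSpace ℝ (Fin d) ↦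
      decay (α * γ) (y u - y v)) := Measurable.indicator (by fun_prop) hB
  have hfm : Measurable f := Measurable.mul (by fun_prop) (hdm.comp measurable_fst)
  have hinj : Function.Injective ![u, v] := by
    intro a b
    fin_cases a <;> fin_cases b <;> simp [huv, huv.symm]
  calc ∫⁻ ω, ((fun ω ↦ (fun i ↦ Y i ω, fun i ↦ W i ω)) ⁻¹' (Prod.fst ⁻¹' B)).indicator
        (fun ω ↦ edgeWeight True (kernel α lam ‖Y u ω - Y v ω‖ (W u ω) (W v ω))) ω ∂P
      ≤ ∫⁻ ω, f (fun i ↦ Y i ω, fun a ↦ W (![u, v] a) ω) ∂P := by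
        refine lintegral_mono_ae ?_
        filter_upwards [hW.ae_one_le u, hW.ae_one_le v] with ω hu hv
        by_cases hω : (fun i ↦ Y i ω) ∈ B
        swap
        · simp only [Set.indicator_apply, Set.mem_preimage, hω, if_false]
          exact zero_le
        rw [Set.indicator_apply, Set.mem_preimage, Set.mem_preimage, if_pos hω]
        simp only [hf, Set.indicator_of_mem hω, edgeWeight, if_true]
        have h0 : 0 ≤ W u ω := by linarith
        have h1 : 0 ≤ W v ω := by linarith
        rw [decay, ← ENNReal.ofReal_mul (by positivity), ← ENNReal.ofReal_mul (by positivity)]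
        simp only [Matrix.cons_val_zero, Matrix.cons_val_one]
        rw [← ENNReal.ofReal_mul (by positivity)]
        refine ENNReal.ofReal_le_ofReal ((kernel_le hα hlam hγ0 hγ1 (hBuv _ hω) h0 h1).trans_eq ?_)
        ring
    _ = ∫⁻ ω, ∫⁻ w, f (fun i ↦ Y i ω, w) ∂(Measure.pi fun _ : Fin 2 ↦ paretoMeasure 1 β) ∂P :=
        lintegral_location_weight hβ h.measurable_location h.measurable_weight hW hind hinj hfm
    _ = ∫⁻ ω, edgeConst α β lam γ * B.indicator (fun y ↦ decay (α * γ) (y u - y v))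
        (fun i ↦ Y i ω) ∂P := by
        refine lintegral_congr fun ω ↦ ?_
        simp only [hf]
        rw [lintegral_mul_const _ (by fun_prop), lintegral_const_mul _ (by fun_prop), edgeConst,
          sq, ← lintegral_prod_mul (by fun_prop) (by fun_prop),
          ← (measurePreserving_finTwoArrow (paretoMeasure 1 β)).lintegral_comp (by fun_prop)]
        rfl
    _ = _ := lintegral_const_mul _ (hdm.comp hYm)

/-! ### Local finiteness of the infinite graph -/

section Infinite

variable {Ω : Type*} [MeasurableSpace Ω] {Q : Measure Ω} {d : ℕ} {α β lam : ℝ}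
  {Y : ℕ → Ω → EuclideanSpace ℝ (Fin d)} {W : ℕ → Ω → ℝ} {G : Ω → SimpleGraph ℕ}

/-- Borel–Cantelli: when `u` is in the `K`-ball, the expected number of its neighbours farther than
`2 * K + 1` from the origin is finite by Campbell's formula and the integrability of the decay. Only
finitely many points are closer. -/
theorem IsInfiniteCSFP.ae_locFinite [IsProbabilityMeasure Q]
    (hG : IsInfiniteCSFP Q d α β lam Y W G) (hβ : 0 < β) (hlam : 0 < lam)
    (hmin : (d : ℝ) < min α (α * β)) : ∀ᵐ ω ∂Q, LocFinite (G ω) := by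
  obtain ⟨γ, hγ0, hγ1, hγβ, hdγ⟩ := exists_exponent hmin
  have hα : 0 < α := d.cast_nonneg.trans_lt (hmin.trans_le (min_le_left _ _))
  have hαγ : 0 < α * γ := by positivity
  have hYm := hG.sirg.measurable_location
  have hfin : ∀ᵐ ω ∂Q, ∀ K : ℕ, {i | Y (i + 1) ω ∈ Metric.closedBall 0 (K : ℝ)}.Finite :=
    ae_all_iff.2 fun K ↦ hG.ae_finite K
  -- Beyond `2 * K + 1` the edge has length at least `1`, as the edge bound requires, and the decay
  -- in `Y u - Y (j + 1)` is controlled by the decay in `Y (j + 1)` alone. The latter is what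
  -- Campbell's formula can sum, even though `u` may itself be a Poisson point.
  set D : ℕ → ℕ → ℕ → Set Ω := fun u K j ↦
    {ω | (fun i ↦ Y i ω) ∈ {y : ℕ → EuclideanSpace ℝ (Fin d) | ‖y u‖ ≤ K ∧ 2 * K + 1 < ‖y (j + 1)‖} ∧
      (G ω).Adj u (j + 1)} with hD
  have hBm : ∀ u K j : ℕ, MeasurableSet
      {y : ℕ → EuclideanSpace ℝ (Fin d) | ‖y u‖ ≤ K ∧ 2 * K + 1 < ‖y (j + 1)‖} := fun u K j ↦
    (measurableSet_le (f := fun y : ℕ → EuclideanSpace ℝ (Fin d) ↦ ‖y u‖) (by fun_prop)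
      measurable_const).inter (measurableSet_lt
        (g := fun y : ℕ → EuclideanSpace ℝ (Fin d) ↦ ‖y (j + 1)‖) measurable_const (by fun_prop))
  have hDle : ∀ u K j, Q (D u K j) ≤ edgeConst α β lam γ * ENNReal.ofReal (2 ^ (α * γ)) *
      ∫⁻ ω, decay (α * γ) (Y (j + 1) ω) ∂Q := by
    intro u K j
    rcases eq_or_ne u (j + 1) with rfl | hne
    · have : D (j + 1) K j = ∅ := by
        ext ω
        simp [hD]
      simp [this]
    · refine (hG.sirg.measure_adj_le hα hβ hlam hγ0 hγ1 hG.pareto hG.indep hne (hBm u K j) ?_).trans ?_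
      · rintro y ⟨h1, h2⟩
        have : (0 : ℝ) ≤ K := K.cast_nonneg
        have h3 := norm_sub_norm_le (y (j + 1)) (y u)
        rw [norm_sub_rev] at h3
        linarith
      · rw [mul_assoc, ← lintegral_const_mul (f := fun ω ↦ decay (α * γ) (Y (j + 1) ω)) _
          ((measurable_decay _).comp (hYm _))]
        refine mul_le_mul_right (lintegral_mono fun ω ↦ ?_) _
        refine Set.indicator_le' (g := fun y : ℕ → EuclideanSpace ℝ (Fin d) ↦
          ENNReal.ofReal (2 ^ (α * γ)) * decay (α * γ) (y (j + 1))) ?_ (fun _ _ ↦ zero_le) _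
        rintro y ⟨h1, h2⟩
        exact decay_sub_le hαγ h1 (by linarith)
  have hBC : ∀ᵐ ω ∂Q, ∀ u K : ℕ, {j | ω ∈ D u K j}.Finite := by
    rw [ae_all_iff]
    refine fun u ↦ ae_all_iff.2 fun K ↦ ae_finite_setOfPred_mem ?_
    refine ne_top_of_le_ne_top ?_ (ENNReal.tsum_le_tsum fun j ↦ hDle u K j)
    rw [ENNReal.tsum_mul_left, hG.poisson.tsum_lintegral (fun i ↦ hYm (i + 1)) (by fun_prop)]
    exact ENNReal.mul_ne_top (ENNReal.mul_ne_top (edgeConst_ne_top hγβ) ENNReal.ofReal_ne_top)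
      (lintegral_decay_lt_top hdγ).ne
  filter_upwards [hfin, hBC] with ω h1 h2 u
  obtain ⟨K, hK⟩ := exists_nat_ge ‖Y u ω‖
  have hsub : (G ω).neighborSet u ⊆ {0} ∪ Nat.succ '' ({j | ω ∈ D u K j} ∪
      {i | Y (i + 1) ω ∈ Metric.closedBall 0 ((2 * K + 1 : ℕ) : ℝ)}) := by
    intro v hv
    rcases v with _ | j
    · exact Or.inl rfl
    · refine Or.inr ⟨j, ?_, rfl⟩
      by_cases hj : 2 * K + 1 < ‖Y (j + 1) ω‖
      · exact Or.inl ⟨⟨hK, hj⟩, hv⟩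
      · exact Or.inr (mem_closedBall_zero_iff.2 (by push_cast; linarith))
  exact (((Set.finite_singleton 0)).union (((h2 u K).union (h1 _)).image _)).subset hsub

/-- Balls of a locally finite graph are finite, hence bounded in space, so the events increase
almost surely to the full one. Continuity from below holds for sets that need not be measurable. -/
theorem IsInfiniteCSFP.tendsto_measure [IsProbabilityMeasure Q]
    (hG : IsInfiniteCSFP Q d α β lam Y W G) (hβ : 0 < β) (hlam : 0 < lam)
    (hmin : (d : ℝ) < min α (α * β)) {U : Type*} (r : ℝ≥0) (H : SimpleGraph U) (h : U) (c : Prop) :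
    Tendsto (fun K : ℕ ↦
      Q {ω | (NbhdIso (G ω) 0 r H h ↔ c) ∧ ∀ v ∈ ball (G ω) 0 r, ‖Y v ω‖ ≤ K}) atTop
      (𝓝 (Q {ω | NbhdIso (G ω) 0 r H h ↔ c})) := by
  have hmono : Monotone fun K : ℕ ↦
      {ω | (NbhdIso (G ω) 0 r H h ↔ c) ∧ ∀ v ∈ ball (G ω) 0 r, ‖Y v ω‖ ≤ K} :=
    fun K K' hKK ω hω ↦ ⟨hω.1, fun v hv ↦ (hω.2 v hv).trans (by exact_mod_cast hKK)⟩
  have key := tendsto_measure_iUnion_atTop (μ := Q) hmono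
  have heq : Q (⋃ K : ℕ, {ω | (NbhdIso (G ω) 0 r H h ↔ c) ∧ ∀ v ∈ ball (G ω) 0 r, ‖Y v ω‖ ≤ K}) =
      Q {ω | NbhdIso (G ω) 0 r H h ↔ c} := by
    refine measure_congr ?_
    filter_upwards [hG.ae_locFinite hβ hlam hmin] with ω hω
    refine propext ⟨fun h' ↦ ?_, fun h' ↦ ?_⟩
    · obtain ⟨K, hK⟩ := Set.mem_iUnion.1 h'
      exact hK.1
    · obtain ⟨x, hx⟩ := ((finite_ball hω 0 r).image fun v ↦ ‖Y v ω‖).bddAbove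
      obtain ⟨K, hK⟩ := exists_nat_ge x
      exact Set.mem_iUnion.2 ⟨K, h', fun v hv ↦ (hx ⟨v, hv, rfl⟩).trans hK⟩
  rwa [heq] at key

end Infinite

/-! ### Product measures and uniform points in the box of volume n -/

section Product

variable {E : Type*} [MeasurableSpace E] (μ : Measure E)

/-- Given the coordinates `z` of the tuple, the remaining coordinates are independent, and each of
them satisfies the constraint with the same probability. -/
theorem lintegral_pi_comp_inter [IsProbabilityMeasure μ] {V A : Type*} [Fintype V] [Fintype A]
    {e : A → V} (he : Function.Injective e) {F : (A → E) → ℝ≥0∞} (hF : Measurable F)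
    {S : Set ((A → E) × E)} (hS : MeasurableSet S) :
    ∫⁻ y, {y : V → E | ∀ v ∉ Set.range e, ((fun a ↦ y (e a)), y v) ∈ S}.indicator
        (fun y ↦ F fun a ↦ y (e a)) y ∂(Measure.pi fun _ : V ↦ μ) =
      ∫⁻ z, F z * μ {x | (z, x) ∈ S} ^ (Fintype.card V - Fintype.card A)
        ∂(Measure.pi fun _ : A ↦ μ) := by
  classical
  let f : A ⊕ {v // v ∉ Set.range e} ≃ V :=
    (Equiv.sumCongr (Equiv.ofInjective e he) (Equiv.refl _)).trans
      (Equiv.sumCompl fun v ↦ v ∈ Set.range e)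
  have hfl : ∀ a, f (Sum.inl a) = e a := fun a ↦ rfl
  have hfr : ∀ v, f (Sum.inr v) = v := fun v ↦ rfl
  have hmeas : MeasurableSet {y : V → E | ∀ v ∉ Set.range e, ((fun a ↦ y (e a)), y v) ∈ S} := by
    have : {y : V → E | ∀ v ∉ Set.range e, ((fun a ↦ y (e a)), y v) ∈ S} =
        ⋂ v ∈ (Set.range e)ᶜ, (fun y : V → E ↦ ((fun a ↦ y (e a)), y v)) ⁻¹' S := by
      ext; simp
    rw [this]
    exact MeasurableSet.biInter (Set.to_countable _) fun v _ ↦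
      (by fun_prop : Measurable fun y : V → E ↦ ((fun a ↦ y (e a)), y v)) hS
  have hFm : Measurable fun y : V → E ↦ F fun a ↦ y (e a) := by fun_prop
  have hind := hFm.indicator hmeas
  have hpres := (measurePreserving_piCongrLeft (fun _ : V ↦ μ) f).comp
    (measurePreserving_sumPiEquivProdPi_symm (fun _ : A ⊕ {v // v ∉ Set.range e} ↦ μ))
  rw [← hpres.lintegral_comp hind]
  refine (lintegral_prod _ (hind.comp hpres.measurable).aemeasurable).trans ?_
  refine lintegral_congr fun z ↦ ?_
  have hl : ∀ (w : {v // v ∉ Set.range e} → E) a,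
      MeasurableEquiv.piCongrLeft (fun _ ↦ E) f
        ((MeasurableEquiv.sumPiEquivProdPi fun _ ↦ E).symm (z, w)) (e a) = z a := fun w a ↦
    Equiv.piCongrLeft_apply_apply (P := fun _ ↦ E) f _ (Sum.inl a)
  have hr : ∀ (w : {v // v ∉ Set.range e} → E) v,
      MeasurableEquiv.piCongrLeft (fun _ ↦ E) f
        ((MeasurableEquiv.sumPiEquivProdPi fun _ ↦ E).symm (z, w)) v.1 = w v := fun w v ↦
    Equiv.piCongrLeft_apply_apply (P := fun _ ↦ E) f _ (Sum.inr v)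
  have hSz : MeasurableSet {x | (z, x) ∈ S} := measurable_prodMk_left hS
  have hpt : ∀ w : {v // v ∉ Set.range e} → E,
      {y : V → E | ∀ v ∉ Set.range e, ((fun a ↦ y (e a)), y v) ∈ S}.indicator
        (fun y ↦ F fun a ↦ y (e a)) (MeasurableEquiv.piCongrLeft (fun _ ↦ E) f
        ((MeasurableEquiv.sumPiEquivProdPi fun _ ↦ E).symm (z, w))) =
      (Set.univ.pi fun _ : {v // v ∉ Set.range e} ↦ {x | (z, x) ∈ S}).indicator
        (fun _ ↦ F z) w := by
    intro w
    simp only [Set.indicator_apply, Set.mem_ofPred_eq, hl, Set.mem_pi, Set.mem_univ,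
      true_imp_iff]
    refine if_congr ⟨fun h v ↦ ?_, fun h v hv ↦ ?_⟩ rfl rfl
    · rw [← hr w v]
      exact h v v.2
    · rw [hr w ⟨v, hv⟩]
      exact h ⟨v, hv⟩
  refine (lintegral_congr hpt).trans ?_
  rw [lintegral_indicator_const (MeasurableSet.univ_pi fun _ ↦ hSz), Measure.pi_pi,
    Finset.prod_const, Finset.card_univ, Fintype.card_subtype_compl]
  congr 3
  exact Set.card_range_of_injective he

theorem lintegral_pi_cons [SigmaFinite μ] {s : ℕ} {F : (Fin (s + 1) → E) → ℝ≥0∞}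
    (hF : Measurable F) :
    ∫⁻ z, F z ∂(Measure.pi fun _ : Fin (s + 1) ↦ μ) =
      ∫⁻ x, ∫⁻ z, F (Fin.cons x z) ∂(Measure.pi fun _ : Fin s ↦ μ) ∂μ := by
  have hpres : MeasurePreserving (fun p : E × (Fin s → E) ↦ (Fin.cons p.1 p.2 : Fin (s + 1) → E))
      (μ.prod (Measure.pi fun _ : Fin s ↦ μ)) (Measure.pi fun _ : Fin (s + 1) ↦ μ) := by
    convert (measurePreserving_piFinSuccAbove (fun _ : Fin (s + 1) ↦ μ) 0).symm using 1
    funext p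
    exact (Fin.insertNth_zero' p.1 p.2).symm
  rw [← hpres.lintegral_comp hF]
  exact lintegral_prod _ (hF.comp hpres.measurable).aemeasurable

theorem measurable_cons {X : Type*} [MeasurableSpace X] {s : ℕ} {f : X → E} {g : X → Fin s → E}
    (hf : Measurable f) (hg : Measurable g) :
    Measurable fun x ↦ (Fin.cons (f x) (g x) : Fin (s + 1) → E) := by
  refine measurable_pi_lambda _ fun a ↦ ?_
  refine Fin.cases ?_ (fun l ↦ ?_) a
  · simpa using hf
  · simpa [Function.comp_def] using (measurable_pi_apply l).comp hg

end Product

/-- The box `[-n ^ (1 / d) / 2, n ^ (1 / d) / 2]^d`, shrunk by `M` on every side. -/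
def box (d n : ℕ) (M : ℝ) : Set (EuclideanSpace ℝ (Fin d)) :=
  {x | ∀ k, |x k| ≤ (n : ℝ) ^ (1 / d : ℝ) / 2 - M}

/-- The uniform distribution on the box of volume `n`. -/
noncomputable def boxMeasure (d n : ℕ) : Measure (EuclideanSpace ℝ (Fin d)) :=
  (n : ℝ≥0∞)⁻¹ • volume.restrict (box d n 0)

theorem measurableSet_box (d n : ℕ) (M : ℝ) : MeasurableSet (box d n M) := by
  have : box d n M = ⋂ k, {x | |x k| ≤ (n : ℝ) ^ (1 / d : ℝ) / 2 - M} := by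
    ext; simp [box]
  rw [this]
  exact MeasurableSet.iInter fun k ↦ measurableSet_le (by fun_prop) measurable_const

theorem volume_box (d n : ℕ) (M : ℝ) :
    volume (box d n M) = ENNReal.ofReal ((n : ℝ) ^ (1 / d : ℝ) - 2 * M) ^ d := by
  have h1 : box d n M = (WithLp.ofLp : EuclideanSpace ℝ (Fin d) → Fin d → ℝ) ⁻¹' Set.univ.pi
      fun _ ↦ Set.Icc (-((n : ℝ) ^ (1 / d : ℝ) / 2 - M)) ((n : ℝ) ^ (1 / d : ℝ) / 2 - M) := by
    ext x
    simp only [box, Set.mem_ofPred_eq, Set.mem_preimage, Set.mem_pi, Set.mem_univ, true_imp_iff,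
      Set.mem_Icc, abs_le]
  rw [h1, (PiLp.volume_preserving_ofLp (Fin d)).measure_preimage
    (MeasurableSet.univ_pi fun _ ↦ measurableSet_Icc).nullMeasurableSet, volume_pi,
    Measure.pi_pi]
  simp only [Real.volume_Icc, Finset.prod_const, Finset.card_univ, Fintype.card_fin]
  congr 2
  ring

theorem closedBall_subset_box {d n : ℕ} {M : ℝ} {x : EuclideanSpace ℝ (Fin d)}
    (hx : x ∈ box d n M) : Metric.closedBall x M ⊆ box d n 0 := by
  intro z hz k
  rw [mem_closedBall_iff_norm] at hz
  have h1 : |(z - x) k| ≤ ‖z - x‖ := by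
    have := EuclideanSpace.norm_eq (z - x)
    exact PiLp.norm_apply_le (z - x) k
  have h2 := hx k
  have h3 : |z k| ≤ |(z - x) k| + |x k| := by
    have := abs_add_le ((z - x) k) (x k)
    simpa using this
  linarith

theorem boxMeasure_le (d n : ℕ) (A : Set (EuclideanSpace ℝ (Fin d))) :
    boxMeasure d n A ≤ (n : ℝ≥0∞)⁻¹ * volume A := by
  rw [boxMeasure, Measure.smul_apply, smul_eq_mul]
  exact mul_le_mul_right (Measure.restrict_apply_le _ _) _

theorem lintegral_boxMeasure_le (d n : ℕ) (f : EuclideanSpace ℝ (Fin d) → ℝ≥0∞) :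
    ∫⁻ x, f x ∂boxMeasure d n ≤ (n : ℝ≥0∞)⁻¹ * ∫⁻ x, f x := by
  rw [boxMeasure, lintegral_smul_measure, smul_eq_mul]
  gcongr
  exact Measure.restrict_le_self

theorem box_one (d : ℕ) : unitBox d = box d 1 0 := by
  ext x
  simp [unitBox, box, abs_le]

theorem map_smul_uniform {d n : ℕ} (hd : 1 ≤ d) (hn : 1 ≤ n) {Ω : Type*} [MeasurableSpace Ω]
    {P : Measure Ω} {X : Ω → EuclideanSpace ℝ (Fin d)}
    (hX : pdf.IsUniform X (unitBox d) P volume) :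
    P.map (fun ω ↦ (n : ℝ) ^ (1 / d : ℝ) • X ω) = boxMeasure d n := by
  have hvol : volume (unitBox d) = 1 := by
    rw [box_one, volume_box]
    simp
  have hn0 : (0 : ℝ) < (n : ℝ) ^ (1 / d : ℝ) := by positivity
  have hXm : AEMeasurable X P := hX.aemeasurable (by simp [hvol]) (by simp [hvol])
  have hmap : P.map X = volume.restrict (unitBox d) := by
    rw [hX, ProbabilityTheory.cond, hvol, inv_one, one_smul]
  have hcomp : P.map (fun ω ↦ (n : ℝ) ^ (1 / d : ℝ) • X ω) =
      (P.map X).map ((n : ℝ) ^ (1 / d : ℝ) • ·) :=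
    (AEMeasurable.map_map_of_aemeasurable (by fun_prop) hXm).symm
  have hpre : unitBox d = ((n : ℝ) ^ (1 / d : ℝ) • · ) ⁻¹' box d n 0 := by
    ext x
    rw [box_one]
    simp only [box, Set.mem_preimage, Set.mem_ofPred_eq, PiLp.smul_apply, smul_eq_mul, abs_mul,
      abs_of_pos hn0, sub_zero]
    refine forall_congr' fun k ↦ ?_
    rw [Nat.cast_one, Real.one_rpow, mul_comm, ← le_div_iff₀ hn0, div_right_comm, div_self hn0.ne']
  have hpow : ((n : ℝ) ^ (1 / d : ℝ)) ^ d = n := by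
    rw [← Real.rpow_natCast, ← Real.rpow_mul (by positivity), one_div,
      inv_mul_cancel₀ (by positivity), Real.rpow_one]
  rw [hcomp, hmap, hpre, ← Measure.restrict_map (by fun_prop) (measurableSet_box _ _ _),
    Measure.map_addHaar_smul _ hn0.ne', Measure.restrict_smul, boxMeasure]
  congr 1
  rw [finrank_euclideanSpace_fin, hpow, abs_of_pos (by positivity),
    ENNReal.ofReal_inv_of_pos (by positivity), ENNReal.ofReal_natCast]

theorem pi_smul_const {ι E : Type*} [Fintype ι] [MeasurableSpace E] (μ : Measure E) [SigmaFinite μ]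
    (c : ℝ≥0∞) [SigmaFinite (c • μ)] :
    Measure.pi (fun _ : ι ↦ c • μ) = c ^ Fintype.card ι • Measure.pi fun _ : ι ↦ μ := by
  refine Measure.pi_eq fun A _ ↦ ?_
  simp [Measure.smul_apply, Measure.pi_pi, Finset.prod_mul_distrib]

theorem isProbabilityMeasure_boxMeasure {d n : ℕ} (hd : 1 ≤ d) (hn : 1 ≤ n) :
    IsProbabilityMeasure (boxMeasure d n) := by
  refine ⟨?_⟩
  have hpow : ((n : ℝ) ^ (1 / d : ℝ)) ^ d = n := by
    rw [← Real.rpow_natCast, ← Real.rpow_mul (by positivity), one_div,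
      inv_mul_cancel₀ (by positivity), Real.rpow_one]
  rw [boxMeasure, Measure.smul_apply, Measure.restrict_apply_univ, volume_box, mul_zero, sub_zero,
    ← ENNReal.ofReal_pow (by positivity), hpow, ENNReal.ofReal_natCast, smul_eq_mul,
    ENNReal.inv_mul_cancel (by simp; omega) (by simp)]

/-- Tuples of locations in the ball of radius `M` around the first one, which is at distance at
least `M` from the complement of the box. -/
def innerTuples (d n : ℕ) (M : ℝ) (s : ℕ) : Set (Fin (s + 1) → EuclideanSpace ℝ (Fin d)) :=
  {z | z 0 ∈ box d n M ∧ ∀ a : Fin s, z a.succ ∈ Metric.closedBall (z 0) M}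

theorem measurableSet_innerTuples (d n : ℕ) (M : ℝ) (s : ℕ) :
    MeasurableSet (innerTuples d n M s) := by
  have : innerTuples d n M s = (fun z ↦ z 0) ⁻¹' box d n M ∩
      ⋂ a : Fin s, {z | dist (z a.succ) (z 0) ≤ M} := by
    ext; simp [innerTuples]
  rw [this]
  refine MeasurableSet.inter ?_ (MeasurableSet.iInter fun a ↦ ?_)
  · exact measurable_pi_apply (0 : Fin (s + 1)) (measurableSet_box _ _ _)
  · exact measurableSet_le (by fun_prop) measurable_const

/-- The integral of `F (0, z)` over tuples `z` of points of the ball of radius `M`. -/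
noncomputable def ballIntegral {d s : ℕ} (M : ℝ)
    (F : (Fin (s + 1) → EuclideanSpace ℝ (Fin d)) → ℝ≥0∞) : ℝ≥0∞ :=
  ∫⁻ z, F (Fin.cons 0 z) ∂Measure.pi fun _ : Fin s ↦ volume.restrict (Metric.closedBall 0 M)

/-- For `x` in the shrunken box, the `M`-ball around `x` lies in the box, where the measure is
Lebesgue measure over `n`. A translation then moves `x` to the origin. For other `x` both sides
vanish. -/
theorem lintegral_cons_boxMeasure {d n : ℕ} (hd : 1 ≤ d) (hn : 1 ≤ n) {M : ℝ} {s : ℕ}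
    {F : (Fin (s + 1) → EuclideanSpace ℝ (Fin d)) → ℝ≥0∞}
    (hFt : ∀ z a, F (fun i ↦ z i + a) = F z) (x : EuclideanSpace ℝ (Fin d)) :
    ∫⁻ z, (innerTuples d n M s).indicator F (Fin.cons x z)
        ∂(Measure.pi fun _ : Fin s ↦ boxMeasure d n) =
      (box d n M).indicator (fun _ ↦ (n : ℝ≥0∞)⁻¹ ^ s * ballIntegral M F) x := by
  have := isProbabilityMeasure_boxMeasure hd hn
  by_cases hx : x ∈ box d n M
  swap
  · simp [innerTuples, hx]
  have hR : ∀ z : Fin s → EuclideanSpace ℝ (Fin d),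
      (Fin.cons x z : Fin (s + 1) → EuclideanSpace ℝ (Fin d)) ∈ innerTuples d n M s ↔
        z ∈ Set.univ.pi fun _ ↦ Metric.closedBall x M := by
    intro z
    simp [innerTuples, hx]
  have hball : ∀ y : EuclideanSpace ℝ (Fin d), MeasurableSet
      (Set.univ.pi fun _ : Fin s ↦ Metric.closedBall y M) := fun y ↦
    MeasurableSet.univ_pi fun _ ↦ measurableSet_closedBall
  have hind : ∀ z : Fin s → EuclideanSpace ℝ (Fin d),
      (innerTuples d n M s).indicator F (Fin.cons x z) =
        (Set.univ.pi fun _ ↦ Metric.closedBall x M).indicator (fun z ↦ F (Fin.cons x z)) z := by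
    classical
    intro z
    simp only [Set.indicator_apply, hR]
  simp_rw [hind]
  rw [Set.indicator_of_mem hx, ballIntegral]
  have : SigmaFinite ((n : ℝ≥0∞)⁻¹ • (volume : Measure (EuclideanSpace ℝ (Fin d))).restrict
    (box d n 0)) := by
    change SigmaFinite (boxMeasure d n)
    infer_instance
  have hpi : (Measure.pi fun _ : Fin s ↦ boxMeasure d n) = (n : ℝ≥0∞)⁻¹ ^ s •
      (volume : Measure (Fin s → EuclideanSpace ℝ (Fin d))).restrict
        (Set.univ.pi fun _ ↦ box d n 0) := by
    unfold boxMeasure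
    rw [pi_smul_const, Fintype.card_fin, volume_pi, Measure.restrict_pi_pi]
  have hinter : (Set.univ.pi fun _ : Fin s ↦ Metric.closedBall x M) ∩
      (Set.univ.pi fun _ : Fin s ↦ box d n 0) = Set.univ.pi fun _ : Fin s ↦ Metric.closedBall x M :=
    Set.inter_eq_left.2 (Set.pi_mono fun _ _ ↦ closedBall_subset_box hx)
  rw [lintegral_indicator (hball x), hpi, Measure.restrict_smul, lintegral_smul_measure,
    Measure.restrict_restrict (hball x), hinter, smul_eq_mul,
    ← Measure.restrict_pi_pi, ← volume_pi, ← lintegral_indicator (hball x),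
    ← lintegral_indicator (hball 0), ← lintegral_add_right_eq_self _ (fun _ : Fin s ↦ x)]
  congr 2
  funext z
  classical
  simp only [Set.indicator_apply]
  refine if_congr ?_ ?_ rfl
  · simp [dist_eq_norm]
  · refine Eq.trans ?_ (hFt _ x)
    congr 1
    funext i
    refine Fin.cases ?_ (fun a ↦ ?_) i <;> simp

/-- By translation invariance, integrating out the points around the root leaves a constant. The
factor `k` will carry the interaction with the second root. -/
theorem lintegral_pi_innerTuples {d n : ℕ} (hd : 1 ≤ d) (hn : 1 ≤ n) {M : ℝ} {s : ℕ}
    {F : (Fin (s + 1) → EuclideanSpace ℝ (Fin d)) → ℝ≥0∞} (hF : Measurable F)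
    (hFt : ∀ z a, F (fun i ↦ z i + a) = F z) {k : EuclideanSpace ℝ (Fin d) → ℝ≥0∞}
    (hk : Measurable k) :
    ∫⁻ z, (innerTuples d n M s).indicator F z * k (z 0)
        ∂(Measure.pi fun _ : Fin (s + 1) ↦ boxMeasure d n) =
      ((n : ℝ≥0∞)⁻¹ ^ s * ballIntegral M F) *
        ∫⁻ x in box d n M, k x ∂boxMeasure d n := by
  have := isProbabilityMeasure_boxMeasure hd hn
  have hFm := hF.indicator (measurableSet_innerTuples d n M s)
  have hm : Measurable fun z ↦ (innerTuples d n M s).indicator F z * k (z 0) :=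
    hFm.mul (by fun_prop)
  rw [lintegral_pi_cons _ hm, ← lintegral_const_mul _ hk,
    ← lintegral_indicator (measurableSet_box _ _ _)]
  refine lintegral_congr fun x ↦ ?_
  have hcons : Measurable fun z : Fin s → EuclideanSpace ℝ (Fin d) ↦
      (innerTuples d n M s).indicator F (Fin.cons x z) :=
    hFm.comp (measurable_cons measurable_const measurable_id)
  simp only [Fin.cons_zero]
  rw [lintegral_mul_const _ hcons,
    lintegral_cons_boxMeasure hd hn hFt]
  by_cases hx : x ∈ box d n M <;> simp [hx]

theorem le_boxMeasure_far {d n : ℕ} (hd : 1 ≤ d) (hn : 1 ≤ n) (M : ℝ)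
    (x x' : EuclideanSpace ℝ (Fin d)) :
    1 - 2 * volume (Metric.closedBall (0 : EuclideanSpace ℝ (Fin d)) M) * (n : ℝ≥0∞)⁻¹ ≤
      boxMeasure d n {y | M < dist y x ∧ M < dist y x'} := by
  have := isProbabilityMeasure_boxMeasure hd hn
  have hset : {y | M < dist y x ∧ M < dist y x'} =
      (Metric.closedBall x M ∪ Metric.closedBall x' M)ᶜ := by
    ext y; simp
  rw [hset, prob_compl_eq_one_sub (measurableSet_closedBall.union measurableSet_closedBall)]
  refine tsub_le_tsub_left ((measure_union_le _ _).trans ?_) _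
  refine (add_le_add (boxMeasure_le _ _ _) (boxMeasure_le _ _ _)).trans_eq ?_
  rw [Measure.addHaar_closedBall_center, Measure.addHaar_closedBall_center _ x']
  ring

/-- A lower bound for the probability that two independent uniform points of the box are far from
each other and from the complement of the box. -/
noncomputable def farProb (d n : ℕ) (M : ℝ) : ℝ≥0∞ :=
  boxMeasure d n (box d n M) * (boxMeasure d n (box d n M) -
    volume (Metric.closedBall (0 : EuclideanSpace ℝ (Fin d)) (2 * M)) * (n : ℝ≥0∞)⁻¹)

/-- The indicator function of the pairs of points at distance more than `2 * M`. -/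
noncomputable def farIndicator {d : ℕ} (M : ℝ) (x x' : EuclideanSpace ℝ (Fin d)) : ℝ≥0∞ :=
  {y | 2 * M < dist y x}.indicator 1 x'

@[fun_prop]
theorem measurable_farIndicator {X : Type*} [MeasurableSpace X] {d : ℕ} {M : ℝ}
    {f g : X → EuclideanSpace ℝ (Fin d)} (hf : Measurable f) (hg : Measurable g) :
    Measurable fun x ↦ farIndicator M (f x) (g x) := by
  classical
  have hm : MeasurableSet {x | 2 * M < dist (g x) (f x)} :=
    measurableSet_lt measurable_const (by fun_prop)
  have heq : (fun x ↦ farIndicator M (f x) (g x)) =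
      {x | 2 * M < dist (g x) (f x)}.indicator 1 := by
    funext x
    simp only [farIndicator, Set.indicator_apply, Set.mem_ofPred_eq, Pi.one_apply]
  rw [heq]
  exact measurable_one.indicator hm

theorem farProb_le {d n : ℕ} (M : ℝ) :
    farProb d n M ≤ ∫⁻ x in box d n M, ∫⁻ x' in box d n M,
      farIndicator M x x' ∂boxMeasure d n ∂boxMeasure d n := by
  rw [farProb, mul_comm, ← setLIntegral_const]
  refine lintegral_mono fun x ↦ ?_
  have hset : {y | 2 * M < dist y x} = (Metric.closedBall x (2 * M))ᶜ := by ext y; simp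
  have hm : MeasurableSet {y | 2 * M < dist y x} := by
    rw [hset]; exact measurableSet_closedBall.compl
  unfold farIndicator
  rw [lintegral_indicator_one hm, Measure.restrict_apply hm, hset, Set.inter_comm,
    ← Set.sdiff_eq]
  refine le_trans (tsub_le_tsub_left ?_ _) le_measure_sdiff
  refine (boxMeasure_le _ _ _).trans_eq ?_
  rw [Measure.addHaar_closedBall_center, mul_comm]

/-- Two disjoint tuples `σ`, `τ` of vertices are exactly the vertices in the balls of radius `M`
around their first elements. -/
def pairTuples {V : Type*} {d : ℕ} (M : ℝ) {s t : ℕ} (σ : Fin (s + 1) → V) (τ : Fin (t + 1) → V) :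
    Set (V → EuclideanSpace ℝ (Fin d)) :=
  {y | Enumerates (Metric.closedBall (y (σ 0)) M) σ y ∧
    Enumerates (Metric.closedBall (y (τ 0)) M) τ y}

theorem measurableSet_pairTuples {V : Type*} [Countable V] {d : ℕ} (M : ℝ) {s t : ℕ}
    (σ : Fin (s + 1) → V) (τ : Fin (t + 1) → V) :
    MeasurableSet (pairTuples (d := d) M σ τ) := by
  have : ∀ {s : ℕ} (σ : Fin (s + 1) → V), MeasurableSet {y : V → EuclideanSpace ℝ (Fin d) |
      Enumerates (Metric.closedBall (y (σ 0)) M) σ y} := by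
    intro s σ
    have : {y : V → EuclideanSpace ℝ (Fin d) | Enumerates (Metric.closedBall (y (σ 0)) M) σ y} =
        ⋂ v, {y | dist (y v) (y (σ 0)) ≤ M ↔ v ∈ Set.range σ} := by
      ext; simp [Enumerates]
    rw [this]
    refine MeasurableSet.iInter fun v ↦ ?_
    have hle : MeasurableSet {y : V → EuclideanSpace ℝ (Fin d) | dist (y v) (y (σ 0)) ≤ M} :=
      measurableSet_le (by fun_prop) measurable_const
    by_cases hv : v ∈ Set.range σ
    · simpa only [hv, iff_true] using hle
    · simp only [hv, iff_false]
      exact hle.compl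
  exact (this σ).inter (this τ)

theorem lintegral_pi_sum {A B E : Type*} [Fintype A] [Fintype B] [MeasurableSpace E]
    (μ : Measure E) [SigmaFinite μ] {R : (A ⊕ B → E) → ℝ≥0∞} (hR : Measurable R) :
    ∫⁻ z, R z ∂(Measure.pi fun _ : A ⊕ B ↦ μ) =
      ∫⁻ z, ∫⁻ z', R (Sum.elim z z') ∂(Measure.pi fun _ : B ↦ μ) ∂(Measure.pi fun _ : A ↦ μ) := by
  have hpres : MeasurePreserving (fun p : (A → E) × (B → E) ↦ Sum.elim p.1 p.2)
      ((Measure.pi fun _ : A ↦ μ).prod (Measure.pi fun _ : B ↦ μ))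
      (Measure.pi fun _ : A ⊕ B ↦ μ) := by
    convert measurePreserving_sumPiEquivProdPi_symm (fun _ : A ⊕ B ↦ μ) using 1
    funext p a
    cases a <;> rfl
  rw [← hpres.lintegral_comp hR]
  exact lintegral_prod _ (hR.comp hpres.measurable).aemeasurable

/-! ### Two isolated clusters of points in the box -/

section PairTuples

variable {d n : ℕ} {M : ℝ} {s t : ℕ} {F : (Fin (s + 1) → EuclideanSpace ℝ (Fin d)) → ℝ≥0∞}
  {F' : (Fin (t + 1) → EuclideanSpace ℝ (Fin d)) → ℝ≥0∞}

/-- The product of `F` and `F'`, restricted to pairs of tuples that are far from each other and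
from the complement of the box. -/
noncomputable def farProduct (n : ℕ) (M : ℝ) (F : (Fin (s + 1) → EuclideanSpace ℝ (Fin d)) → ℝ≥0∞)
    (F' : (Fin (t + 1) → EuclideanSpace ℝ (Fin d)) → ℝ≥0∞)
    (z : Fin (s + 1) ⊕ Fin (t + 1) → EuclideanSpace ℝ (Fin d)) : ℝ≥0∞ :=
  (innerTuples d n M s).indicator F (fun a ↦ z (.inl a)) *
    ((innerTuples d n M t).indicator F' (fun a ↦ z (.inr a)) *
      farIndicator M (z (.inl 0)) (z (.inr 0)))

theorem measurable_farProduct (hF : Measurable F) (hF' : Measurable F') :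
    Measurable (farProduct n M F F') := by
  have hFm := hF.indicator (measurableSet_innerTuples d n M s)
  have hFm' := hF'.indicator (measurableSet_innerTuples d n M t)
  have h1 : Measurable fun z : Fin (s + 1) ⊕ Fin (t + 1) → EuclideanSpace ℝ (Fin d) ↦
      (innerTuples d n M s).indicator F (fun a ↦ z (.inl a)) :=
    hFm.comp (measurable_pi_lambda (fun (z : Fin (s + 1) ⊕ Fin (t + 1) → EuclideanSpace ℝ (Fin d)) a
      ↦ z (.inl a)) fun a ↦ measurable_pi_apply _)
  have h2 : Measurable fun z : Fin (s + 1) ⊕ Fin (t + 1) → EuclideanSpace ℝ (Fin d) ↦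
      (innerTuples d n M t).indicator F' (fun a ↦ z (.inr a)) :=
    hFm'.comp (measurable_pi_lambda (fun (z : Fin (s + 1) ⊕ Fin (t + 1) → EuclideanSpace ℝ (Fin d)) a
      ↦ z (.inr a)) fun a ↦ measurable_pi_apply _)
  have h3 : Measurable fun z : Fin (s + 1) ⊕ Fin (t + 1) → EuclideanSpace ℝ (Fin d) ↦
      farIndicator M (z (.inl 0)) (z (.inr 0)) :=
    measurable_farIndicator (measurable_pi_apply _) (measurable_pi_apply _)
  exact h1.mul (h2.mul h3)

/-- Integrating one tuple and then the other extracts a ball integral from each. Only the two roots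
remain coupled, through `farIndicator`. -/
theorem le_lintegral_farProduct (hd : 1 ≤ d) (hn : 1 ≤ n) (hF : Measurable F)
    (hFt : ∀ z a, F (fun i ↦ z i + a) = F z) (hF' : Measurable F')
    (hFt' : ∀ z a, F' (fun i ↦ z i + a) = F' z) :
    ((n : ℝ≥0∞)⁻¹ ^ s * ballIntegral M F) * (((n : ℝ≥0∞)⁻¹ ^ t * ballIntegral M F') *
        farProb d n M) ≤
      ∫⁻ z, farProduct n M F F' z
        ∂(Measure.pi fun _ : Fin (s + 1) ⊕ Fin (t + 1) ↦ boxMeasure d n) := by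
  have := isProbabilityMeasure_boxMeasure hd hn
  have hFm := hF.indicator (measurableSet_innerTuples d n M s)
  have hFm' := hF'.indicator (measurableSet_innerTuples d n M t)
  have hkint : Measurable fun x ↦ ∫⁻ x' in box d n M,
      farIndicator M x x' ∂boxMeasure d n :=
    Measurable.lintegral_prod_right' (f := fun p : EuclideanSpace ℝ (Fin d) ×
      EuclideanSpace ℝ (Fin d) ↦ farIndicator M p.1 p.2) (by fun_prop)
  have hz : ∀ z, ∫⁻ z', farProduct n M F F' (Sum.elim z z')
      ∂(Measure.pi fun _ : Fin (t + 1) ↦ boxMeasure d n) =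
      (innerTuples d n M s).indicator F z * (((n : ℝ≥0∞)⁻¹ ^ t * ballIntegral M F') *
        ∫⁻ x' in box d n M, farIndicator M (z 0) x' ∂boxMeasure d n) := by
    intro z
    have hk0 : Measurable fun z' : Fin (t + 1) → EuclideanSpace ℝ (Fin d) ↦
        farIndicator M (z 0) (z' 0) := 
      measurable_farIndicator measurable_const (measurable_pi_apply _)
    have hm : Measurable fun z' : Fin (t + 1) → EuclideanSpace ℝ (Fin d) ↦
        (innerTuples d n M t).indicator F' z' *
          farIndicator M (z 0) (z' 0) := hFm'.mul hk0
    rw [← lintegral_pi_innerTuples hd hn hF' hFt'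
      (k := fun x' ↦ farIndicator M (z 0) x') (by fun_prop), ← lintegral_const_mul _ hm]
    simp only [farProduct, Sum.elim_inl, Sum.elim_inr]
  rw [lintegral_pi_sum _ (measurable_farProduct hF hF'), lintegral_congr hz,
    lintegral_pi_innerTuples hd hn hF hFt (k := fun x ↦ ((n : ℝ≥0∞)⁻¹ ^ t * ballIntegral M F') *
      ∫⁻ x' in box d n M, farIndicator M x x' ∂boxMeasure d n)
      (hkint.const_mul _), lintegral_const_mul _ hkint]
  gcongr
  exact farProb_le M

/-- Roots at distance more than `2 * M` have disjoint `M`-balls, so no point of one tuple lies in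
the ball of the other. All further points avoid both balls by hypothesis. -/
theorem farProduct_le_indicator (hM : 0 ≤ M) {σ : Fin (s + 1) → Fin n} {τ : Fin (t + 1) → Fin n}
    {y : Fin n → EuclideanSpace ℝ (Fin d)}
    (hy : ∀ v ∉ Set.range (Sum.elim σ τ), M < dist (y v) (y (σ 0)) ∧ M < dist (y v) (y (τ 0))) :
    farProduct n M F F' (fun a ↦ y (Sum.elim σ τ a)) ≤
      (pairTuples M σ τ).indicator (fun y ↦ F (fun a ↦ y (σ a)) * F' (fun a ↦ y (τ a))) y := by
  unfold farProduct farIndicator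
  simp only [Sum.elim_inl, Sum.elim_inr]
  by_cases h1 : (fun a ↦ y (σ a)) ∈ innerTuples d n M s
  swap
  · simp [h1]
  by_cases h2 : (fun a ↦ y (τ a)) ∈ innerTuples d n M t
  swap
  · simp [h2]
  by_cases h3 : y (τ 0) ∈ {x | 2 * M < dist x (y (σ 0))}
  swap
  · rw [Set.indicator_of_notMem h3]
    simp
  have h3' : 2 * M < dist (y (τ 0)) (y (σ 0)) := h3
  have hb : ∀ {m : ℕ} {ρ : Fin (m + 1) → Fin n}, (fun a ↦ y (ρ a)) ∈ innerTuples d n M m →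
      ∀ a, dist (y (ρ a)) (y (ρ 0)) ≤ M := by
    intro m ρ h a
    refine Fin.cases (by simpa using hM) (fun l ↦ h.2 l) a
  have hfar : ∀ v, v ∉ Set.range σ → v ∉ Set.range τ → M < dist (y v) (y (σ 0)) ∧
      M < dist (y v) (y (τ 0)) := by
    intro v hv1 hv2
    refine hy v ?_
    rw [Set.Sum.elim_range]
    exact fun h ↦ h.elim hv1 hv2
  rw [Set.indicator_of_mem h1, Set.indicator_of_mem h2, Set.indicator_of_mem h3, Pi.one_apply,
    mul_one, Set.indicator_of_mem]
  refine ⟨fun v ↦ ⟨fun hv ↦ ?_, ?_⟩, fun v ↦ ⟨fun hv ↦ ?_, ?_⟩⟩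
  · by_contra hσ
    rw [Metric.mem_closedBall] at hv
    by_cases hτ : v ∈ Set.range τ
    · obtain ⟨b, rfl⟩ := hτ
      have := hb h2 b
      have := dist_triangle_left (y (τ 0)) (y (σ 0)) (y (τ b))
      linarith
    · linarith [(hfar v hσ hτ).1]
  · rintro ⟨a, rfl⟩
    exact hb h1 a
  · by_contra hτ
    rw [Metric.mem_closedBall] at hv
    by_cases hσ : v ∈ Set.range σ
    · obtain ⟨b, rfl⟩ := hσ
      have := hb h1 b
      have := dist_triangle_left (y (τ 0)) (y (σ 0)) (y (σ b))
      linarith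
    · linarith [(hfar v hσ hτ).2]
  · rintro ⟨a, rfl⟩
    exact hb h2 a

/-- Whatever the two centres are, each of the other `n - (s + 1 + (t + 1))` vertices avoids both
balls with probability at least `1 - 2|B_M|/n`, independently. -/
theorem le_setLIntegral_pairTuples (hd : 1 ≤ d) (hn : 1 ≤ n) (hM : 0 ≤ M)
    {σ : Fin (s + 1) → Fin n} {τ : Fin (t + 1) → Fin n} (hστ : Function.Injective (Sum.elim σ τ))
    (hF : Measurable F) (hFt : ∀ z a, F (fun i ↦ z i + a) = F z) (hF' : Measurable F')
    (hFt' : ∀ z a, F' (fun i ↦ z i + a) = F' z) :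
    (1 - 2 * volume (Metric.closedBall (0 : EuclideanSpace ℝ (Fin d)) M) * (n : ℝ≥0∞)⁻¹) ^
        (n - (s + 1 + (t + 1))) * (((n : ℝ≥0∞)⁻¹ ^ s * ballIntegral M F) *
      (((n : ℝ≥0∞)⁻¹ ^ t * ballIntegral M F') * farProb d n M)) ≤
      ∫⁻ y in pairTuples M σ τ, F (fun a ↦ y (σ a)) * F' (fun a ↦ y (τ a))
        ∂(Measure.pi fun _ : Fin n ↦ boxMeasure d n) := by
  have := isProbabilityMeasure_boxMeasure hd hn
  have hRm := measurable_farProduct (n := n) (M := M) hF hF'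
  set S : Set ((Fin (s + 1) ⊕ Fin (t + 1) → EuclideanSpace ℝ (Fin d)) ×
    EuclideanSpace ℝ (Fin d)) :=
      {p | M < dist p.2 (p.1 (.inl 0))} ∩ {p | M < dist p.2 (p.1 (.inr 0))} with hS
  have hSm : MeasurableSet S :=
    MeasurableSet.inter (measurableSet_lt measurable_const (by fun_prop))
      (measurableSet_lt measurable_const (by fun_prop))
  have key := lintegral_pi_comp_inter (boxMeasure d n) hστ hRm hSm
  rw [← lintegral_indicator (measurableSet_pairTuples _ _ _)]
  refine le_trans ?_ (key.symm.le.trans (lintegral_mono fun y ↦ ?_))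
  · refine (mul_le_mul_right (le_lintegral_farProduct hd hn hF hFt hF' hFt') _).trans ?_
    rw [mul_comm, ← lintegral_mul_const _ hRm]
    refine lintegral_mono fun z ↦ ?_
    rw [Fintype.card_sum, Fintype.card_fin, Fintype.card_fin, Fintype.card_fin]
    gcongr
    exact le_boxMeasure_far hd hn M _ _
  · exact Set.indicator_apply_le' (fun hy ↦ farProduct_le_indicator hM hy) fun _ ↦ zero_le

end PairTuples

theorem lintegral_pi_update {ι E : Type*} [Fintype ι] [DecidableEq ι] [MeasurableSpace E]
    (μ : Measure E) [IsProbabilityMeasure μ] {F : (ι → E) → ℝ≥0∞} (hF : Measurable F) (v : ι) :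
    ∫⁻ y, F y ∂(Measure.pi fun _ : ι ↦ μ) =
      ∫⁻ y, ∫⁻ x, F (Function.update y v x) ∂μ ∂(Measure.pi fun _ : ι ↦ μ) := by
  have hm : Measurable fun y ↦ ∫⁻ x, F (Function.update y v x) ∂μ := by
    simpa only [← lmarginal_singleton (μ := fun _ : ι ↦ μ)] using hF.lmarginal (fun _ : ι ↦ μ)
  refine lintegral_eq_of_lmarginal_eq {v} hF hm ?_
  rw [lmarginal_singleton, lmarginal_singleton]
  funext y
  simp

theorem lintegral_boxMeasure_decay_le {d : ℕ} (n : ℕ) (a R : ℝ) (w : EuclideanSpace ℝ (Fin d)) :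
    ∫⁻ x, {x | R < ‖w - x‖}.indicator (fun x ↦ decay a (w - x)) x ∂boxMeasure d n ≤
      (n : ℝ≥0∞)⁻¹ * ∫⁻ z in {z : EuclideanSpace ℝ (Fin d) | R < ‖z‖}, decay a z := by
  refine (lintegral_boxMeasure_le _ _ _).trans_eq ?_
  rw [← lintegral_indicator (measurableSet_lt measurable_const measurable_norm),
    
    ← lintegral_sub_left_eq_self ({z | R < ‖z‖}.indicator (decay a)) w]
  rfl

/-- `G` is a SIRG on `n` vertices with the connection function of continuum scale-free percolation,
i.i.d. Pareto weights and i.i.d. uniform locations in the box of volume `n`. -/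
structure IsBoxCSFP {Ω : Type*} [MeasurableSpace Ω] (P : Measure Ω) (d : ℕ) (α β lam : ℝ)
    (n : ℕ) (Y : Fin n → Ω → EuclideanSpace ℝ (Fin d)) (W : Fin n → Ω → ℝ)
    (G : Ω → SimpleGraph (Fin n)) : Prop where
  sirg : IsSIRG P (kernel α lam) Y W G
  pareto : IsIIDPareto P β W
  indep : IndepFun (fun ω i ↦ Y i ω) (fun ω i ↦ W i ω) P
  law : P.map (fun ω i ↦ Y i ω) = Measure.pi fun _ ↦ boxMeasure d n

/-! ### Long edges in the finite graphs -/

section Finite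

variable {Ω : Type*} [MeasurableSpace Ω] {P : Measure Ω} {d : ℕ} {α β lam : ℝ} {n : ℕ}
  {Y : Fin n → Ω → EuclideanSpace ℝ (Fin d)} {W : Fin n → Ω → ℝ} {G : Ω → SimpleGraph (Fin n)}

theorem IsFiniteCSFP.isBoxCSFP [IsProbabilityMeasure P] (hd : 1 ≤ d) (hn : 1 ≤ n)
    (hG : IsFiniteCSFP P d α β lam n Y W G) :
    IsBoxCSFP P d α β lam n (fun i ω ↦ (n : ℝ) ^ (1 / d : ℝ) • Y i ω) W G where
  sirg := hG.sirg
  pareto := hG.pareto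
  indep := hG.indep.comp (φ := fun y i ↦ (n : ℝ) ^ (1 / d : ℝ) • y i) (ψ := id)
    (measurable_pi_lambda _ fun i ↦ by fun_prop) measurable_id
  law := by
    have hind : iIndepFun (fun i ω ↦ (n : ℝ) ^ (1 / d : ℝ) • Y i ω) P :=
      hG.indep_location.comp (fun _ x ↦ (n : ℝ) ^ (1 / d : ℝ) • x) fun _ ↦ by fun_prop
    rw [(iIndepFun_iff_map_fun_eq_pi_map
      fun i ↦ (hG.sirg.measurable_location i).aemeasurable).1 hind]
    congr 1
    funext i
    exact map_smul_uniform hd hn (hG.uniform i)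

theorem IsBoxCSFP.measurable_locations (hG : IsBoxCSFP P d α β lam n Y W G) :
    Measurable fun ω i ↦ Y i ω := measurable_pi_lambda _ hG.sirg.measurable_location

theorem IsBoxCSFP.lintegral_locations (hG : IsBoxCSFP P d α β lam n Y W G)
    {F : (Fin n → EuclideanSpace ℝ (Fin d)) → ℝ≥0∞} (hF : Measurable F) :
    ∫⁻ ω, F (fun i ↦ Y i ω) ∂P = ∫⁻ y, F y ∂(Measure.pi fun _ ↦ boxMeasure d n) := by
  rw [← hG.law, lintegral_map hF hG.measurable_locations]

/-- A bound for the expected number of edges from the ball of radius `K` around a vertex to the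
complement of the ball of radius `M`. -/
noncomputable def longEdgeBound (d : ℕ) (α β lam γ K M : ℝ) : ℝ≥0∞ :=
  edgeConst α β lam γ * ((1 + volume (Metric.closedBall (0 : EuclideanSpace ℝ (Fin d)) K)) *
    ∫⁻ z in {z : EuclideanSpace ℝ (Fin d) | M - K < ‖z‖}, decay (α * γ) z)

/-- There is an edge from the ball of radius `K` around `i` to the complement of the ball of radius
`M`. -/
def HasLongEdge {V E : Type*} [NormedAddCommGroup E] (G : SimpleGraph V) (y : V → E) (i : V)
    (K M : ℝ) : Prop :=
  ∃ u v, ‖y u - y i‖ ≤ K ∧ M < ‖y v - y i‖ ∧ G.Adj u v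

/-- The ends of such an edge are more than `M - K ≥ 1` apart. Averaging over the location of `v`
gives the tail of the decay over `n`. Averaging over that of `u` gives the volume of the `K`-ball
over `n`, unless `u = i`. -/
theorem IsBoxCSFP.measure_edge_le [IsProbabilityMeasure P] (hG : IsBoxCSFP P d α β lam n Y W G)
    (hd : 1 ≤ d) (hn : 1 ≤ n) (hα : 0 < α) (hβ : 0 < β) (hlam : 0 < lam) {γ : ℝ} (hγ0 : 0 < γ)
    (hγ1 : γ ≤ 1) {K M : ℝ} (hK : 0 ≤ K) (hKM : K + 1 ≤ M) (i u v : Fin n) :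
    P {ω | ‖Y u ω - Y i ω‖ ≤ K ∧ M < ‖Y v ω - Y i ω‖ ∧ (G ω).Adj u v} ≤
      edgeConst α β lam γ * ((if u = i then 1 else (n : ℝ≥0∞)⁻¹ *
        volume (Metric.closedBall (0 : EuclideanSpace ℝ (Fin d)) K)) * ((n : ℝ≥0∞)⁻¹ *
          ∫⁻ z in {z : EuclideanSpace ℝ (Fin d) | M - K < ‖z‖}, decay (α * γ) z)) := by
  classical
  have := isProbabilityMeasure_boxMeasure hd hn
  rcases eq_or_ne v i with rfl | hvi
  · have : {ω | ‖Y u ω - Y v ω‖ ≤ K ∧ M < ‖Y v ω - Y v ω‖ ∧ (G ω).Adj u v} = ∅ := by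
      ext ω
      simp only [sub_self, norm_zero, Set.mem_ofPred_eq, Set.mem_empty_iff_false, iff_false]
      rintro ⟨_, h, _⟩
      linarith
    rw [this, measure_empty]
    exact zero_le
  rcases eq_or_ne u v with rfl | huv
  · simp
  set B : Set (Fin n → EuclideanSpace ℝ (Fin d)) :=
    {y | ‖y u - y i‖ ≤ K} ∩ {y | M - K < ‖y u - y v‖} with hB
  have hBm : MeasurableSet B := MeasurableSet.inter
    (measurableSet_le (f := fun y : Fin n → EuclideanSpace ℝ (Fin d) ↦ ‖y u - y i‖) (by fun_prop)
      measurable_const)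
    (measurableSet_lt (g := fun y : Fin n → EuclideanSpace ℝ (Fin d) ↦ ‖y u - y v‖)
      measurable_const (by fun_prop))
  have hsub : {ω | ‖Y u ω - Y i ω‖ ≤ K ∧ M < ‖Y v ω - Y i ω‖ ∧ (G ω).Adj u v} ⊆
      {ω | (fun i ↦ Y i ω) ∈ B ∧ (G ω).Adj u v} := by
    rintro ω ⟨h1, h2, h3⟩
    refine ⟨⟨h1, ?_⟩, h3⟩
    have h4 : ‖Y v ω - Y i ω‖ ≤ ‖Y u ω - Y i ω‖ + ‖Y u ω - Y v ω‖ := by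
      rw [add_comm, norm_sub_rev (Y u ω) (Y v ω)]
      exact norm_sub_le_norm_sub_add_norm_sub _ _ _
    change M - K < ‖Y u ω - Y v ω‖
    linarith
  refine (measure_mono hsub).trans ((hG.sirg.measure_adj_le hα hβ hlam hγ0 hγ1 hG.pareto hG.indep
    huv hBm fun y hy ↦ by linarith [show M - K < ‖y u - y v‖ from hy.2]).trans ?_)
  refine mul_le_mul_right ?_ _
  set D := (n : ℝ≥0∞)⁻¹ *
    ∫⁻ z in {z : EuclideanSpace ℝ (Fin d) | M - K < ‖z‖}, decay (α * γ) z with hD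
  have hFm : Measurable (B.indicator fun y : Fin n → EuclideanSpace ℝ (Fin d) ↦
      decay (α * γ) (y u - y v)) := Measurable.indicator (by fun_prop) hBm
  have hball : MeasurableSet {y : Fin n → EuclideanSpace ℝ (Fin d) | ‖y u - y i‖ ≤ K} :=
    measurableSet_le (by fun_prop) measurable_const
  rw [hG.lintegral_locations hFm, lintegral_pi_update _ hFm v]
  calc _ ≤ ∫⁻ y, {y | ‖y u - y i‖ ≤ K}.indicator 1 y * D
        ∂(Measure.pi fun _ : Fin n ↦ boxMeasure d n) := by
        refine lintegral_mono fun y ↦ ?_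
        by_cases hy : ‖y u - y i‖ ≤ K
        · rw [Set.indicator_of_mem (by exact hy), Pi.one_apply, one_mul]
          refine le_trans (lintegral_mono fun x ↦ ?_) (lintegral_boxMeasure_decay_le n _ _ (y u))
          simp only [Set.indicator_apply, hB, Set.mem_inter_iff, Set.mem_ofPred_eq,
            Function.update_of_ne huv, Function.update_of_ne hvi.symm, Function.update_self, hy,
            true_and]
          exact le_rfl
        · refine le_of_eq_of_le ?_ zero_le
          refine (lintegral_congr fun x ↦ ?_).trans lintegral_zero
          refine Set.indicator_of_notMem ?_ _
          rintro ⟨h, -⟩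
          simp only [Set.mem_ofPred_eq, Function.update_of_ne huv,
            Function.update_of_ne hvi.symm] at h
          exact hy h
    _ = (Measure.pi fun _ : Fin n ↦ boxMeasure d n) {y | ‖y u - y i‖ ≤ K} * D := by
        rw [lintegral_mul_const _ (measurable_one.indicator hball), lintegral_indicator_one hball]
    _ ≤ _ := by
        refine mul_le_mul_left ?_ _
        split_ifs with hui
        · exact prob_le_one
        · rw [← lintegral_indicator_one hball,
            lintegral_pi_update _ (measurable_one.indicator hball) u]
          refine (lintegral_mono (g := fun _ ↦ (n : ℝ≥0∞)⁻¹ *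
            volume (Metric.closedBall (0 : EuclideanSpace ℝ (Fin d)) K)) fun y ↦ ?_).trans_eq
              (by simp)
          have h1 : ∀ x, {y : Fin n → EuclideanSpace ℝ (Fin d) | ‖y u - y i‖ ≤ K}.indicator
              (1 : (Fin n → EuclideanSpace ℝ (Fin d)) → ℝ≥0∞) (Function.update y u x) =
                (Metric.closedBall (y i) K).indicator 1 x := by
            intro x
            simp only [Set.indicator_apply, Set.mem_ofPred_eq, Function.update_self,
              Function.update_of_ne (Ne.symm hui), mem_closedBall_iff_norm, Pi.one_apply]
          rw [lintegral_congr h1, lintegral_indicator_one measurableSet_closedBall]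
          refine (boxMeasure_le _ _ _).trans_eq ?_
          rw [Measure.addHaar_closedBall_center]

/-- In a union bound, the `n` choices of `v` cancel its factor `1 / n`. The vertex `u = i`
contributes `1` and the others at most the volume of the `K`-ball, so the bound is uniform in `n`.
-/
theorem IsBoxCSFP.measure_hasLongEdge_le [IsProbabilityMeasure P]
    (hG : IsBoxCSFP P d α β lam n Y W G)
    (hd : 1 ≤ d) (hn : 1 ≤ n) (hα : 0 < α) (hβ : 0 < β) (hlam : 0 < lam) {γ : ℝ} (hγ0 : 0 < γ)
    (hγ1 : γ ≤ 1) {K M : ℝ} (hK : 0 ≤ K) (hKM : K + 1 ≤ M) (i : Fin n) :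
    P {ω | HasLongEdge (G ω) (fun v ↦ Y v ω) i K M} ≤ longEdgeBound d α β lam γ K M := by
  have hset : {ω | HasLongEdge (G ω) (fun v ↦ Y v ω) i K M} =
      ⋃ u, ⋃ v, {ω | ‖Y u ω - Y i ω‖ ≤ K ∧ M < ‖Y v ω - Y i ω‖ ∧ (G ω).Adj u v} := by
    ext ω
    simp [HasLongEdge]
  set L := volume (Metric.closedBall (0 : EuclideanSpace ℝ (Fin d)) K)
  set D := ∫⁻ z in {z : EuclideanSpace ℝ (Fin d) | M - K < ‖z‖}, decay (α * γ) z with hD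
  have hn0 : (n : ℝ≥0∞) * (n : ℝ≥0∞)⁻¹ = 1 := ENNReal.mul_inv_cancel (by simp; omega) (by simp)
  calc _ ≤ ∑ u, ∑ v, P {ω | ‖Y u ω - Y i ω‖ ≤ K ∧ M < ‖Y v ω - Y i ω‖ ∧ (G ω).Adj u v} := by
        rw [hset]
        exact (measure_iUnion_fintype_le _ _).trans
          (Finset.sum_le_sum fun u _ ↦ measure_iUnion_fintype_le _ _)
    _ ≤ ∑ u, ∑ _v : Fin n, edgeConst α β lam γ * ((if u = i then 1 else (n : ℝ≥0∞)⁻¹ * L) *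
          ((n : ℝ≥0∞)⁻¹ * D)) :=
        Finset.sum_le_sum fun u _ ↦ Finset.sum_le_sum fun v _ ↦
          hG.measure_edge_le hd hn hα hβ hlam hγ0 hγ1 hK hKM i u v
    _ = edgeConst α β lam γ * ((∑ u, if u = i then 1 else (n : ℝ≥0∞)⁻¹ * L) *
          (((n : ℝ≥0∞) * (n : ℝ≥0∞)⁻¹) * D)) := by
        simp only [Finset.sum_const, Finset.card_univ, Fintype.card_fin, nsmul_eq_mul]
        rw [Finset.sum_mul, Finset.mul_sum]
        refine Finset.sum_congr rfl fun u _ ↦ ?_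
        ring
    _ ≤ _ := by
        rw [hn0, one_mul, longEdgeBound]
        gcongr
        calc (∑ u, if u = i then 1 else (n : ℝ≥0∞)⁻¹ * L)
            ≤ ∑ u, ((if u = i then 1 else 0) + (n : ℝ≥0∞)⁻¹ * L) :=
              Finset.sum_le_sum fun u _ ↦ by split_ifs <;> simp
          _ = 1 + L := by
              rw [Finset.sum_add_distrib]
              simp [← mul_assoc, hn0]

end Finite

/-- The tuple of `i` and the elements of `S`. -/
def finsetTuple {n : ℕ} (i : Fin n) (S : Finset (Fin n)) : Fin (S.card + 1) → Fin n :=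
  Fin.cons i (S.orderEmbOfFin rfl)

theorem range_finsetTuple {n : ℕ} (i : Fin n) (S : Finset (Fin n)) :
    Set.range (finsetTuple i S) = insert i (S : Set (Fin n)) := by
  rw [finsetTuple, Fin.range_cons, Finset.range_orderEmbOfFin]

theorem injective_finsetTuple {n : ℕ} {i : Fin n} {S : Finset (Fin n)} (hi : i ∉ S) :
    Function.Injective (finsetTuple i S) :=
  Fin.cons_injective_iff.2 ⟨by rwa [Finset.range_orderEmbOfFin],
    (S.orderEmbOfFin rfl).injective⟩

/-- A lower bound for the probability of a pattern of `s` and `t` vertices around two roots. -/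
noncomputable def patternBound (α β lam : ℝ) (d : ℕ) {U : Type*} (r : ℝ≥0) (H : SimpleGraph U)
    (h : U) (c c' : Prop) (K M : ℝ) (n s t : ℕ) : ℝ≥0∞ :=
  (1 - 2 * volume (Metric.closedBall (0 : EuclideanSpace ℝ (Fin d)) M) * (n : ℝ≥0∞)⁻¹) ^
      (n - (s + 1 + (t + 1))) * (((n : ℝ≥0∞)⁻¹ ^ s * localWeight α β lam d r H h c K M s) *
    (((n : ℝ≥0∞)⁻¹ ^ t * localWeight α β lam d r H h c' K M t) * farProb d n M))

/-! ### Pattern events around two roots -/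

section Pattern

variable {Ω : Type*} {d : ℕ} {n : ℕ} {Y : Fin n → Ω → EuclideanSpace ℝ (Fin d)}
  {G : Ω → SimpleGraph (Fin n)} {U : Type*} {r : ℝ≥0} {H : SimpleGraph U} {h : U} {c c' : Prop}
  {K M : ℝ}

/-- The event that `S` and `T` are the sets of the vertices besides `i` and `j` in the balls of
radius `M` around `i` and `j`, and the neighbourhoods of `i` and `j` in the graphs spanned by these
vertices have the properties required. -/
def patternEvent (Y : Fin n → Ω → EuclideanSpace ℝ (Fin d)) (G : Ω → SimpleGraph (Fin n))
    (r : ℝ≥0) (H : SimpleGraph U) (h : U) (c c' : Prop) (K M : ℝ) (i j : Fin n)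
    (S T : Finset (Fin n)) : Set Ω :=
  {ω | (fun i ↦ Y i ω) ∈ pairTuples M (finsetTuple i S) (finsetTuple j T) ∧
    LocalProp r H h c K ((G ω).comap (finsetTuple i S)) (fun a ↦ Y (finsetTuple i S a) ω) ∧
    LocalProp r H h c' K ((G ω).comap (finsetTuple j T)) fun a ↦ Y (finsetTuple j T a) ω}

/-- In the absence of a long edge at `i`, neighbours of vertices in the `K`-ball lie in the
`M`-ball. Its vertices are exactly `i` and `S`, so the spanned graph determines the neighbourhood.
-/
theorem patternEvent_subset {i j : Fin n} {S T : Finset (Fin n)} (hi : i ∉ S) (hj : j ∉ T) :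
    patternEvent Y G r H h c c' K M i j S T ⊆
      {ω | (NbhdIso (G ω) i r H h ↔ c) ∧ (NbhdIso (G ω) j r H h ↔ c')} ∪
        ({ω | HasLongEdge (G ω) (fun v ↦ Y v ω) i K M} ∪
          {ω | HasLongEdge (G ω) (fun v ↦ Y v ω) j K M}) := by
  have key : ∀ {ω : Ω} {i : Fin n} {S : Finset (Fin n)} {c : Prop}, i ∉ S →
      Enumerates (Metric.closedBall (Y i ω) M) (finsetTuple i S) (fun v ↦ Y v ω) →
      LocalProp r H h c K ((G ω).comap (finsetTuple i S)) (fun a ↦ Y (finsetTuple i S a) ω) →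
      ¬ HasLongEdge (G ω) (fun v ↦ Y v ω) i K M → (NbhdIso (G ω) i r H h ↔ c) := by
    intro ω i S c hi he hl hA
    refine nbhdIso_of_localProp_comap (y := fun v ↦ Y v ω) (injective_finsetTuple hi) hl ?_
    intro u v hu huv
    rw [← he v, mem_closedBall_iff_norm]
    by_contra! hv
    exact hA ⟨u, v, hu, hv, huv⟩
  rintro ω ⟨⟨h1, h2⟩, h3, h4⟩
  by_contra hω
  simp only [Set.mem_union, Set.mem_ofPred_eq, not_or] at hω
  exact hω.1 ⟨key hi h1 h3 hω.2.1, key hj h2 h4 hω.2.2⟩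

/-- The locations determine `S` and `T`, so different pattern events are disjoint and their
probabilities add up. -/
theorem eq_of_mem_patternEvent {i j : Fin n} {S T S' T' : Finset (Fin n)} (hS : i ∉ S)
    (hS' : i ∉ S') (hT : j ∉ T) (hT' : j ∉ T') {ω : Ω}
    (hω : ω ∈ patternEvent Y G r H h c c' K M i j S T)
    (hω' : ω ∈ patternEvent Y G r H h c c' K M i j S' T') : S = S' ∧ T = T' := by
  have key : ∀ {i : Fin n} {S S' : Finset (Fin n)}, i ∉ S → i ∉ S' →
      Enumerates (Metric.closedBall (Y i ω) M) (finsetTuple i S) (fun v ↦ Y v ω) →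
      Enumerates (Metric.closedBall (Y i ω) M) (finsetTuple i S') (fun v ↦ Y v ω) → S = S' := by
    intro i S S' hS hS' h1 h2
    ext v
    have h3 := (h1 v).symm.trans (h2 v)
    simp only [range_finsetTuple, Set.mem_insert_iff, Finset.mem_coe] at h3
    constructor
    · intro hv
      exact (h3.1 (Or.inr hv)).resolve_left (by rintro rfl; exact hS hv)
    · intro hv
      exact (h3.2 (Or.inr hv)).resolve_left (by rintro rfl; exact hS' hv)
  exact ⟨key hS hS' hω.1.1 hω'.1.1, key hT hT' hω.1.2 hω'.1.2⟩

end Pattern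

/-! ### Summation over the vertex sets of the two clusters -/

section Finite

variable {Ω : Type*} [MeasurableSpace Ω] {P : Measure Ω} {d : ℕ} {α β lam : ℝ} {n : ℕ}
  {Y : Fin n → Ω → EuclideanSpace ℝ (Fin d)} {W : Fin n → Ω → ℝ} {G : Ω → SimpleGraph (Fin n)}
  {U : Type*} {r : ℝ≥0} {H : SimpleGraph U} {h : U} {c c' : Prop} {K M : ℝ}

theorem IsBoxCSFP.patternBound_le [IsProbabilityMeasure P] (hG : IsBoxCSFP P d α β lam n Y W G)
    (hd : 1 ≤ d) (hn : 1 ≤ n) (hβ : 0 < β) (hlam : 0 < lam) (hM : 0 ≤ M) {s t : ℕ}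
    {σ : Fin (s + 1) → Fin n} {τ : Fin (t + 1) → Fin n} (hστ : Function.Injective (Sum.elim σ τ)) :
    patternBound α β lam d r H h c c' K M n s t ≤
      P {ω | (fun i ↦ Y i ω) ∈ pairTuples M σ τ ∧
        LocalProp r H h c K ((G ω).comap σ) (fun a ↦ Y (σ a) ω) ∧
        LocalProp r H h c' K ((G ω).comap τ) fun a ↦ Y (τ a) ω} := by
  have hBm := measurableSet_pairTuples (d := d) M σ τ
  have hp : ∀ (c : Prop) (m : ℕ), Measurable
      (propWeight α β lam (LocalProp (d := d) (s := m) r H h c K)) := fun c m ↦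
    measurable_propWeight hβ measurableSet_localProp
  rw [hG.sirg.measure_prop_comap hβ hlam hG.pareto hG.indep hστ measurableSet_localProp
    measurableSet_localProp hBm]
  have hm : Measurable fun y : Fin n → EuclideanSpace ℝ (Fin d) ↦
      propWeight α β lam (LocalProp r H h c K) (fun a ↦ y (σ a)) *
        propWeight α β lam (LocalProp r H h c' K) (fun a ↦ y (τ a)) := by
    have h1 := hp c s
    have h2 := hp c' t
    fun_prop
  have hset : ∫⁻ ω in {ω | (fun i ↦ Y i ω) ∈ pairTuples M σ τ},
      propWeight α β lam (LocalProp r H h c K) (fun a ↦ Y (σ a) ω) *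
        propWeight α β lam (LocalProp r H h c' K) (fun a ↦ Y (τ a) ω) ∂P =
      ∫⁻ y in pairTuples M σ τ, propWeight α β lam (LocalProp r H h c K) (fun a ↦ y (σ a)) *
        propWeight α β lam (LocalProp r H h c' K) (fun a ↦ y (τ a))
        ∂(Measure.pi fun _ : Fin n ↦ boxMeasure d n) := by
    rw [← hG.law, setLIntegral_map hBm hm hG.measurable_locations]
    rfl
  rw [hset]
  exact le_setLIntegral_pairTuples hd hn hM hστ (hp c s)
    (propWeight_add_const fun g z a ↦ localProp_add_const g z a) (hp c' t)
    (propWeight_add_const fun g z a ↦ localProp_add_const g z a)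

theorem measurableSet_localProp_comap {Ω V : Type*} [MeasurableSpace Ω] [Countable V]
    {G : Ω → SimpleGraph V} {Y : V → Ω → EuclideanSpace ℝ (Fin d)}
    (hG : ∀ u v, MeasurableSet {ω | (G ω).Adj u v}) (hY : ∀ v, Measurable (Y v)) {m : ℕ}
    (σ : Fin (m + 1) → V) :
    MeasurableSet {ω | LocalProp r H h c K ((G ω).comap σ) fun a ↦ Y (σ a) ω} := by
  have : {ω | LocalProp r H h c K ((G ω).comap σ) fun a ↦ Y (σ a) ω} =
      ⋃ g : SimpleGraph (Fin (m + 1)), (⋂ a, ⋂ b, {ω | (G ω).Adj (σ a) (σ b) ↔ g.Adj a b}) ∩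
        (fun ω a ↦ Y (σ a) ω) ⁻¹' {z | LocalProp r H h c K g z} := by
    ext ω
    simp only [Set.mem_ofPred_eq, Set.mem_iUnion, Set.mem_inter_iff, Set.mem_iInter,
      Set.mem_preimage]
    constructor
    · exact fun hω ↦ ⟨_, fun a b ↦ Iff.rfl, hω⟩
    · rintro ⟨g, hg, hω⟩
      have : (G ω).comap σ = g := by
        ext a b
        exact hg a b
      rwa [this]
  rw [this]
  refine MeasurableSet.iUnion fun g ↦ MeasurableSet.inter (MeasurableSet.iInter fun a ↦
    MeasurableSet.iInter fun b ↦ ?_)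
    (measurable_pi_lambda _ (fun a ↦ hY _) (measurableSet_localProp g))
  by_cases hg : g.Adj a b
  · simpa only [hg, iff_true] using hG _ _
  · simp only [hg, iff_false]
    exact (hG _ _).compl

theorem IsBoxCSFP.measurableSet_patternEvent (hG : IsBoxCSFP P d α β lam n Y W G) (i j : Fin n)
    (S T : Finset (Fin n)) : MeasurableSet (patternEvent Y G r H h c c' K M i j S T) :=
  (hG.measurable_locations (measurableSet_pairTuples M _ _)).inter
    ((measurableSet_localProp_comap hG.sirg.measurable_adj hG.sirg.measurable_location _).inter
      (measurableSet_localProp_comap hG.sirg.measurable_adj hG.sirg.measurable_location _))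

/-- The binomial coefficients count the disjoint pairs `(S, T)` of sizes `s` and `t` that avoid both
roots. Their pattern events are disjoint and imply the joint outcome, except on the events of long
edges. -/
theorem IsBoxCSFP.sum_patternBound_le [IsProbabilityMeasure P]
    (hG : IsBoxCSFP P d α β lam n Y W G) (hd : 1 ≤ d) (hn : 1 ≤ n) (hβ : 0 < β) (hlam : 0 < lam)
    (hM : 0 ≤ M) {i j : Fin n} (hij : i ≠ j) {N : ℕ} (hN : 2 * N + 2 ≤ n) :
    ∑ s ∈ Finset.range N, ∑ t ∈ Finset.range N, ((n - 2).choose s : ℝ≥0∞) *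
        ((n - 2 - s).choose t * patternBound α β lam d r H h c c' K M n s t) ≤
      P {ω | (NbhdIso (G ω) i r H h ↔ c) ∧ (NbhdIso (G ω) j r H h ↔ c')} +
        (P {ω | HasLongEdge (G ω) (fun v ↦ Y v ω) i K M} +
          P {ω | HasLongEdge (G ω) (fun v ↦ Y v ω) j K M}) := by
  classical
  set A : Finset (Fin n) := {i, j}ᶜ with hA
  have hAc : A.card = n - 2 := by
    rw [hA, Finset.card_compl, Fintype.card_fin, Finset.card_pair hij]
  set I : Finset ((_ : Finset (Fin n)) × Finset (Fin n)) :=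
    A.powerset.sigma fun S ↦ (A \ S).powerset with hI
  have hmem : ∀ p ∈ I, i ∉ p.1 ∧ j ∉ p.1 ∧ i ∉ p.2 ∧ j ∉ p.2 ∧ Disjoint p.1 p.2 := by
    rintro ⟨S, T⟩ hp
    simp only [hI, Finset.mem_sigma, Finset.mem_powerset] at hp
    have hiA : i ∉ A := by simp [hA]
    have hjA : j ∉ A := by simp [hA]
    have hT := hp.2.trans Finset.sdiff_subset
    exact ⟨fun h ↦ hiA (hp.1 h), fun h ↦ hjA (hp.1 h), fun h ↦ hiA (hT h), fun h ↦ hjA (hT h),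
      Finset.disjoint_left.2 fun v hv hv' ↦ (Finset.mem_sdiff.1 (hp.2 hv')).2 hv⟩
  -- Since `2 * N + 2 ≤ n`, all sizes `s, t < N` occur in the full ranges. The terms added are
  -- nonnegative.
  calc _ ≤ ∑ s ∈ Finset.range (A.card + 1), A.card.choose s •
        ∑ t ∈ Finset.range (A.card - s + 1), (A.card - s).choose t •
          patternBound α β lam d r H h c c' K M n s t := by
        rw [hAc]
        refine (Finset.sum_le_sum fun s hs ↦ ?_).trans
          (Finset.sum_le_sum_of_subset (Finset.range_subset_range.2 (by omega)))
        rw [← Finset.mul_sum, nsmul_eq_mul]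
        refine mul_le_mul_right ?_ _
        simp only [← nsmul_eq_mul]
        have := Finset.mem_range.1 hs
        exact Finset.sum_le_sum_of_subset (Finset.range_subset_range.2 (by omega))
    _ = ∑ p ∈ I, patternBound α β lam d r H h c c' K M n p.1.card p.2.card := by
        rw [hI, Finset.sum_sigma, ← Finset.sum_powerset_apply_card (f := fun s ↦
          ∑ t ∈ Finset.range (A.card - s + 1), (A.card - s).choose t •
            patternBound α β lam d r H h c c' K M n s t)]
        refine Finset.sum_congr rfl fun S hS ↦ ?_
        rw [Finset.sum_powerset_apply_card (f := fun t ↦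
          patternBound α β lam d r H h c c' K M n S.card t),
          Finset.card_sdiff_of_subset (Finset.mem_powerset.1 hS)]
    _ ≤ ∑ p ∈ I, P (patternEvent Y G r H h c c' K M i j p.1 p.2) := by
        refine Finset.sum_le_sum fun p hp ↦ hG.patternBound_le hd hn hβ hlam hM ?_
        obtain ⟨h1, h2, h3, h4, h5⟩ := hmem p hp
        refine (injective_finsetTuple h1).sumElim (injective_finsetTuple h4) fun a b hab ↦ ?_
        have ha : finsetTuple i p.1 a ∈ insert i (p.1 : Set (Fin n)) :=
          range_finsetTuple i p.1 ▸ Set.mem_range_self a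
        have hb : finsetTuple j p.2 b ∈ insert j (p.2 : Set (Fin n)) :=
          range_finsetTuple j p.2 ▸ Set.mem_range_self b
        rw [← hab] at hb
        rcases ha with ha | ha <;> rcases hb with hb | hb
        · exact hij (ha.symm.trans hb)
        · rw [ha] at hb; exact h3 hb
        · rw [hb] at ha; exact h2 ha
        · exact Finset.disjoint_left.1 h5 ha hb
    _ = P (⋃ p ∈ I, patternEvent Y G r H h c c' K M i j p.1 p.2) := by
        refine (measure_biUnion_finset ?_ fun p _ ↦ hG.measurableSet_patternEvent i j _ _).symm
        intro p hp q hq hpq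
        refine Set.disjoint_left.2 fun ω h1 h2 ↦ hpq ?_
        obtain ⟨e1, e2⟩ := eq_of_mem_patternEvent (hmem p hp).1 (hmem q hq).1 (hmem p hp).2.2.2.1
          (hmem q hq).2.2.2.1 h1 h2
        obtain ⟨S, T⟩ := p
        obtain ⟨S', T'⟩ := q
        simp only at e1 e2
        rw [e1, e2]
    _ ≤ _ := (measure_mono (Set.iUnion₂_subset fun p hp ↦
        patternEvent_subset (hmem p hp).1 (hmem p hp).2.2.2.1)).trans
          ((measure_union_le _ _).trans (add_le_add_right (measure_union_le _ _) _))

end Finite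

/-! ### Limits as n tends to infinity -/

theorem tendsto_choose_sub_mul_inv_pow (a k : ℕ) :
    Tendsto (fun n : ℕ ↦ ((n - a).choose k : ℝ≥0∞) * (n : ℝ≥0∞)⁻¹ ^ k) atTop
      (𝓝 (k.factorial : ℝ≥0∞)⁻¹) := by
  have hk : (k.factorial : ℝ) ≠ 0 := by positivity
  have h1 : Tendsto (fun m : ℕ ↦ (m.choose k : ℝ) / ((m : ℝ) ^ k / k.factorial)) atTop (𝓝 1) :=
    (Asymptotics.isEquivalent_iff_tendsto_one (by
      filter_upwards [eventually_gt_atTop 0] with m hm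
      positivity)).1 (isEquivalent_choose k)
  have h2 : Tendsto (fun n : ℕ ↦ ((n - a : ℕ) : ℝ) / n) atTop (𝓝 1) := by
    have : Tendsto (fun n : ℕ ↦ 1 - (a : ℝ) / n) atTop (𝓝 (1 - 0)) :=
      tendsto_const_nhds.sub (tendsto_const_div_atTop_nhds_zero_nat _)
    rw [sub_zero] at this
    refine this.congr' ?_
    filter_upwards [eventually_ge_atTop a, eventually_gt_atTop 0] with n hn hn0
    rw [Nat.cast_sub hn]
    field_simp
  have h3 : Tendsto (fun n : ℕ ↦ ((n - a).choose k : ℝ) * (n : ℝ)⁻¹ ^ k) atTop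
      (𝓝 (k.factorial : ℝ)⁻¹) := by
    have := ((h1.comp (tendsto_sub_atTop_nat a)).mul (h2.pow k)).div_const (k.factorial : ℝ)
    rw [one_pow, mul_one, one_div] at this
    refine this.congr' ?_
    filter_upwards [eventually_gt_atTop a] with n hn
    have hn0 : (n : ℝ) ≠ 0 := by
      have : 0 < n := by omega
      positivity
    have hna : ((n - a : ℕ) : ℝ) ≠ 0 := by
      have : 0 < n - a := by omega
      positivity
    simp only [Function.comp]
    rw [div_div_eq_mul_div, div_pow, inv_pow]
    field_simp
  have h4 := ENNReal.tendsto_ofReal h3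
  rw [ENNReal.ofReal_inv_of_pos (by positivity), ENNReal.ofReal_natCast] at h4
  refine h4.congr' ?_
  filter_upwards [eventually_gt_atTop 0] with n hn
  rw [ENNReal.ofReal_mul (by positivity), ENNReal.ofReal_natCast, ENNReal.ofReal_pow (by positivity),
    ENNReal.ofReal_inv_of_pos (by positivity), ENNReal.ofReal_natCast]

theorem tendsto_one_sub_mul_inv_pow {L : ℝ≥0∞} (hL : L ≠ ∞) (b : ℕ) :
    Tendsto (fun n : ℕ ↦ (1 - L * (n : ℝ≥0∞)⁻¹) ^ (n - b)) atTop
      (𝓝 (ENNReal.ofReal (Real.exp (-L.toReal)))) := by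
  set l := L.toReal with hl
  have h0 : Tendsto (fun n : ℕ ↦ 1 + (-l) / n) atTop (𝓝 (1 + 0)) :=
    tendsto_const_nhds.add (tendsto_const_div_atTop_nhds_zero_nat _)
  rw [add_zero] at h0
  have h1 : Tendsto (fun n : ℕ ↦ (1 + (-l) / n) ^ n / (1 + (-l) / n) ^ b) atTop
      (𝓝 (Real.exp (-l) / 1 ^ b)) :=
    (Real.tendsto_one_add_div_pow_exp (-l)).div (h0.pow b) (by simp)
  rw [one_pow, div_one] at h1
  refine (ENNReal.tendsto_ofReal h1).congr' ?_
  filter_upwards [h0.eventually (lt_mem_nhds one_pos), eventually_ge_atTop b,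
    eventually_gt_atTop 0] with n hpos hb hn
  rw [div_eq_mul_inv, ← pow_sub₀ _ hpos.ne' hb, ENNReal.ofReal_pow hpos.le, neg_div, ← sub_eq_add_neg,
    ENNReal.ofReal_sub _ (by positivity), ENNReal.ofReal_one, div_eq_mul_inv,
    ENNReal.ofReal_mul (by positivity), hl, ENNReal.ofReal_toReal hL,
    ENNReal.ofReal_inv_of_pos (by positivity), ENNReal.ofReal_natCast]

theorem tendsto_boxMeasure_box {d : ℕ} (hd : 1 ≤ d) {M : ℝ} (hM : 0 ≤ M) :
    Tendsto (fun n ↦ boxMeasure d n (box d n M)) atTop (𝓝 1) := by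
  have hpow : Tendsto (fun n : ℕ ↦ (n : ℝ) ^ (1 / d : ℝ)) atTop atTop :=
    (tendsto_rpow_atTop (by positivity)).comp tendsto_natCast_atTop_atTop
  have h1 : Tendsto (fun n : ℕ ↦ (1 - 2 * M / (n : ℝ) ^ (1 / d : ℝ)) ^ d) atTop
      (𝓝 ((1 - 0) ^ d)) := (tendsto_const_nhds.sub (hpow.const_div_atTop _)).pow d
  rw [sub_zero, one_pow] at h1
  have h2 := ENNReal.tendsto_ofReal h1
  rw [ENNReal.ofReal_one] at h2
  refine h2.congr' ?_
  filter_upwards [eventually_gt_atTop 0, hpow.eventually_ge_atTop (2 * M)] with n hn hnM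
  have hn0 : (0 : ℝ) < (n : ℝ) ^ (1 / d : ℝ) := by positivity
  have hsub : box d n M ⊆ box d n 0 := fun x hx k ↦ (hx k).trans (by linarith)
  have hnd : ((n : ℝ) ^ (1 / d : ℝ)) ^ d = n := by
    rw [← Real.rpow_natCast, ← Real.rpow_mul (by positivity), one_div,
      inv_mul_cancel₀ (by positivity), Real.rpow_one]
  rw [boxMeasure, Measure.smul_apply, Measure.restrict_apply (measurableSet_box _ _ _),
    Set.inter_eq_left.2 hsub, volume_box, smul_eq_mul, ← ENNReal.ofReal_natCast (n := n),
    ← ENNReal.ofReal_inv_of_pos (by positivity), ← ENNReal.ofReal_pow (by linarith),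
    ← ENNReal.ofReal_mul (by positivity)]
  congr 1
  rw [one_sub_div hn0.ne', div_pow, hnd, div_eq_inv_mul]

theorem tendsto_farProb {d : ℕ} (hd : 1 ≤ d) {M : ℝ} (hM : 0 ≤ M) :
    Tendsto (fun n ↦ farProb d n M) atTop (𝓝 1) := by
  have h1 := tendsto_boxMeasure_box hd hM
  have hL : volume (Metric.closedBall (0 : EuclideanSpace ℝ (Fin d)) (2 * M)) ≠ ∞ :=
    measure_closedBall_lt_top.ne
  have h2 : Tendsto (fun n : ℕ ↦ volume (Metric.closedBall (0 : EuclideanSpace ℝ (Fin d)) (2 * M)) *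
      (n : ℝ≥0∞)⁻¹) atTop (𝓝 0) := by
    have := ENNReal.Tendsto.const_mul ENNReal.tendsto_inv_nat_nhds_zero (Or.inr hL)
    rwa [mul_zero] at this
  have h3 := ENNReal.Tendsto.mul h1 (Or.inl one_ne_zero)
    (ENNReal.Tendsto.sub h1 h2 (Or.inl ENNReal.one_ne_top)) (Or.inr ENNReal.one_ne_top)
  simpa [farProb] using h3

/-- The probability, in the limit, that `s` vertices besides the root are in the ball of radius `M`
around it and span a graph with the property required. -/
noncomputable def limitWeight (α β lam : ℝ) (d : ℕ) {U : Type*} (r : ℝ≥0) (H : SimpleGraph U)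
    (h : U) (c : Prop) (K M : ℝ) (s : ℕ) : ℝ≥0∞ :=
  ENNReal.ofReal (Real.exp (-(volume (Metric.closedBall (0 : EuclideanSpace ℝ (Fin d)) M)).toReal)) *
    (s.factorial : ℝ≥0∞)⁻¹ * localWeight α β lam d r H h c K M s

/-- The probability that the other vertices avoid both balls tends to `exp (-2|B_M|)`, one factor
`exp (-|B_M|)` for each root. The binomials with the powers of `1 / n` tend to `1 / (s! t!)`. -/
theorem tendsto_patternBound {α β lam : ℝ} {d : ℕ} (hd : 1 ≤ d) {U : Type*} (r : ℝ≥0)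
    (H : SimpleGraph U) (h : U) (c c' : Prop) (K : ℝ) {M : ℝ} (hM : 0 ≤ M) (s t : ℕ) :
    Tendsto (fun n : ℕ ↦ ((n - 2).choose s : ℝ≥0∞) *
      ((n - 2 - s).choose t * patternBound α β lam d r H h c c' K M n s t)) atTop
      (𝓝 (limitWeight α β lam d r H h c K M s * limitWeight α β lam d r H h c' K M t)) := by
  set L := volume (Metric.closedBall (0 : EuclideanSpace ℝ (Fin d)) M) with hL
  have hLt : L ≠ ∞ := measure_closedBall_lt_top.ne
  have h1 := tendsto_choose_sub_mul_inv_pow 2 s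
  have h2 := tendsto_choose_sub_mul_inv_pow (2 + s) t
  have h3 := tendsto_one_sub_mul_inv_pow (L := 2 * L) (ENNReal.mul_ne_top (by simp) hLt)
    (s + 1 + (t + 1))
  have h4 := tendsto_farProb hd hM
  have hf : ∀ k : ℕ, (k.factorial : ℝ≥0∞)⁻¹ ≠ 0 := fun k ↦
    ENNReal.inv_ne_zero.2 (ENNReal.natCast_ne_top _)
  have hf' : ∀ k : ℕ, (k.factorial : ℝ≥0∞)⁻¹ ≠ ∞ := fun k ↦
    ENNReal.inv_ne_top.2 (by simp [k.factorial_ne_zero])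
  have he : ENNReal.ofReal (Real.exp (-(2 * L).toReal)) ≠ 0 := by
    simp [Real.exp_pos]
  have h12 := ENNReal.Tendsto.mul h1 (Or.inl (hf s)) h2 (Or.inl (hf t))
  have h123 := ENNReal.Tendsto.mul h12 (Or.inl (mul_ne_zero (hf s) (hf t))) h3 (Or.inl he)
  have h1234 := ENNReal.Tendsto.mul h123 (Or.inl (mul_ne_zero (mul_ne_zero (hf s) (hf t)) he)) h4
    (Or.inl one_ne_zero)
  -- The limit of the first factor is nonzero, so finiteness of the local weights need not be known.
  have h5 := ENNReal.Tendsto.mul_const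
    (b := localWeight α β lam d r H h c K M s * localWeight α β lam d r H h c' K M t) h1234
    (Or.inl (mul_ne_zero (mul_ne_zero (mul_ne_zero (hf s) (hf t)) he) one_ne_zero))
  have hexp : ENNReal.ofReal (Real.exp (-(2 * L).toReal)) =
      ENNReal.ofReal (Real.exp (-L.toReal)) * ENNReal.ofReal (Real.exp (-L.toReal)) := by
    rw [← ENNReal.ofReal_mul (by positivity), ← Real.exp_add, ENNReal.toReal_mul]
    congr 2
    simp
    ring
  convert h5 using 2 with n
  · rw [patternBound, Nat.sub_sub]
    ring
  · rw [limitWeight, limitWeight, hexp]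
    ring

theorem IsInfiniteCSFP.exists_lt_sum {Ω : Type*} [MeasurableSpace Ω] {Q : Measure Ω}
    [IsProbabilityMeasure Q] {d : ℕ} {α β lam : ℝ} {Y : ℕ → Ω → EuclideanSpace ℝ (Fin d)}
    {W : ℕ → Ω → ℝ} {G : Ω → SimpleGraph ℕ}
    (hG : IsInfiniteCSFP Q d α β lam Y W G) (hβ : 0 < β) (hlam : 0 < lam) {U : Type*} (r : ℝ≥0)
    (H : SimpleGraph U) (h : U) (c c' : Prop) {K M : ℝ} (hKM : K ≤ M) {ε : ℝ≥0∞} (hε : ε ≠ 0) :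
    ∃ N : ℕ, Q {ω | (NbhdIso (G ω) 0 r H h ↔ c) ∧ ∀ v ∈ ball (G ω) 0 r, ‖Y v ω‖ ≤ K} *
        Q {ω | (NbhdIso (G ω) 0 r H h ↔ c') ∧ ∀ v ∈ ball (G ω) 0 r, ‖Y v ω‖ ≤ K} <
      ∑ s ∈ Finset.range N, ∑ t ∈ Finset.range N,
        limitWeight α β lam d r H h c K M s * limitWeight α β lam d r H h c' K M t + ε := by
  set q : Prop → ℝ≥0∞ := fun c ↦
    Q {ω | (NbhdIso (G ω) 0 r H h ↔ c) ∧ ∀ v ∈ ball (G ω) 0 r, ‖Y v ω‖ ≤ K} with hq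
  have hqt : ∀ c, q c ≠ ∞ := fun c ↦ measure_ne_top _ _
  set A : Prop → ℕ → ℝ≥0∞ := fun c N ↦
    ∑ s ∈ Finset.range N, limitWeight α β lam d r H h c K M s with hA
  -- The series dominates `q c` but is not known to be finite. Truncating at `q c` keeps the limits
  -- finite, so that the product converges.
  have htend : ∀ c, Tendsto (fun N ↦ min (A c N) (q c)) atTop (𝓝 (q c)) := by
    intro c
    have h1 : Tendsto (A c) atTop (𝓝 (∑' s, limitWeight α β lam d r H h c K M s)) :=
      ENNReal.tendsto_nat_tsum _
    have h2 := h1.min (tendsto_const_nhds (x := q c))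
    have hle : q c ≤ ∑' s, limitWeight α β lam d r H h c K M s :=
      hG.measure_le hβ hlam r H h c hKM
    rwa [min_eq_right hle] at h2
  have hmul := (ENNReal.Tendsto.mul (htend c) (Or.inr (hqt c')) (htend c') (Or.inr (hqt c))).add
    (tendsto_const_nhds (x := ε))
  have hlt : q c * q c' < q c * q c' + ε :=
    ENNReal.lt_add_right (ENNReal.mul_ne_top (hqt c) (hqt c')) hε
  obtain ⟨N, hN⟩ := (hmul.eventually (lt_mem_nhds hlt)).exists
  refine ⟨N, hN.trans_le ?_⟩
  rw [← Finset.sum_mul_sum]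
  gcongr
  · exact min_le_left _ _
  · exact min_le_left _ _

theorem tendsto_longEdgeBound {d : ℕ} {α β lam γ : ℝ} (hγβ : γ < β) (hdγ : d < α * γ) (K : ℝ) :
    Tendsto (fun M ↦ longEdgeBound d α β lam γ K M) atTop (𝓝 0) := by
  have h1 := (tendsto_setLIntegral_decay hdγ).comp (tendsto_atTop_add_const_right _ (-K) tendsto_id)
  have h2 := ENNReal.Tendsto.const_mul (a := edgeConst α β lam γ) (ENNReal.Tendsto.const_mul
    (a := 1 + volume (Metric.closedBall (0 : EuclideanSpace ℝ (Fin d)) K)) h1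
    (Or.inr (ENNReal.add_ne_top.2 ⟨ENNReal.one_ne_top, measure_closedBall_lt_top.ne⟩)))
    (Or.inr (edgeConst_ne_top hγβ))
  rw [mul_zero, mul_zero] at h2
  refine h2.congr fun M ↦ ?_
  simp [longEdgeBound, sub_eq_add_neg]

/-- Asymptotic lower bound for the joint distribution of the neighbourhoods of two vertices. -/
theorem eventually_mul_le_measure {d : ℕ} (hd : 1 ≤ d) {α β lam : ℝ} (hβ : 0 < β) (hlam : 0 < lam)
    (hmin : (d : ℝ) < min α (α * β)) {Ω : ℕ → Type*} [∀ n, MeasurableSpace (Ω n)]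
    {P : ∀ n, Measure (Ω n)} [∀ n, IsProbabilityMeasure (P n)]
    {X : ∀ n, Fin n → Ω n → EuclideanSpace ℝ (Fin d)} {W : ∀ n, Fin n → Ω n → ℝ}
    {G : ∀ n, Ω n → SimpleGraph (Fin n)}
    (hG : ∀ n, 1 ≤ n → IsFiniteCSFP (P n) d α β lam n (X n) (W n) (G n))
    {Ω' : Type*} [MeasurableSpace Ω'] {Q : Measure Ω'} [IsProbabilityMeasure Q]
    {Y : ℕ → Ω' → EuclideanSpace ℝ (Fin d)} {W' : ℕ → Ω' → ℝ} {Ginf : Ω' → SimpleGraph ℕ}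
    (hGinf : IsInfiniteCSFP Q d α β lam Y W' Ginf) {U : Type*} (r : ℝ≥0)
    (H : SimpleGraph U) (h : U) (c c' : Prop) {δ : ℝ≥0∞} (hδ : δ ≠ 0) :
    ∀ᶠ n in atTop, ∀ i j : Fin n, i ≠ j →
      Q {ω | NbhdIso (Ginf ω) 0 r H h ↔ c} * Q {ω | NbhdIso (Ginf ω) 0 r H h ↔ c'} ≤
        P n {ω | (NbhdIso (G n ω) i r H h ↔ c) ∧ (NbhdIso (G n ω) j r H h ↔ c')} + δ := by
  obtain ⟨γ, hγ0, hγ1, hγβ, hdγ⟩ := exists_exponent hmin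
  have hα : 0 < α := d.cast_nonneg.trans_lt (hmin.trans_le (min_le_left _ _))
  -- The four errors are the restriction to distance `K`, the truncation of the series at `N`, and
  -- the long edges at `i` and at `j`. The constants are chosen in the order `K`, `M`, `N`, then
  -- `n`.
  set ε : ℝ≥0∞ := δ / 4 with hε
  have hε0 : ε ≠ 0 := by simp [hε, hδ]
  set q : Prop → ℝ≥0∞ := fun c ↦ Q {ω | NbhdIso (Ginf ω) 0 r H h ↔ c} with hq
  set qK : ℕ → Prop → ℝ≥0∞ := fun K c ↦
    Q {ω | (NbhdIso (Ginf ω) 0 r H h ↔ c) ∧ ∀ v ∈ ball (Ginf ω) 0 r, ‖Y v ω‖ ≤ K} with hqK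
  have hqt : ∀ c, q c ≠ ∞ := fun c ↦ measure_ne_top _ _
  have hK : ∀ᶠ K in atTop, q c * q c' < qK K c * qK K c' + ε :=
    ((ENNReal.Tendsto.mul (hGinf.tendsto_measure hβ hlam hmin r H h c) (Or.inr (hqt c'))
      (hGinf.tendsto_measure hβ hlam hmin r H h c') (Or.inr (hqt c))).add
        (tendsto_const_nhds (x := ε))).eventually
          (lt_mem_nhds (ENNReal.lt_add_right (ENNReal.mul_ne_top (hqt c) (hqt c')) hε0))
  obtain ⟨K, hK⟩ := hK.exists
  have hM := ((tendsto_longEdgeBound (lam := lam) hγβ hdγ (K : ℝ)).eventually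
    (gt_mem_nhds (pos_iff_ne_zero.2 hε0))).and (eventually_ge_atTop ((K : ℝ) + 1))
  obtain ⟨M, hMε, hKM⟩ := hM.exists
  have hK0 : (0 : ℝ) ≤ K := K.cast_nonneg
  have hM0 : 0 ≤ M := by linarith
  obtain ⟨N, hN⟩ := hGinf.exists_lt_sum hβ hlam r H h c c' (K := K) (M := M) (by linarith) hε0
  have hsum := (tendsto_finsetSum (Finset.range N) fun s _ ↦
    tendsto_finsetSum (Finset.range N) fun t _ ↦
      tendsto_patternBound (α := α) (β := β) (lam := lam) hd r H h c c' (K : ℝ) hM0 s t).add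
        (tendsto_const_nhds (x := ε))
  filter_upwards [hsum.eventually (lt_mem_nhds hN), eventually_ge_atTop (2 * N + 2)] with n hn hnN
  intro i j hij
  have hn1 : 1 ≤ n := by omega
  have hB := (hG n hn1).isBoxCSFP hd hn1
  have herr := fun i ↦ (hB.measure_hasLongEdge_le hd hn1 hα hβ hlam hγ0 hγ1 hK0 hKM i).trans hMε.le
  have hS := hB.sum_patternBound_le (r := r) (H := H) (h := h) (c := c) (c' := c') (K := K)
    hd hn1 hβ hlam hM0 hij hnN
  calc q c * q c' ≤ qK K c * qK K c' + ε := hK.le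
    _ ≤ P n {ω | (NbhdIso (G n ω) i r H h ↔ c) ∧ (NbhdIso (G n ω) j r H h ↔ c')} + (ε + ε)
        + ε + ε := by
        gcongr
        refine hn.le.trans ?_
        gcongr
        exact hS.trans (by gcongr <;> exact herr _)
    _ = P n {ω | (NbhdIso (G n ω) i r H h ↔ c) ∧ (NbhdIso (G n ω) j r H h ↔ c')} + 4 * ε := by ring
    _ = _ := by rw [hε, ENNReal.mul_div_cancel (by simp) (by simp)]

/-! ### Chebyshev's inequality and the conclusion -/

theorem measurableSet_nbhdIso {Ω V : Type*} [MeasurableSpace Ω] [Finite V] {G : Ω → SimpleGraph V}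
    (hG : ∀ u v, MeasurableSet {ω | (G ω).Adj u v}) {U : Type*} (v : V) (r : ℝ≥0)
    (H : SimpleGraph U) (h : U) : MeasurableSet {ω | NbhdIso (G ω) v r H h} := by
  have : {ω | NbhdIso (G ω) v r H h} = ⋃ g ∈ {g : SimpleGraph V | NbhdIso g v r H h},
      ⋂ a, ⋂ b, {ω | (G ω).Adj a b ↔ g.Adj a b} := by
    ext ω
    simp only [Set.mem_ofPred_eq, Set.mem_iUnion, Set.mem_iInter, exists_prop]
    constructor
    · exact fun hω ↦ ⟨_, hω, fun a b ↦ Iff.rfl⟩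
    · rintro ⟨g, hg, hω⟩
      have : G ω = g := by
        ext a b
        exact hω a b
      rwa [this]
  rw [this]
  refine MeasurableSet.biUnion (Set.to_countable _) fun g _ ↦ MeasurableSet.iInter fun a ↦
    MeasurableSet.iInter fun b ↦ ?_
  by_cases hg : g.Adj a b
  · simpa only [hg, iff_true] using hG _ _
  · simp only [hg, iff_false]
    exact (hG _ _).compl

/-- Chebyshev's inequality for the proportion of events that occur. -/
theorem mul_measureReal_proportion_le {Ω : Type*} [MeasurableSpace Ω] {μ : Measure Ω}
    [IsProbabilityMeasure μ] {n : ℕ} (hn : 1 ≤ n) {A : Fin n → Set Ω}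
    (hA : ∀ i, MeasurableSet (A i)) {p a b ε : ℝ} (hp : 0 ≤ p) (ha : 0 ≤ a) (hε : 0 < ε)
    (h1 : ∀ i, b ≤ μ.real (A i)) (h2 : ∀ i j, i ≠ j → μ.real (A i ∩ A j) ≤ a) :
    ε ^ 2 * μ.real {ω | ε ≤ |({i | ω ∈ A i}.ncard : ℝ) / n - p|} ≤
      1 / n + a - 2 * p * b + p ^ 2 := by
  classical
  have hn0 : (0 : ℝ) < n := by exact_mod_cast hn
  set f : Ω → ℝ := fun ω ↦ ∑ i, (A i).indicator 1 ω with hf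
  have hcard : ∀ ω, ({i | ω ∈ A i}.ncard : ℝ) = f ω := by
    intro ω
    rw [Set.ncard_eq_toFinset_card', hf]
    simp [Set.indicator_apply]
  have hint : ∀ B, MeasurableSet B → Integrable (B.indicator (1 : Ω → ℝ)) μ := fun B hB ↦
    (integrable_const (1 : ℝ)).indicator hB
  have hfi : Integrable f μ := integrable_finsetSum _ fun i _ ↦ hint _ (hA i)
  have hf2 : ∀ ω, f ω ^ 2 = ∑ i, ∑ j, (A i ∩ A j).indicator 1 ω := by
    intro ω
    rw [hf, sq, Finset.sum_mul_sum]
    simp only [Set.inter_indicator_one, Pi.mul_apply]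
  have hf2i : Integrable (fun ω ↦ f ω ^ 2) μ := by
    simp_rw [hf2]
    exact integrable_finsetSum _ fun i _ ↦ integrable_finsetSum _ fun j _ ↦
      hint _ ((hA i).inter (hA j))
  have hIf : (n : ℝ) * b ≤ ∫ ω, f ω ∂μ := by
    rw [hf, integral_finsetSum _ fun i _ ↦ hint _ (hA i)]
    simp only [integral_indicator_one (hA _)]
    calc (n : ℝ) * b = ∑ _i : Fin n, b := by simp
      _ ≤ _ := Finset.sum_le_sum fun i _ ↦ h1 i
  have hIf2 : ∫ ω, f ω ^ 2 ∂μ ≤ n + n ^ 2 * a := by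
    simp_rw [hf2]
    rw [integral_finsetSum _ fun i _ ↦ integrable_finsetSum _ fun j _ ↦
      hint _ ((hA i).inter (hA j))]
    -- The diagonal terms contribute at most `n` beyond `n ^ 2 * a`, which becomes `1 / n` after
    -- normalisation.
    calc _ ≤ ∑ i : Fin n, ∑ j : Fin n, ((if i = j then 1 else 0) + a) := by
          refine Finset.sum_le_sum fun i _ ↦ ?_
          rw [integral_finsetSum _ fun j _ ↦ hint _ ((hA i).inter (hA j))]
          refine Finset.sum_le_sum fun j _ ↦ ?_
          rw [integral_indicator_one ((hA i).inter (hA j))]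
          split_ifs with hij
          · exact measureReal_le_one.trans (by linarith)
          · simpa using h2 i j hij
      _ = _ := by
          simp [Finset.sum_add_distrib]
          ring
  -- The second moment is taken about `p` and not about the mean. The mean enters with a negative
  -- sign, so its lower bound suffices.
  have hexp : (fun ω ↦ (f ω / n - p) ^ 2) = fun ω ↦
      f ω ^ 2 * (1 / n ^ 2) - f ω * (2 * p / n) + p ^ 2 := by
    funext ω
    field_simp
    ring
  have hsub : Integrable (fun ω ↦ f ω ^ 2 * (1 / n ^ 2) - f ω * (2 * p / n)) μ :=
    (hf2i.mul_const _).sub (hfi.mul_const _)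
  have hgi : Integrable (fun ω ↦ (f ω / n - p) ^ 2) μ := by
    rw [hexp]
    exact hsub.add (integrable_const _)
  have hval : ∫ ω, (f ω / n - p) ^ 2 ∂μ =
      (∫ ω, f ω ^ 2 ∂μ) * (1 / n ^ 2) - (∫ ω, f ω ∂μ) * (2 * p / n) + p ^ 2 := by
    rw [hexp, integral_add hsub (integrable_const _),
      integral_sub (hf2i.mul_const _) (hfi.mul_const _), integral_mul_const, integral_mul_const]
    simp
  have hset : {ω | ε ≤ |({i | ω ∈ A i}.ncard : ℝ) / n - p|} =
      {ω | ε ^ 2 ≤ (f ω / n - p) ^ 2} := by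
    ext ω
    simp only [Set.mem_ofPred_eq, hcard]
    rw [sq_le_sq, abs_of_pos hε]
  rw [hset]
  refine (mul_meas_ge_le_integral_of_nonneg (ae_of_all _ fun ω ↦ sq_nonneg _) hgi _).trans ?_
  rw [hval]
  have e1 : (∫ ω, f ω ^ 2 ∂μ) * (1 / n ^ 2) ≤ 1 / n + a := by
    refine (mul_le_mul_of_nonneg_right hIf2 (by positivity)).trans_eq ?_
    field_simp
  have e2 : 2 * p * b ≤ (∫ ω, f ω ∂μ) * (2 * p / n) := by
    refine le_of_eq_of_le ?_ (mul_le_mul_of_nonneg_right hIf (by positivity))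
    field_simp
  linarith

end CSFP

theorem mainTheorem10 (d : ℕ) (hd : 1 ≤ d) (α β lam : ℝ) (hβ : 0 < β) (hlam : 0 < lam)
    (hmin : (d : ℝ) < min α (α * β))
    {Ω : ℕ → Type*} [∀ n, MeasurableSpace (Ω n)] (P : ∀ n, Measure (Ω n))
    [∀ n, IsProbabilityMeasure (P n)]
    (X : ∀ n, Fin n → Ω n → EuclideanSpace ℝ (Fin d)) (W : ∀ n, Fin n → Ω n → ℝ)
    (G : ∀ n, Ω n → SimpleGraph (Fin n))
    (hG : ∀ n, 1 ≤ n → CSFP.IsFiniteCSFP (P n) d α β lam n (X n) (W n) (G n))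
    {Ω' : Type*} [MeasurableSpace Ω'] (Q : Measure Ω') [IsProbabilityMeasure Q]
    (Y : ℕ → Ω' → EuclideanSpace ℝ (Fin d)) (W' : ℕ → Ω' → ℝ) (Ginf : Ω' → SimpleGraph ℕ)
    (hGinf : CSFP.IsInfiniteCSFP Q d α β lam Y W' Ginf) :
    CSFP.ConvergesLocallyInProbability P G Q Ginf 0 := by
  refine ⟨hGinf.ae_locFinite hβ hlam hmin, fun r _ U H h _ ε hε ↦ ?_⟩
  set p := Q.real {ω' | CSFP.NbhdIso (Ginf ω') 0 r H h} with hp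
  set p' := Q.real {ω' | ¬ CSFP.NbhdIso (Ginf ω') 0 r H h} with hp'
  have hp0 : 0 ≤ p := measureReal_nonneg
  have hp1 : p ≤ 1 := measureReal_le_one
  -- Subadditivity of the outer measure gives this inequality without measurability, and it is all
  -- that is used below.
  have hpp : 1 ≤ p + p' := by
    have := measureReal_union_le (μ := Q) {ω' | CSFP.NbhdIso (Ginf ω') 0 r H h}
      {ω' | ¬ CSFP.NbhdIso (Ginf ω') 0 r H h}
    have hu : {ω' | CSFP.NbhdIso (Ginf ω') 0 r H h} ∪ {ω' | ¬ CSFP.NbhdIso (Ginf ω') 0 r H h} =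
        Set.univ := by
      ext ω
      simpa using em _
    rw [hu, probReal_univ] at this
    exact this
  have hmain : ∀ δ : ℝ, 0 < δ → ∀ᶠ n in atTop,
      ε ^ 2 * (P n).real {ω | ε ≤ |({i | CSFP.NbhdIso (G n ω) i r H h}.ncard : ℝ) / n - p|} ≤
        1 / n + 7 * δ := by
    intro δ hδ
    have hδ0 : ENNReal.ofReal δ ≠ 0 := by simpa using hδ
    have key := fun c c' ↦ CSFP.eventually_mul_le_measure hd hβ hlam hmin hG hGinf r H h c c' hδ0
    filter_upwards [key True True, key True False, key False True, key False False,
      eventually_ge_atTop 2] with n h11 h10 h01 h00 hn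
    simp only [iff_true, iff_false] at h11 h10 h01 h00
    set A : Fin n → Set (Ω n) := fun i ↦ {ω | CSFP.NbhdIso (G n ω) i r H h} with hA
    have hAm : ∀ i, MeasurableSet (A i) := fun i ↦
      CSFP.measurableSet_nbhdIso (hG n (by omega)).sirg.measurable_adj i r H h
    have hreal : ∀ {x y : ℝ≥0∞} {B : Set (Ω n)}, x * y ≤ P n B + ENNReal.ofReal δ →
        x.toReal * y.toReal ≤ (P n).real B + δ := by
      intro x y B hB
      have := ENNReal.toReal_mono (ENNReal.add_ne_top.2 ⟨measure_ne_top _ _, ENNReal.ofReal_ne_top⟩)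
        hB
      rwa [ENNReal.toReal_mul, ENNReal.toReal_add (measure_ne_top _ _) ENNReal.ofReal_ne_top,
        ENNReal.toReal_ofReal hδ.le] at this
    have e11 : ∀ i j, i ≠ j → p * p ≤ (P n).real (A i ∩ A j) + δ := fun i j hij ↦
      hreal (h11 i j hij)
    have e10 : ∀ i j, i ≠ j → p * p' ≤ (P n).real (A i \ A j) + δ := fun i j hij ↦
      hreal (h10 i j hij)
    have e00 : ∀ i j, i ≠ j → p' * p' ≤ (P n).real ((A i)ᶜ \ A j) + δ := fun i j hij ↦
      hreal (h00 i j hij)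
    have e01 : ∀ i j, i ≠ j → p' * p ≤ (P n).real ((A i)ᶜ ∩ A j) + δ := fun i j hij ↦
      hreal (h01 i j hij)
    have hsplit : ∀ (B : Set (Ω n)) j,
        (P n).real (B ∩ A j) + (P n).real (B \ A j) = (P n).real B := fun B j ↦
      measureReal_inter_add_sdiff (hAm j)
    have hcompl : ∀ i, (P n).real (A i) + (P n).real (A i)ᶜ = 1 := fun i ↦ by
      rw [probReal_compl_eq_one_sub (hAm i)]
      ring
    -- Splitting along `A j` for some other vertex `j` gives at least `p * (p + p') - 2 * δ`.
    have hb : ∀ i, p - 2 * δ ≤ (P n).real (A i) := by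
      intro i
      have : Nontrivial (Fin n) := Fin.nontrivial_iff_two_le.2 hn
      obtain ⟨j, hj⟩ := exists_ne i
      have e1 := e11 i j hj.symm
      have e2 := e10 i j hj.symm
      have e3 := hsplit (A i) j
      nlinarith
    -- The other three outcomes leave at most `1 - 2 * p * p' - p' ^ 2 + 3 * δ`, and `1 + p ^ 2 - (p
    -- + p') ^ 2 ≤ p ^ 2`.
    have ha : ∀ i j, i ≠ j → (P n).real (A i ∩ A j) ≤ p ^ 2 + 3 * δ := by
      intro i j hij
      have e1 := e10 i j hij
      have e2 := e01 i j hij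
      have e3 := e00 i j hij
      have e4 := hsplit (A i) j
      have e5 := hsplit (A i)ᶜ j
      have e6 := hcompl i
      nlinarith
    -- With `a = p ^ 2 + 3 * δ` and `b = p - 2 * δ`, the bound is `1 / n + 3 * δ + 4 * p * δ`, where
    -- `p ≤ 1`.
    refine (CSFP.mul_measureReal_proportion_le (by omega) hAm hp0 (by positivity) hε hb ha).trans ?_
    nlinarith
  refine ENNReal.tendsto_nhds_zero.2 fun η hη ↦ ?_
  obtain ⟨x, hx0, hxη⟩ := ENNReal.lt_iff_exists_nnreal_btwn.1 hη
  have hx : (0 : ℝ) < x := by exact_mod_cast hx0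
  have hn : ∀ᶠ n : ℕ in atTop, 1 / (n : ℝ) < ε ^ 2 * x / 2 :=
    tendsto_one_div_atTop_nhds_zero_nat.eventually (gt_mem_nhds (by positivity))
  -- This `δ` makes `7 * δ` equal to half of `ε ^ 2 * x`. The other half absorbs `1 / n`.
  filter_upwards [hmain (ε ^ 2 * x / 14) (by positivity), hn] with n h1 h2
  refine le_trans ?_ hxη.le
  rw [Fintype.card_fin, ← ENNReal.ofReal_coe_nnreal]
  refine (ENNReal.le_ofReal_iff_toReal_le (measure_ne_top _ _) x.coe_nonneg).2 ?_
  refine le_of_mul_le_mul_left (h1.trans ?_) (by positivity : 0 < ε ^ 2)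
  linarith
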